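/- Cells are the unit squares of the regular square grid, indexed by $\mathbb{Z}^2$. A \emph{simple grid polygon} is a finite set $P$ of (free) cells that is connected via common edges and has no holes, i.e. the remaining (boundary) cells are connected via common edges or corners. An \emph{instance} is a simple grid polygon $P$ with a start cell $s\in P$ that shares an edge with at least one boundary cell. A \emph{tour} is a sequence of cells of $P$ that starts and ends in $s$, contains every cell of $P$, and in which consecutive cells share an edge; each move between consecutive cells is one step. Let $S_{OPT}(P,s)$ be the minimal number of steps of a tour. A (deterministic) \emph{online exploration strategy} $ALG$ decides, knowing only the positions relative to $s$ of the cells visited so far (in their order) and, for each of them, which of its four edge-neighbours are free, to which neighbouring cell to move next or whether to stop; on every instance it has to stop after finitely many steps and to have performed a tour. Let $S_{ALG}(P,s)$ be its number of steps. The strategy is \emph{$C$-competitive} if there is a constant $a\in\mathbb{R}$ with $S_{ALG}(P,s)\le C\cdot S_{OPT}(P,s)+a$ for all instances $(P,s)$. \textbf{Theorem.} Let $ALG$ be an online exploration strategy. For every $\varepsilon>0$ and every $N\in\mathbb{N}$ there is an instance $(P,s)$ such that $P$ has at least $N$ cells, $S_{OPT}(P,s)>0$, and $$\frac{S_{ALG}(P,s)}{S_{OPT}(P,s)}>\frac{13}{11}-\varepsilon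 .$$ Consequently, $ALG$ is not $C$-competitive for any real $C<\frac{13}{11}$. -/

import Mathlib

namespace GridExploration

/-- The cells of the regular square grid. -/
abbrev Cell : Type := ℤ × ℤ

/-- The four directions in which the agent looks and moves. -/
inductive Dir : Type
  | north
  | east
  | south
  | west
  deriving DecidableEq

/-- The displacement of one step in the given direction. -/
def Dir.vec : Dir → Cell
  | .north => (0, 1)
  | .east => (1, 0)
  | .south => (0, -1)
  | .west => (-1, 0)

/-- Two cells are adjacent if they share an edge. -/
def edgeGraph : SimpleGraph Cell where
  Adj a b := |a.1 - b.1| + |a.2 - b.2| = 1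
  symm := ⟨fun a b h => by rw [abs_sub_comm b.1, abs_sub_comm b.2]; exact h⟩
  loopless := ⟨fun a h => by simp at h⟩

/-- Two distinct cells touch if they share an edge or a corner. -/
def touchGraph : SimpleGraph Cell where
  Adj a b := a ≠ b ∧ |a.1 - b.1| ≤ 1 ∧ |a.2 - b.2| ≤ 1
  symm := ⟨fun a b h => by
    rw [abs_sub_comm b.1, abs_sub_comm b.2]; exact ⟨h.1.symm, h.2⟩⟩
  loopless := ⟨fun _ h => h.1 rfl⟩

/-- A simple grid polygon, given by its finite set of free cells; all other cells are boundary
cells. The free cells are connected through common edges, and there is no hole: no set of boundary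
cells is fully surrounded by free cells, that is, the boundary cells are connected through common
edges and corners. (The boundary path of the polygon may touch itself in a corner.) -/
structure IsSimpleGridPolygon (P : Finset Cell) : Prop where
  connected : (edgeGraph.induce (P : Set Cell)).Connected
  no_hole : (touchGraph.induce (P : Set Cell)ᶜ).Preconnected

/-- An instance of the exploration problem: a simple grid polygon `P` together with a free start
cell `s` that is adjacent to a boundary cell. -/
structure IsInstance (P : Finset Cell) (s : Cell) : Prop where
  simple : IsSimpleGridPolygon P
  start_mem : s ∈ P
  start_boundary : ∃ d : Dir, s + d.vec ∉ P

/-- `l` lists the successive cells of a closed walk in `P` that starts and ends at `s` and visits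
every cell of `P`. It has `l.length - 1` steps. -/
structure IsTour (P : Finset Cell) (s : Cell) (l : List Cell) : Prop where
  head_eq : l.head? = some s
  last_eq : l.getLast? = some s
  chain : l.IsChain edgeGraph.Adj
  mem_iff : ∀ c, c ∈ l ↔ c ∈ P

/-- The number of steps of an optimal offline tour. -/
noncomputable def optSteps (P : Finset Cell) (s : Cell) : ℕ :=
  sInf {k | ∃ l : List Cell, IsTour P s l ∧ l.length = k + 1}

/-- The local view of the agent: which of the four neighbouring cells are free. -/
abbrev View : Type := Dir → Bool

/-- What the agent records in cell `c`: the position relative to the start, and the local view. -/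
def observe (P : Finset Cell) (s c : Cell) : Cell × View :=
  (c - s, fun d => decide (c + d.vec ∈ P))

/-- A (deterministic) online strategy. On the basis of the records of all cells visited so far
(latest first, the current cell included) it chooses the direction of the next step, or `none` to
stop. -/
abbrev Strategy : Type := List (Cell × View) → Option Dir

/-- The cells visited by the strategy after `n` decisions, latest first. Once the strategy stops,
nothing is added. -/
def Strategy.visits (A : Strategy) (P : Finset Cell) (s : Cell) : ℕ → List Cell
  | 0 => [s]
  | n + 1 =>
    match A ((A.visits P s n).map (observe P s)) with
    | none => A.visits P s n
    | some d => ((A.visits P s n).headD s + d.vec) :: A.visits P s n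

/-- The strategy decides to stop after `n` steps. -/
def Strategy.StopsAt (A : Strategy) (P : Finset Cell) (s : Cell) (n : ℕ) : Prop :=
  A ((A.visits P s n).map (observe P s)) = none

/-- The number of steps made by the strategy (only meaningful if it stops). -/
noncomputable def Strategy.steps (A : Strategy) (P : Finset Cell) (s : Cell) : ℕ :=
  sInf {n | A.StopsAt P s n}

/-- The strategy solves the instance: it stops, and its path is a tour of `P` from `s` to `s`. In
particular it never steps into a boundary cell. -/
def Strategy.Solves (A : Strategy) (P : Finset Cell) (s : Cell) : Prop :=
  (∃ n, A.StopsAt P s n) ∧ IsTour P s (A.visits P s (A.steps P s))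

/-- An online exploration strategy solves every instance. -/
def Strategy.IsExploration (A : Strategy) : Prop :=
  ∀ (P : Finset Cell) (s : Cell), IsInstance P s → A.Solves P s

/-- `C`-competitiveness, with an additive constant `a`. -/
def Strategy.IsCompetitive (A : Strategy) (C : ℝ) : Prop :=
  ∃ a : ℝ, ∀ (P : Finset Cell) (s : Cell), IsInstance P s →
    (A.steps P s : ℝ) ≤ C * (optSteps P s : ℝ) + a

end GridExploration

/-! The adversary builds the polygon while the strategy walks in it, as a chain of small blocks. A
block is entered from the left through two cells, coded 36 and 45, where 36 is the one used first (a
reflection of the block arranges this). Its last column contains a neck of two cells, and the next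
block hangs behind that neck.

Upper bound for the optimum: every finished block has a walk with `O ≤ 22` entries from 36 to 45
that visits all its cells and contains a step along the neck. Replacing this step by the walk
through the rest of the chain joins all the walks (`Chain.Valid.exists_path`). The closed tour
obtained has length the sum of the `O`, plus 2 for the two cells that end the chain.

Lower bound for the agent: in a block with walk length `O` it pays at least `need O`, which is `O +
2` or `O + 4`, and `13 * O ≤ 11 * need O` (`le_need`), with equality for `O = 22`. The reason is a
finite game. The adversary holds a provisional block. Whenever a new cell is visited, it may pass to
another block that looks the same from all cells visited before. It may also declare that the new
cell already lies behind the neck: until then the two cells to the right of the neck are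
indistinguishable from cells of the block. At a leaf of the tree the block is final, and an
exhaustive search shows that each completion costs at least `need O`. The tree `rootTree` is
explicit and checked by evaluation (`rootTree_check`). `Tree.check_branch`, `Tree.State.cons_new`
and `search_sound` turn the check into statements about walks.

Independence of the blocks: a walk crosses from one block to the next only through the neck
(`Glue.crossing`). Hence neither side sees changes made on the other, and a walk can be cut into its
part in the first block and its part behind the neck. A visit behind the neck costs two crossings.
If the agent comes back through the neck cell by which it left, both crossings are charged to
closing the tour behind the neck. If it comes back through the other one, one of them pays for the
step along the neck in the first block and the other closes the tour. This is why closing costs 2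
from 36 and 1 from 45, and `Glue.split` shows that the charges never exceed the moves made.

Conclusion: `Chain.step` plays one reply on the whole chain without altering anything the agent has
seen, so the deterministic strategy repeats its past moves on the new polygon. The play ends because
each change of the polygon lowers a weight (`Strategy.exists_explored`). The chains have no holes
(`Chain.Valid.no_hole`). Adding the costs of the blocks (`Chain.Inv.cost`) gives `13 * OPT ≤ 11 *
ALG + 48`. The number of blocks is arbitrary, so the additive constant becomes negligible. -/

namespace GridExploration

/-! ### Bit-coded blocks, the search for lower bounds, and the check of a strategy tree. -/

/-- A strategy tree for the adversary in one block. Cells are coded by natural numbers. A leaf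
`leaf p a b` holds a finished block: the code `p` of a path through all its cells, and the two
neck cells `a`, `b`. A node is a list of branches; `br c t r` gives the reaction `t` to a visit
of `c`. -/
inductive Tree : Type
  | leaf (p a b : ℕ)
  | br (c : ℕ) (t r : Tree)
  | nil

/-- The value `f x`; the kernel evaluates `x` first. -/
def force {α : Type} (x : ℕ) (f : ℕ → α) : α := Nat.rec (f 0) (fun n _ => f (n + 1)) x

/-- The set `m` of cells with the cell `i` added. -/
def insertBit (m i : ℕ) : ℕ := m ||| 1 <<< i

/-- The neighbours of a set of cells. -/
def nbrs (m : ℕ) : ℕ := m <<< 1 ||| m >>> 1 ||| (m <<< 9 ||| m >>> 9)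

/-- The set `R`, enlarged by the cells of `V` that can be reached from `R` in one step. -/
def spread (V R : ℕ) : ℕ := R ||| (nbrs R &&& V)

/-- All cells of `m` satisfy `P`. The second argument bounds their number. -/
def allBits (P : ℕ → Bool) : ℕ → ℕ → Bool
  | 0, m => m.beq 0
  | n + 1, m => bif m.beq 0 then true else
      force m.log2 fun i => P i && force (m ^^^ 1 <<< i) fun m' => allBits P n m'

/-- The number of elements, for sets with at most `n` cells. -/
def bitCount : ℕ → ℕ → ℕ
  | 0, _ => 0
  | n + 1, m => bif m.beq 0 then 0 else bitCount n (m ^^^ 1 <<< m.log2) + 1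

/-- `P j c` holds for every cell `c` of `C` outside `V` that can be reached from `R` through
`V` in `j' + 1` steps with `j' < n`, where `j` is the number of the step. -/
def layers (P : ℕ → ℕ → Bool) (V C : ℕ) : ℕ → ℕ → ℕ → ℕ → Bool
  | 0, _, _, _ => true
  | n + 1, R, seen, j =>
    force (nbrs R &&& (C ^^^ seen)) fun T => allBits (P j) 22 T &&
      force (spread V R) fun R' => force (seen ||| T) fun s => force (j + 1) fun j' =>
        layers P V C n R' s j'

/-- The walk from `R` through `V` back to the entry of the block is not too short. -/
def closing (V : ℕ) : ℕ → ℕ → Bool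
  | 0, _ => true
  | n + 1, R => !R.testBit 45 && (n.beq 0 || !R.testBit 36) && closing V n (spread V R)

/-- Every way to complete the exploration of `C`, if `V` is visited, `n` cells are not, and the
agent is in `p` after `k` steps, costs at least `m`. -/
def search (C m : ℕ) : ℕ → ℕ → ℕ → ℕ → Bool
  | 0, V, p, k => closing V (m - k - 1) (1 <<< p)
  | n + 1, V, p, k =>
    layers (fun j c => force (insertBit V c) fun V' => force (k + j + 1) fun k' =>
      search C m n V' c k') V C (m - k - (n + 2)) (1 <<< p) V 0

/-- The number of steps before a walk from `R` through `V` enters `c`. -/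
def layerOf (V c : ℕ) : ℕ → ℕ → ℕ
  | 0, _ => 0
  | n + 1, R => bif (nbrs R).testBit c then 0 else layerOf V c n (spread V R) + 1

/-- The path with code `p` that starts in `c`. -/
def decodePath : ℕ → ℕ → ℕ → List ℕ
  | 0, _, c => [c]
  | n + 1, p, c =>
    bif p.ble 1 then [c] else
      c :: decodePath n (p / 4)
        (bif (p % 4).beq 0 then c + 1 else bif (p % 4).beq 1 then c - 1 else
          bif (p % 4).beq 2 then c + 9 else c - 9)

/-- The set of the cells in a list. -/
def maskOf : List ℕ → ℕ
  | [] => 0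
  | c :: l => insertBit (maskOf l) c

/-- A finished block: a path through its cells, the set of its cells, and the neck. -/
structure Block : Type where
  path : List ℕ
  mask : ℕ
  a : ℕ
  b : ℕ

/-- The block with path code `p` and neck `a`, `b`. -/
def mkBlock (p a b : ℕ) : Block := ⟨decodePath 22 p 36, maskOf (decodePath 22 p 36), a, b⟩

/-- The first finished block in a tree. -/
def Tree.block : Tree → Block
  | .leaf p a b => mkBlock p a b
  | .br _ t _ => t.block
  | .nil => ⟨[], 0, 0, 0⟩

/-- Whether the list of branches is empty. -/
def Tree.isNil : Tree → Bool
  | .nil => true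
  | _ => false

def Tree.isLeaf : Tree → Bool
  | .leaf _ _ _ => true
  | _ => false

/-- The list contains one of the steps from `a` to `b` and from `b` to `a`. -/
def hasStep (a b : ℕ) : List ℕ → Bool
  | x :: y :: l => (x.beq a && y.beq b) || (x.beq b && y.beq a) || hasStep a b (y :: l)
  | _ => false

/-- The number of local steps that the agent needs in a block with a tour of length `O`. -/
def need (O : ℕ) : ℕ := bif O.ble 10 then O + 2 else O + 4

/-- The first column. -/
def columnMask : ℕ := 0x8040201008040201

/-- The columns up to `A`. -/
def boxTo (A : ℕ) : ℕ := (2 ^ (A + 1) - 1) * columnMask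

/-- The cells that a block may use. -/
def blockBox : ℕ := 0x3f1fcfe7f3f9f8fc7e

/-- The first and the last row. -/
def outerRows : ℕ := 0xff80000000000001ff

/-- All cells of `m` are connected, through edges and corners, to cells of `f`. -/
def flood (m : ℕ) : ℕ → ℕ → Bool
  | 0, f => f.beq m
  | n + 1, f => bif f.beq m then true else
      flood m n ((f ||| f <<< 1 ||| f >>> 1 ||| (f ||| f <<< 1 ||| f >>> 1) <<< 9 |||
        (f ||| f <<< 1 ||| f >>> 1) >>> 9) &&& m)

/-- The lower one of the two neck cells. -/
def Block.low (B : Block) : ℕ := bif B.a.ble B.b then B.a else B.b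

/-- The column of the neck. -/
def Block.col (B : Block) : ℕ := B.a % 9

/-- The block is simple, has a clear neck, and is traversed by its path. -/
def Block.valid (B : Block) : Bool :=
  B.col.ble 6 && B.low.ble 62 &&
    ((B.low.beq B.a && (B.low + 9).beq B.b) || (B.low.beq B.b && (B.low + 9).beq B.a)) &&
    (B.mask &&& (blockBox &&& boxTo B.col)).beq B.mask &&
    (B.mask &&& 0x8040201 <<< B.low >>> 9).beq (0x201 <<< B.low) &&
    hasStep B.a B.b B.path && (B.path.getLastD 0).beq 45 &&
    B.path.length.ble 22 && (B.path.length % 2).beq 0 &&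
    flood (boxTo B.col ^^^ B.mask) 20
      ((boxTo B.col ^^^ B.mask) &&& (outerRows ||| columnMask <<< B.col))

/-- The cells of the block, with the two exit cells if the exit has not been used (`x = 0`). -/
def Block.full (B : Block) (x : ℕ) : ℕ :=
  bif x.beq 0 then insertBit (insertBit B.mask (B.a + 1)) (B.b + 1) else B.mask

/-- The cells of `V` and their free neighbours. -/
def Block.known (B : Block) (V x : ℕ) : ℕ := V ||| (nbrs V &&& B.full x)

/-- The strategy tree is correct from the position where the cells of `V` are visited, those of
`F` are known, and the agent is in `p` after `k` local steps. The exit `x`, `y` is fixed unless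
`x = 0`. The branches have to cover `rem`. -/
def Tree.check : Tree → ℕ → ℕ → ℕ → ℕ → ℕ → ℕ → ℕ → Bool
  | .leaf q a b, V, _, p, k, x, y, _ =>
    (mkBlock q a b).valid && (V &&& (mkBlock q a b).mask).beq V &&
      (x.beq 0 || (x.beq a && y.beq b)) &&
      search (mkBlock q a b).mask (need (mkBlock q a b).path.length)
        (bitCount 72 ((mkBlock q a b).mask ^^^ V)) V p k
  | .nil, _, _, _, _, _, _, rem => rem.beq 0
  | .br c t r, V, F, p, k, x, y, rem =>
    !t.isNil && !r.isLeaf && rem.testBit c && r.check V F p k x y (rem ^^^ 1 <<< c) &&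
      F.beq (t.block.known V x) &&
      bif t.block.mask.testBit c then
        t.check (insertBit V c) (t.block.known (insertBit V c) x) c
          (k + layerOf V c 22 (1 <<< p) + 1) x y
          (t.block.known (insertBit V c) x ^^^ insertBit V c)
      else
        x.beq 0 && (t.block.a + 1).beq c &&
          t.check V (t.block.known V t.block.a) t.block.a (k + layerOf V c 22 (1 <<< p))
            t.block.a t.block.b (t.block.known V t.block.a ^^^ V)

/-! ### The explicit strategy tree for one block. -/

/-- The strategy of the adversary. -/
def rootTree : Tree :=
  .br 27 (.br 28 (.br 19 (.br 10 (.br 11 (.br 12 (.br 21 (.br 20 (.br 29 (.br 30 (.br 31 (.br 22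
  (.br 23 (.br 39 (.br 38 (.leaf 452621881120 22 31) (.br 48 (.br 47 (.leaf 6432353214243 22 31)
  (.br 38 (.leaf 452621881120 22 31) (.br 37 (.leaf 385915948483 22 31) (.br 45 (.leaf
  8357375249859 22 31) .nil)))) (.br 37 (.leaf 384305335747 22 31) (.br 45 (.leaf 8355764637123
  22 31) .nil)))) (.br 38 (.leaf 452621880544 22 31) (.br 37 (.leaf 23997844931 22 31) (.br 45
  (.leaf 522214051267 22 31) .nil)))) (.br 32 (.leaf 452621856960 23 32) (.br 39 (.leaf
  7241949712256 23 32) (.br 38 (.leaf 452621880544 22 31) (.br 37 (.leaf 23997844931 22 31) (.br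
  45 (.leaf 522214051267 22 31) .nil)))))) (.br 32 (.br 22 (.br 39 (.br 38 (.leaf 452621881120 31
  22) (.br 48 (.br 47 (.leaf 6432353214243 31 22) (.br 38 (.leaf 452621881120 31 22) (.br 37
  (.leaf 385915948483 31 22) (.br 45 (.leaf 8357375249859 31 22) .nil)))) (.br 37 (.leaf
  384305335747 31 22) (.br 45 (.leaf 8355764637123 31 22) .nil)))) (.br 38 (.leaf 452621880544 31
  22) (.br 37 (.leaf 23997844931 31 22) (.br 45 (.leaf 522214051267 31 22) .nil)))) (.br 39
  (.leaf 452621881216 31 22) (.br 38 (.leaf 452621880544 31 22) (.br 37 (.leaf 23997844931 31 22)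
  (.br 45 (.leaf 522214051267 31 22) .nil))))) (.br 39 (.leaf 452621881216 22 31) (.br 38 (.leaf
  452621880544 22 31) (.br 37 (.leaf 23997844931 22 31) (.br 45 (.leaf 522214051267 22 31)
  .nil)))))) (.br 39 (.leaf 452621881216 22 31) (.br 22 (.br 23 (.br 31 (.br 39 (.br 38 (.leaf
  452621881120 22 31) (.br 48 (.br 47 (.leaf 6432353214243 22 31) (.br 38 (.leaf 452621881120 22
  31) (.br 37 (.leaf 385915948483 22 31) (.br 45 (.leaf 8357375249859 22 31) .nil)))) (.br 37
  (.leaf 384305335747 22 31) (.br 45 (.leaf 8355764637123 22 31) .nil)))) (.br 38 (.leaf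
  452621880544 22 31) (.br 37 (.leaf 23997844931 22 31) (.br 45 (.leaf 522214051267 22 31)
  .nil)))) (.br 39 (.leaf 452621881216 22 31) (.br 38 (.leaf 452621880544 22 31) (.br 37 (.leaf
  23997844931 22 31) (.br 45 (.leaf 522214051267 22 31) .nil))))) (.br 31 (.leaf 452621856960 23
  32) (.br 39 (.leaf 452621881216 22 31) (.br 38 (.leaf 452621880544 22 31) (.br 37 (.leaf
  23997844931 22 31) (.br 45 (.leaf 522214051267 22 31) .nil)))))) (.br 38 (.leaf 452621880544 22
  31) (.br 37 (.leaf 23997844931 22 31) (.br 45 (.leaf 522214051267 22 31) .nil)))))) (.br 38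
  (.leaf 452621880544 22 31) (.br 37 (.leaf 24061008899 22 31) (.br 22 (.br 23 (.br 31 (.br 30
  (.br 39 (.br 38 (.leaf 452621881120 22 31) (.br 48 (.br 47 (.leaf 6432353214243 22 31) (.br 38
  (.leaf 452621881120 22 31) (.br 37 (.leaf 385915948483 22 31) (.br 45 (.leaf 8357375249859 22
  31) .nil)))) (.br 37 (.leaf 384305335747 22 31) (.br 45 (.leaf 8355764637123 22 31) .nil))))
  (.br 38 (.leaf 452621880544 22 31) (.br 37 (.leaf 23997844931 22 31) (.br 45 (.leaf
  522214051267 22 31) .nil)))) (.br 38 (.leaf 452621880544 22 31) (.br 37 (.leaf 24061008899 22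
  31) (.br 45 (.leaf 522277215235 22 31) .nil)))) (.br 30 (.leaf 28288867520 22 31) (.br 38
  (.leaf 452621880544 22 31) (.br 37 (.leaf 24061008899 22 31) (.br 45 (.leaf 522277215235 22 31)
  .nil))))) (.br 31 (.leaf 7260043950128 23 32) (.br 30 (.leaf 28288867520 22 31) (.br 38 (.leaf
  452621880544 22 31) (.br 37 (.leaf 24061008899 22 31) (.br 45 (.leaf 522277215235 22 31)
  .nil)))))) (.br 45 (.leaf 522277215235 22 31) .nil))))) (.br 22 (.br 23 (.br 31 (.br 30 (.br 29
  (.br 38 (.br 37 (.leaf 452621880544 22 31) (.br 39 (.br 37 (.leaf 452621880544 22 31) (.br 47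
  (.br 46 (.leaf 6312098401731 22 31) (.br 56 (.leaf 8077061524931 22 31) (.br 37 (.leaf
  6183249382851 22 31) (.br 45 (.leaf 8077061524931 22 31) .nil)))) (.br 45 (.leaf 8357576576451
  22 31) .nil))) (.br 47 (.leaf 6432353214243 22 31) (.br 45 (.leaf 8357576576451 22 31) .nil))))
  (.br 37 (.leaf 23997844931 22 31) (.br 39 (.br 38 (.leaf 452621881120 22 31) (.br 48 (.br 47
  (.leaf 6432353214243 22 31) (.br 38 (.leaf 452621881120 22 31) (.br 37 (.leaf 385915948483 22
  31) (.br 45 (.leaf 8357375249859 22 31) .nil)))) (.br 37 (.leaf 384305335747 22 31) (.br 45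
  (.leaf 8355764637123 22 31) .nil)))) (.br 45 (.leaf 522214051267 22 31) .nil)))) (.br 39 (.br
  38 (.leaf 452621881120 22 31) (.br 48 (.br 47 (.leaf 6432353214243 22 31) (.br 38 (.leaf
  452621881120 22 31) (.br 29 (.leaf 452621881120 22 31) (.br 37 (.leaf 385915948483 22 31) (.br
  45 (.leaf 8357375249859 22 31) .nil))))) (.br 29 (.leaf 452621881216 22 31) (.br 37 (.leaf
  384305335747 22 31) (.br 45 (.leaf 8355764637123 22 31) .nil))))) (.br 37 (.leaf 23997844931 22
  31) (.br 45 (.leaf 8360787561987 22 31) .nil)))) (.br 29 (.leaf 28359547952 22 31) (.br 37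
  (.leaf 24061008899 22 31) (.br 45 (.leaf 522549222403 22 31) .nil)))) (.br 30 (.leaf
  28288867520 22 31) (.br 29 (.leaf 28359547952 22 31) (.br 37 (.leaf 24061008899 22 31) (.br 45
  (.leaf 522549222403 22 31) .nil))))) (.br 31 (.br 30 (.leaf 7260043939340 23 32) (.br 32 (.br
  23 (.br 24 (.br 30 (.leaf 452621856960 23 32) (.br 29 (.leaf 453752746032 23 32) (.br 37 (.leaf
  384976121859 23 32) (.br 45 (.leaf 8360787537923 23 32) .nil)))) (.br 33 (.leaf 7260043853836
  24 33) (.br 30 (.leaf 452621856960 23 32) (.br 29 (.leaf 453752746032 23 32) (.br 37 (.leaf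
  384976121859 23 32) (.br 45 (.leaf 8360787537923 23 32) .nil)))))) (.br 33 (.br 23 (.br 30
  (.leaf 452621856960 32 23) (.br 29 (.leaf 453752746032 32 23) (.br 37 (.leaf 384976121859 32
  23) (.br 45 (.leaf 8360787537923 32 23) .nil)))) (.br 30 (.leaf 7260043939340 32 23) (.br 29
  (.leaf 453752746032 32 23) (.br 37 (.leaf 384976121859 32 23) (.br 45 (.leaf 8360787537923 32
  23) .nil))))) (.br 30 (.leaf 7260043939340 23 32) (.br 29 (.leaf 453752746032 23 32) (.br 37
  (.leaf 384976121859 23 32) (.br 45 (.leaf 8360787537923 23 32) .nil)))))) (.br 23 (.br 24 (.br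
  32 (.br 30 (.leaf 452621856960 23 32) (.br 29 (.leaf 453752746032 23 32) (.br 37 (.leaf
  384976121859 23 32) (.br 45 (.leaf 8360787537923 23 32) .nil)))) (.br 30 (.leaf 7260043939340
  23 32) (.br 29 (.leaf 453752746032 23 32) (.br 37 (.leaf 384976121859 23 32) (.br 45 (.leaf
  8360787537923 23 32) .nil))))) (.br 32 (.leaf 7260043853836 24 33) (.br 30 (.leaf 7260043939340
  23 32) (.br 29 (.leaf 453752746032 23 32) (.br 37 (.leaf 384976121859 23 32) (.br 45 (.leaf
  8360787537923 23 32) .nil)))))) (.br 29 (.leaf 28359547952 22 31) (.br 37 (.leaf 24061008899 22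
  31) (.br 45 (.leaf 522549222403 22 31) .nil)))))) (.br 30 (.leaf 7260043939340 23 32) (.br 29
  (.leaf 28359547952 22 31) (.br 37 (.leaf 24061008899 22 31) (.br 45 (.leaf 522549222403 22 31)
  .nil)))))) (.br 30 (.leaf 28288867520 22 31) (.br 37 (.leaf 24061008899 22 31) (.br 45 (.leaf
  522549222403 22 31) .nil))))) (.br 22 (.br 23 (.br 31 (.br 30 (.br 29 (.br 20 (.br 38 (.br 37
  (.leaf 452621880544 22 31) (.br 39 (.br 37 (.leaf 452621880544 22 31) (.br 47 (.br 46 (.leaf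
  6312098401731 22 31) (.br 56 (.leaf 8077061524931 22 31) (.br 37 (.leaf 6183249382851 22 31)
  (.br 45 (.leaf 8077061524931 22 31) .nil)))) (.br 45 (.leaf 8357576576451 22 31) .nil))) (.br
  47 (.leaf 6432353214243 22 31) (.br 45 (.leaf 8357576576451 22 31) .nil)))) (.br 37 (.leaf
  23997844931 22 31) (.br 39 (.br 38 (.leaf 452621881120 22 31) (.br 48 (.br 47 (.leaf
  6432353214243 22 31) (.br 38 (.leaf 452621881120 22 31) (.br 37 (.leaf 385915948483 22 31) (.br
  45 (.leaf 8357375249859 22 31) .nil)))) (.br 37 (.leaf 384305335747 22 31) (.br 45 (.leaf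
  8355764637123 22 31) .nil)))) (.br 45 (.leaf 522214051267 22 31) .nil)))) (.br 38 (.leaf
  452621880544 22 31) (.br 37 (.leaf 23997844931 22 31) (.br 39 (.leaf 452621881216 22 31) (.br
  45 (.leaf 522214051267 22 31) .nil))))) (.br 39 (.br 38 (.leaf 452621881120 22 31) (.br 48 (.br
  47 (.leaf 6432353214243 22 31) (.br 38 (.leaf 452621881120 22 31) (.br 29 (.leaf 452621881120
  22 31) (.br 20 (.leaf 452621881120 22 31) (.br 37 (.leaf 385915948483 22 31) (.br 45 (.leaf
  8357375249859 22 31) .nil)))))) (.br 29 (.leaf 452621881216 22 31) (.br 20 (.leaf 452621881216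
  22 31) (.br 37 (.leaf 384305335747 22 31) (.br 45 (.leaf 8355764637123 22 31) .nil)))))) (.br
  20 (.br 29 (.br 38 (.br 37 (.leaf 452621880544 22 31) (.br 39 (.br 37 (.leaf 452621880544 22
  31) (.br 47 (.br 46 (.leaf 6312098401731 22 31) (.br 56 (.leaf 8077061524931 22 31) (.br 37
  (.leaf 6183249382851 22 31) (.br 45 (.leaf 8077061524931 22 31) .nil)))) (.br 45 (.leaf
  8357576576451 22 31) .nil))) (.br 47 (.leaf 6432353214243 22 31) (.br 45 (.leaf 8357576576451
  22 31) .nil)))) (.br 37 (.leaf 23997844931 22 31) (.br 39 (.br 38 (.leaf 452621881120 22 31)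
  (.br 48 (.br 47 (.leaf 6432353214243 22 31) (.br 38 (.leaf 452621881120 22 31) (.br 37 (.leaf
  385915948483 22 31) (.br 45 (.leaf 8357375249859 22 31) .nil)))) (.br 37 (.leaf 384305335747 22
  31) (.br 45 (.leaf 8355764637123 22 31) .nil)))) (.br 45 (.leaf 522214051267 22 31) .nil))))
  (.br 37 (.leaf 23997844931 22 31) (.br 39 (.leaf 452621881216 22 31) (.br 45 (.leaf
  8360787561987 22 31) .nil)))) (.br 37 (.leaf 23997844931 22 31) (.br 45 (.leaf 8360787561987 22
  31) .nil))))) (.br 20 (.br 29 (.br 30 (.br 39 (.br 38 (.leaf 452621881120 22 31) (.br 48 (.br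
  47 (.leaf 6432353214243 22 31) (.br 38 (.leaf 452621881120 22 31) (.br 37 (.leaf 385915948483
  22 31) (.br 45 (.leaf 8357375249859 22 31) .nil)))) (.br 37 (.leaf 384305335747 22 31) (.br 45
  (.leaf 8355764637123 22 31) .nil)))) (.br 38 (.leaf 452621880544 22 31) (.br 37 (.leaf
  23997844931 22 31) (.br 45 (.leaf 522214051267 22 31) .nil)))) (.br 38 (.leaf 452621880544 22
  31) (.br 37 (.leaf 24061008899 22 31) (.br 45 (.leaf 522277215235 22 31) .nil)))) (.br 30
  (.leaf 28288867520 22 31) (.br 37 (.leaf 24061008899 22 31) (.br 45 (.leaf 522549222403 22 31)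
  .nil)))) (.br 29 (.leaf 28359547952 22 31) (.br 37 (.leaf 24061008899 22 31) (.br 45 (.leaf
  522549222403 22 31) .nil))))) (.br 20 (.br 29 (.br 30 (.br 31 (.br 39 (.br 38 (.leaf
  452621881120 22 31) (.br 48 (.br 47 (.leaf 6432353214243 22 31) (.br 38 (.leaf 452621881120 22
  31) (.br 37 (.leaf 385915948483 22 31) (.br 45 (.leaf 8357375249859 22 31) .nil)))) (.br 37
  (.leaf 384305335747 22 31) (.br 45 (.leaf 8355764637123 22 31) .nil)))) (.br 38 (.leaf
  452621880544 22 31) (.br 37 (.leaf 23997844931 22 31) (.br 45 (.leaf 522214051267 22 31)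
  .nil)))) (.br 39 (.leaf 452621881216 22 31) (.br 38 (.leaf 452621880544 22 31) (.br 37 (.leaf
  23997844931 22 31) (.br 45 (.leaf 522214051267 22 31) .nil))))) (.br 38 (.leaf 452621880544 22
  31) (.br 37 (.leaf 24061008899 22 31) (.br 31 (.leaf 28359547952 22 31) (.br 45 (.leaf
  522277215235 22 31) .nil))))) (.br 30 (.leaf 28288867520 22 31) (.br 31 (.br 30 (.leaf
  28288867520 22 31) (.br 29 (.leaf 28359547952 22 31) (.br 37 (.leaf 24061008899 22 31) (.br 45
  (.leaf 522549222403 22 31) .nil)))) (.br 37 (.leaf 24061008899 22 31) (.br 45 (.leaf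
  522549222403 22 31) .nil))))) (.br 30 (.leaf 28288867520 22 31) (.br 29 (.leaf 28359547952 22
  31) (.br 37 (.leaf 24061008899 22 31) (.br 45 (.leaf 522549222403 22 31) .nil)))))) (.br 31
  (.br 30 (.leaf 452621856960 23 32) (.br 32 (.br 30 (.br 29 (.br 20 (.br 38 (.br 37 (.leaf
  452621880544 31 22) (.br 39 (.br 37 (.leaf 452621880544 31 22) (.br 47 (.br 46 (.leaf
  6312098401731 31 22) (.br 56 (.leaf 8077061524931 31 22) (.br 37 (.leaf 6183249382851 31 22)
  (.br 45 (.leaf 8077061524931 31 22) .nil)))) (.br 45 (.leaf 8357576576451 31 22) .nil))) (.br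
  47 (.leaf 6432353214243 31 22) (.br 45 (.leaf 8357576576451 31 22) .nil)))) (.br 37 (.leaf
  23997844931 31 22) (.br 39 (.br 38 (.leaf 452621881120 31 22) (.br 48 (.br 47 (.leaf
  6432353214243 31 22) (.br 38 (.leaf 452621881120 31 22) (.br 37 (.leaf 385915948483 31 22) (.br
  45 (.leaf 8357375249859 31 22) .nil)))) (.br 37 (.leaf 384305335747 31 22) (.br 45 (.leaf
  8355764637123 31 22) .nil)))) (.br 45 (.leaf 522214051267 31 22) .nil)))) (.br 38 (.leaf
  452621880544 31 22) (.br 37 (.leaf 23997844931 31 22) (.br 39 (.leaf 452621881216 31 22) (.br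
  45 (.leaf 522214051267 31 22) .nil))))) (.br 39 (.br 38 (.leaf 452621881120 31 22) (.br 48 (.br
  47 (.leaf 6432353214243 31 22) (.br 38 (.leaf 452621881120 31 22) (.br 29 (.leaf 452621881120
  31 22) (.br 20 (.leaf 452621881120 31 22) (.br 37 (.leaf 385915948483 31 22) (.br 45 (.leaf
  8357375249859 31 22) .nil)))))) (.br 29 (.leaf 452621881216 31 22) (.br 20 (.leaf 452621881216
  31 22) (.br 37 (.leaf 384305335747 31 22) (.br 45 (.leaf 8355764637123 31 22) .nil)))))) (.br
  20 (.br 29 (.br 38 (.br 37 (.leaf 452621880544 31 22) (.br 39 (.br 37 (.leaf 452621880544 31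
  22) (.br 47 (.br 46 (.leaf 6312098401731 31 22) (.br 56 (.leaf 8077061524931 31 22) (.br 37
  (.leaf 6183249382851 31 22) (.br 45 (.leaf 8077061524931 31 22) .nil)))) (.br 45 (.leaf
  8357576576451 31 22) .nil))) (.br 47 (.leaf 6432353214243 31 22) (.br 45 (.leaf 8357576576451
  31 22) .nil)))) (.br 37 (.leaf 23997844931 31 22) (.br 39 (.br 38 (.leaf 452621881120 31 22)
  (.br 48 (.br 47 (.leaf 6432353214243 31 22) (.br 38 (.leaf 452621881120 31 22) (.br 37 (.leaf
  385915948483 31 22) (.br 45 (.leaf 8357375249859 31 22) .nil)))) (.br 37 (.leaf 384305335747 31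
  22) (.br 45 (.leaf 8355764637123 31 22) .nil)))) (.br 45 (.leaf 522214051267 31 22) .nil))))
  (.br 37 (.leaf 23997844931 31 22) (.br 39 (.leaf 452621881216 31 22) (.br 45 (.leaf
  8360787561987 31 22) .nil)))) (.br 37 (.leaf 23997844931 31 22) (.br 45 (.leaf 8360787561987 31
  22) .nil))))) (.br 20 (.br 29 (.br 30 (.br 39 (.br 38 (.leaf 452621881120 31 22) (.br 48 (.br
  47 (.leaf 6432353214243 31 22) (.br 38 (.leaf 452621881120 31 22) (.br 37 (.leaf 385915948483
  31 22) (.br 45 (.leaf 8357375249859 31 22) .nil)))) (.br 37 (.leaf 384305335747 31 22) (.br 45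
  (.leaf 8355764637123 31 22) .nil)))) (.br 38 (.leaf 452621880544 31 22) (.br 37 (.leaf
  23997844931 31 22) (.br 45 (.leaf 522214051267 31 22) .nil)))) (.br 38 (.leaf 452621880544 31
  22) (.br 37 (.leaf 24061008899 31 22) (.br 45 (.leaf 522277215235 31 22) .nil)))) (.br 30
  (.leaf 28288867520 31 22) (.br 37 (.leaf 24061008899 31 22) (.br 45 (.leaf 522549222403 31 22)
  .nil)))) (.br 29 (.leaf 28359547952 31 22) (.br 37 (.leaf 24061008899 31 22) (.br 45 (.leaf
  522549222403 31 22) .nil))))) (.br 23 (.br 24 (.br 32 (.br 30 (.leaf 452621856960 23 32) (.br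
  20 (.leaf 453752745996 23 32) (.br 29 (.leaf 453752746032 23 32) (.br 37 (.leaf 384976121859 23
  32) (.br 45 (.leaf 8360787537923 23 32) .nil))))) (.br 20 (.leaf 453752745996 23 32) (.br 30
  (.leaf 7260043939340 23 32) (.br 29 (.leaf 453752746032 23 32) (.br 37 (.leaf 384976121859 23
  32) (.br 45 (.leaf 8360787537923 23 32) .nil)))))) (.br 32 (.leaf 7260043853836 24 33) (.br 20
  (.leaf 453752745996 23 32) (.br 30 (.leaf 7260043939340 23 32) (.br 29 (.leaf 453752746032 23
  32) (.br 37 (.leaf 384976121859 23 32) (.br 45 (.leaf 8360787537923 23 32) .nil))))))) (.br 20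
  (.leaf 453752745996 23 32) (.br 29 (.leaf 28359547952 22 31) (.br 37 (.leaf 24061008899 22 31)
  (.br 45 (.leaf 522549222403 22 31) .nil))))))) (.br 20 (.br 29 (.leaf 7260043922480 14 23) (.br
  30 (.leaf 7260043939340 23 32) (.br 23 (.br 24 (.br 32 (.br 31 (.br 30 (.leaf 452621856960 23
  32) (.br 29 (.leaf 453752746032 23 32) (.br 37 (.leaf 384976121859 23 32) (.br 45 (.leaf
  8360787537923 23 32) .nil)))) (.br 30 (.leaf 7260043939340 23 32) (.br 29 (.leaf 453752746032
  23 32) (.br 37 (.leaf 384976121859 23 32) (.br 45 (.leaf 8360787537923 23 32) .nil))))) (.br 31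
  (.leaf 7260043950092 23 32) (.br 30 (.leaf 7260043939340 23 32) (.br 29 (.leaf 453752746032 23
  32) (.br 37 (.leaf 384976121859 23 32) (.br 45 (.leaf 8360787537923 23 32) .nil)))))) (.br 32
  (.leaf 7260043853836 24 33) (.br 31 (.leaf 7260043950092 23 32) (.br 30 (.leaf 7260043939340 23
  32) (.br 29 (.leaf 453752746032 23 32) (.br 37 (.leaf 384976121859 23 32) (.br 45 (.leaf
  8360787537923 23 32) .nil))))))) (.br 31 (.leaf 7260043950092 23 32) (.br 37 (.leaf 24061008899
  22 31) (.br 45 (.leaf 522549222403 22 31) .nil)))))) (.br 30 (.leaf 28288867520 22 31) (.br 29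
  (.leaf 28359547952 22 31) (.br 37 (.leaf 24061008899 22 31) (.br 45 (.leaf 522549222403 22 31)
  .nil))))))) (.br 30 (.br 29 (.br 20 (.br 22 (.br 23 (.br 31 (.br 39 (.br 38 (.leaf 452621881120
  22 31) (.br 48 (.br 47 (.leaf 6432353214243 22 31) (.br 38 (.leaf 452621881120 22 31) (.br 37
  (.leaf 385915948483 22 31) (.br 45 (.leaf 8357375249859 22 31) .nil)))) (.br 37 (.leaf
  384305335747 22 31) (.br 45 (.leaf 8355764637123 22 31) .nil)))) (.br 38 (.leaf 452621880544 22
  31) (.br 37 (.leaf 23997844931 22 31) (.br 45 (.leaf 522214051267 22 31) .nil)))) (.br 39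
  (.leaf 452621881216 22 31) (.br 38 (.leaf 452621880544 22 31) (.br 37 (.leaf 23997844931 22 31)
  (.br 45 (.leaf 522214051267 22 31) .nil))))) (.br 31 (.leaf 452621856960 23 32) (.br 39 (.leaf
  452621881216 22 31) (.br 38 (.leaf 452621880544 22 31) (.br 37 (.leaf 23997844931 22 31) (.br
  45 (.leaf 522214051267 22 31) .nil)))))) (.br 38 (.leaf 452621880544 22 31) (.br 31 (.leaf
  28288867520 22 31) (.br 37 (.leaf 23997844931 22 31) (.br 39 (.leaf 452621881216 22 31) (.br 45
  (.leaf 522214051267 22 31) .nil)))))) (.br 38 (.leaf 452621880544 22 31) (.br 31 (.leaf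
  7260052288256 23 32) (.br 37 (.leaf 23997844931 22 31) (.br 39 (.leaf 452621881216 22 31) (.br
  22 (.leaf 28288867520 22 31) (.br 45 (.leaf 522214051267 22 31) .nil))))))) (.br 31 (.br 22
  (.leaf 452621856960 23 32) (.br 32 (.br 22 (.br 20 (.br 29 (.br 38 (.br 37 (.leaf 452621880544
  31 22) (.br 39 (.br 37 (.leaf 452621880544 31 22) (.br 47 (.br 46 (.leaf 6312098401731 31 22)
  (.br 56 (.leaf 8077061524931 31 22) (.br 37 (.leaf 6183249382851 31 22) (.br 45 (.leaf
  8077061524931 31 22) .nil)))) (.br 45 (.leaf 8357576576451 31 22) .nil))) (.br 47 (.leaf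
  6432353214243 31 22) (.br 45 (.leaf 8357576576451 31 22) .nil)))) (.br 37 (.leaf 23997844931 31
  22) (.br 39 (.br 38 (.leaf 452621881120 31 22) (.br 48 (.br 47 (.leaf 6432353214243 31 22) (.br
  38 (.leaf 452621881120 31 22) (.br 37 (.leaf 385915948483 31 22) (.br 45 (.leaf 8357375249859
  31 22) .nil)))) (.br 37 (.leaf 384305335747 31 22) (.br 45 (.leaf 8355764637123 31 22) .nil))))
  (.br 45 (.leaf 522214051267 31 22) .nil)))) (.br 37 (.leaf 23997844931 31 22) (.br 39 (.leaf
  452621881216 31 22) (.br 45 (.leaf 8360787561987 31 22) .nil)))) (.br 29 (.leaf 28288867520 31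
  22) (.br 39 (.leaf 452621881216 31 22) (.br 37 (.leaf 23997844931 31 22) (.br 45 (.leaf
  8360787561987 31 22) .nil))))) (.br 29 (.leaf 28288867520 31 22) (.br 39 (.leaf 452621881216 31
  22) (.br 20 (.leaf 453752770060 31 22) (.br 37 (.leaf 23997844931 31 22) (.br 45 (.leaf
  8360787561987 31 22) .nil)))))) (.br 29 (.leaf 28288867520 22 31) (.br 39 (.leaf 452621881216
  22 31) (.br 20 (.leaf 453752770060 22 31) (.br 37 (.leaf 23997844931 22 31) (.br 45 (.leaf
  8360787561987 22 31) .nil))))))) (.br 39 (.leaf 452621881120 22 31) (.br 20 (.leaf 28288867520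
  22 31) (.br 22 (.leaf 28288867520 22 31) (.br 37 (.leaf 23997844931 22 31) (.br 45 (.leaf
  8360787561987 22 31) .nil))))))) (.br 29 (.leaf 28359547952 22 31) (.br 37 (.leaf 24061008899
  22 31) (.br 45 (.leaf 522549222403 22 31) .nil)))))) (.br 20 (.br 21 (.br 22 (.br 23 (.br 31
  (.br 29 (.br 38 (.br 37 (.leaf 453754359776 22 31) (.br 47 (.br 46 (.leaf 6312165253363 22 31)
  (.br 56 (.leaf 8077128376563 22 31) (.br 37 (.leaf 6183316234483 22 31) (.br 45 (.leaf
  8077128376563 22 31) .nil)))) (.br 45 (.leaf 8357643428083 22 31) .nil))) (.br 37 (.leaf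
  24064696563 22 31) (.br 45 (.leaf 522280902899 22 31) .nil))) (.br 37 (.leaf 24064696563 22 31)
  (.br 45 (.leaf 522549321923 22 31) .nil))) (.br 29 (.leaf 28359647472 22 31) (.br 37 (.leaf
  24064696563 22 31) (.br 45 (.leaf 522549321923 22 31) .nil)))) (.br 31 (.br 32 (.br 29 (.br 38
  (.br 37 (.leaf 453754359776 31 22) (.br 47 (.br 46 (.leaf 6312165253363 31 22) (.br 56 (.leaf
  8077128376563 31 22) (.br 37 (.leaf 6183316234483 31 22) (.br 45 (.leaf 8077128376563 31 22)
  .nil)))) (.br 45 (.leaf 8357643428083 31 22) .nil))) (.br 37 (.leaf 24064696563 31 22) (.br 45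
  (.leaf 522280902899 31 22) .nil))) (.br 37 (.leaf 24064696563 31 22) (.br 45 (.leaf
  522549321923 31 22) .nil))) (.br 23 (.leaf 453753905356 23 32) (.br 29 (.leaf 453753905392 23
  32) (.br 37 (.leaf 24064696563 22 31) (.br 45 (.leaf 522549321923 22 31) .nil))))) (.br 29
  (.leaf 28359647472 22 31) (.br 37 (.leaf 24064696563 22 31) (.br 45 (.leaf 522549321923 22 31)
  .nil))))) (.br 29 (.leaf 28359647472 22 31) (.br 37 (.leaf 24064696563 22 31) (.br 45 (.leaf
  522549321923 22 31) .nil)))) (.br 29 (.br 38 (.leaf 28359587616 39 48) (.br 21 (.leaf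
  28359647472 22 31) (.br 37 (.br 38 (.leaf 28359587616 39 48) (.br 45 (.br 54 (.br 55 (.br 38
  (.leaf 8016998758176 39 48) (.br 21 (.leaf 8016998818032 22 31) .nil)) (.br 38 (.leaf
  8016998758176 39 48) (.br 21 (.leaf 8016998818032 22 31) .nil))) (.br 38 (.leaf 526575793952 39
  48) (.br 21 (.leaf 526575853808 22 31) .nil))) (.br 21 (.leaf 28359647472 22 31) .nil))) (.br
  45 (.br 37 (.br 38 (.leaf 28359587616 39 48) (.br 21 (.leaf 28359647472 22 31) .nil)) (.br 38
  (.leaf 28359587616 39 48) (.br 21 (.leaf 28359647472 22 31) .nil))) .nil)))) (.br 37 (.br 38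
  (.leaf 28359587616 39 48) (.br 29 (.br 38 (.leaf 28359587616 39 48) (.br 21 (.leaf 28359647472
  22 31) (.br 45 (.br 54 (.br 55 (.br 38 (.leaf 8016998758176 39 48) (.br 21 (.leaf 8016998818032
  22 31) .nil)) (.br 38 (.leaf 8016998758176 39 48) (.br 21 (.leaf 8016998818032 22 31) .nil)))
  (.br 38 (.leaf 526575793952 39 48) (.br 21 (.leaf 526575853808 22 31) .nil))) .nil))) (.br 45
  (.br 38 (.leaf 28359587616 39 48) (.br 29 (.br 30 (.leaf 28288867520 22 31) (.br 38 (.br 39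
  (.leaf 453753271072 31 40) (.br 47 (.br 48 (.leaf 7260052769952 40 49) (.br 56 (.br 57 (.leaf
  7260052877472 49 58) (.br 48 (.leaf 7260052769952 40 49) (.br 39 (.leaf 7260052339872 31 40)
  (.br 30 (.leaf 7241950100640 22 31) (.br 21 (.leaf 7241950100640 22 31) .nil))))) (.br 39
  (.leaf 7260052337568 31 40) (.br 30 (.leaf 7241950098336 22 31) (.br 21 (.leaf 7241950098336 22
  31) .nil))))) (.br 30 (.leaf 452621880544 22 31) (.br 21 (.leaf 452621880544 22 31) .nil))))
  (.br 21 (.leaf 28359547952 22 31) .nil))) (.br 21 (.leaf 28359547952 22 31) .nil))) (.br 21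
  (.leaf 28359547952 22 31) .nil)))) (.br 45 (.br 37 (.br 38 (.leaf 28359587616 39 48) (.br 29
  (.br 30 (.leaf 28288867520 22 31) (.br 38 (.br 39 (.leaf 453753271072 31 40) (.br 47 (.br 48
  (.leaf 7260052769952 40 49) (.br 56 (.br 57 (.leaf 7260052877472 49 58) (.br 48 (.leaf
  7260052769952 40 49) (.br 39 (.leaf 7260052339872 31 40) (.br 30 (.leaf 7241950100640 22 31)
  (.br 21 (.leaf 7241950100640 22 31) .nil))))) (.br 39 (.leaf 7260052337568 31 40) (.br 30
  (.leaf 7241950098336 22 31) (.br 21 (.leaf 7241950098336 22 31) .nil))))) (.br 30 (.leaf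
  452621880544 22 31) (.br 21 (.leaf 452621880544 22 31) .nil)))) (.br 21 (.leaf 28359547952 22
  31) .nil))) (.br 21 (.leaf 28359547952 22 31) .nil))) (.br 29 (.br 38 (.leaf 28359587616 39 48)
  (.br 21 (.leaf 28359647472 22 31) (.br 37 (.br 38 (.leaf 28359587616 39 48) (.br 21 (.leaf
  28359647472 22 31) .nil)) .nil))) (.br 21 (.leaf 28359547916 22 31) .nil))) .nil)))) (.br 29
  (.br 20 (.br 21 (.leaf 28359647472 22 31) (.br 38 (.leaf 28359587616 39 48) (.br 37 (.br 38
  (.leaf 28359587616 39 48) (.br 45 (.br 54 (.br 55 (.br 38 (.leaf 8016998758176 39 48) (.br 21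
  (.leaf 8016998818032 22 31) .nil)) (.br 38 (.leaf 8016998758176 39 48) (.br 21 (.leaf
  8016998818032 22 31) .nil))) (.br 38 (.leaf 526575793952 39 48) (.br 21 (.leaf 526575853808 22
  31) .nil))) (.br 21 (.leaf 28359647472 22 31) .nil))) (.br 45 (.br 37 (.br 38 (.leaf
  28359587616 39 48) (.br 21 (.leaf 28359647472 22 31) .nil)) (.br 38 (.leaf 28359587616 39 48)
  (.br 21 (.leaf 28359647472 22 31) .nil))) .nil)))) (.br 38 (.leaf 28359587616 39 48) (.br 37
  (.br 38 (.leaf 28359587616 39 48) (.br 45 (.br 38 (.leaf 28359587616 39 48) (.br 20 (.br 21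
  (.leaf 28359647472 22 31) (.br 38 (.leaf 28359587616 39 48) .nil)) (.br 21 (.leaf 28359647472
  22 31) .nil))) (.br 20 (.br 21 (.leaf 28359647472 22 31) (.br 38 (.leaf 28359587616 39 48) (.br
  45 (.br 54 (.br 55 (.br 38 (.leaf 8016998758176 39 48) (.br 21 (.leaf 8016998818032 22 31)
  .nil)) (.br 38 (.leaf 8016998758176 39 48) (.br 21 (.leaf 8016998818032 22 31) .nil))) (.br 38
  (.leaf 526575793952 39 48) (.br 21 (.leaf 526575853808 22 31) .nil))) .nil))) (.br 21 (.leaf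
  28359647472 22 31) .nil)))) (.br 45 (.br 37 (.br 38 (.leaf 28359587616 39 48) (.br 20 (.br 21
  (.leaf 28359647472 22 31) (.br 38 (.leaf 28359587616 39 48) .nil)) (.br 21 (.leaf 28359647472
  22 31) .nil))) (.br 20 (.br 21 (.leaf 28359647472 22 31) (.br 38 (.leaf 28359587616 39 48) (.br
  37 (.br 38 (.leaf 28359587616 39 48) (.br 21 (.leaf 28359647472 22 31) .nil)) .nil))) (.br 38
  (.leaf 28359587616 39 48) (.br 21 (.leaf 28359647472 22 31) .nil)))) (.br 21 (.leaf 28359647472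
  22 31) .nil))))) (.br 37 (.br 29 (.br 20 (.br 21 (.leaf 28359547916 22 31) (.br 30 (.leaf
  453752770060 22 31) (.br 45 (.br 54 (.br 55 (.br 30 (.leaf 8016998718476 22 31) (.br 21 (.leaf
  8016998718476 22 31) .nil)) (.br 30 (.leaf 8016998718476 22 31) (.br 21 (.leaf 8016998718476 22
  31) .nil))) (.br 30 (.leaf 8425212071436 22 31) (.br 21 (.leaf 526575754252 22 31) .nil)))
  .nil))) (.br 30 (.leaf 453752770060 22 31) (.br 45 (.br 20 (.br 21 (.leaf 28359547916 22 31)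
  (.br 30 (.leaf 453752770060 22 31) .nil)) (.br 30 (.leaf 453752770060 22 31) (.br 21 (.leaf
  28359547916 22 31) .nil))) (.br 21 (.leaf 28359547916 22 31) .nil)))) (.br 45 (.br 29 (.br 20
  (.br 21 (.leaf 28359547916 22 31) (.br 30 (.leaf 453752770060 22 31) .nil)) (.br 30 (.leaf
  453752770060 22 31) (.br 21 (.leaf 28359547916 22 31) .nil))) (.br 20 (.br 21 (.leaf
  28359547916 22 31) (.br 29 (.br 30 (.leaf 453752770060 22 31) (.br 21 (.leaf 28359547916 22 31)
  .nil)) .nil)) (.br 21 (.leaf 28359547916 22 31) .nil))) (.br 20 (.br 21 (.leaf 28359547916 22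
  31) (.br 29 (.br 30 (.leaf 453752770060 22 31) (.br 21 (.leaf 28359547916 22 31) (.br 45 (.br
  54 (.br 55 (.br 30 (.leaf 8016998718476 22 31) (.br 21 (.leaf 8016998718476 22 31) .nil)) (.br
  30 (.leaf 8016998718476 22 31) (.br 21 (.leaf 8016998718476 22 31) .nil))) (.br 30 (.leaf
  8425212071436 22 31) (.br 21 (.leaf 526575754252 22 31) .nil))) .nil))) (.br 45 (.br 29 (.br 30
  (.leaf 453752770060 22 31) (.br 21 (.leaf 28359547916 22 31) .nil)) (.br 21 (.leaf 28359547916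
  22 31) .nil)) .nil))) (.br 21 (.leaf 28359547916 22 31) .nil)))) (.br 45 (.br 37 (.br 29 (.br
  20 (.br 21 (.leaf 28359547916 22 31) (.br 30 (.leaf 453752770060 22 31) .nil)) (.br 30 (.leaf
  453752770060 22 31) (.br 21 (.leaf 28359547916 22 31) .nil))) (.br 20 (.br 21 (.leaf
  28359547916 22 31) (.br 29 (.br 30 (.leaf 453752770060 22 31) (.br 21 (.leaf 28359547916 22 31)
  .nil)) .nil)) (.br 21 (.leaf 28359547916 22 31) .nil))) (.br 29 (.br 20 (.br 21 (.leaf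
  28359647436 22 31) (.br 37 (.br 21 (.leaf 28359647436 22 31) .nil) .nil)) (.br 37 (.br 20 (.br
  21 (.leaf 28359647436 22 31) .nil) (.br 21 (.leaf 28359647436 22 31) .nil)) (.br 21 (.leaf
  28359647436 22 31) .nil))) (.br 20 (.br 21 (.leaf 28359547916 22 31) (.br 29 (.br 38 (.leaf
  28359587616 39 48) (.br 21 (.leaf 28359647472 22 31) (.br 37 (.br 38 (.leaf 28359587616 39 48)
  (.br 21 (.leaf 28359647472 22 31) .nil)) .nil))) (.br 37 (.br 38 (.leaf 28359587616 39 48) (.br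
  29 (.br 30 (.leaf 28288867520 22 31) (.br 38 (.br 39 (.leaf 453753271072 31 40) (.br 47 (.br 48
  (.leaf 7260052769952 40 49) (.br 56 (.br 57 (.leaf 7260052877472 49 58) (.br 48 (.leaf
  7260052769952 40 49) (.br 39 (.leaf 7260052339872 31 40) (.br 30 (.leaf 7241950100640 22 31)
  (.br 21 (.leaf 7241950100640 22 31) .nil))))) (.br 39 (.leaf 7260052337568 31 40) (.br 30
  (.leaf 7241950098336 22 31) (.br 21 (.leaf 7241950098336 22 31) .nil))))) (.br 30 (.leaf
  452621880544 22 31) (.br 21 (.leaf 452621880544 22 31) .nil)))) (.br 21 (.leaf 28359547952 22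
  31) .nil))) (.br 21 (.leaf 28359547952 22 31) .nil))) .nil))) (.br 21 (.leaf 28359547916 22 31)
  .nil)))) .nil))))) (.br 20 (.br 29 (.leaf 28359474480 3 12) (.br 12 (.br 3 (.br 4 (.br 5 (.br
  13 (.br 29 (.br 38 (.br 37 (.leaf 453750046688 4 13) (.br 47 (.br 46 (.leaf 6312169160947 4 13)
  (.br 56 (.leaf 8077132284147 4 13) (.br 37 (.leaf 6183320142067 4 13) (.br 45 (.leaf
  8077132284147 4 13) .nil)))) (.br 45 (.leaf 8357647335667 4 13) .nil))) (.br 37 (.leaf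
  24068604147 4 13) (.br 45 (.leaf 522284810483 4 13) .nil))) (.br 37 (.leaf 24068604147 4 13)
  (.br 45 (.leaf 522549052355 4 13) .nil))) (.br 29 (.leaf 453750046000 4 13) (.br 37 (.leaf
  24068604147 4 13) (.br 45 (.leaf 522549052355 4 13) .nil)))) (.br 13 (.leaf 7259995472844 5 14)
  (.br 29 (.leaf 453750046000 4 13) (.br 37 (.leaf 24068604147 4 13) (.br 45 (.leaf 522549052355
  4 13) .nil))))) (.br 13 (.leaf 7259995472844 5 14) (.br 29 (.leaf 453750046000 4 13) (.br 37
  (.leaf 1504293107 3 12) (.br 45 (.leaf 32659321795 3 12) .nil))))) (.br 13 (.br 4 (.leaf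
  453749703628 5 14) (.br 14 (.br 4 (.br 3 (.br 29 (.br 38 (.br 37 (.leaf 453750046688 13 4) (.br
  47 (.br 46 (.leaf 6312169160947 13 4) (.br 56 (.leaf 8077132284147 13 4) (.br 37 (.leaf
  6183320142067 13 4) (.br 45 (.leaf 8077132284147 13 4) .nil)))) (.br 45 (.leaf 8357647335667 13
  4) .nil))) (.br 37 (.leaf 24068604147 13 4) (.br 45 (.leaf 522284810483 13 4) .nil))) (.br 37
  (.leaf 24068604147 13 4) (.br 45 (.leaf 522549052355 13 4) .nil))) (.br 29 (.leaf 453750046000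
  13 4) (.br 37 (.leaf 24068604147 13 4) (.br 45 (.leaf 522549052355 13 4) .nil)))) (.br 3 (.leaf
  28359377868 13 4) (.br 29 (.leaf 453750046000 13 4) (.br 37 (.leaf 24068604147 13 4) (.br 45
  (.leaf 522549052355 13 4) .nil))))) (.br 3 (.leaf 28359377868 4 13) (.br 29 (.leaf 453750046000
  4 13) (.br 37 (.leaf 24068604147 4 13) (.br 45 (.leaf 522549052355 4 13) .nil)))))) (.br 29
  (.leaf 28359474480 3 12) (.br 37 (.leaf 1504293107 3 12) (.br 45 (.leaf 32659321795 3 12)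
  .nil))))) (.br 37 (.leaf 1504293107 3 12) (.br 45 (.leaf 32659321795 3 12) .nil)))) (.br 29
  (.leaf 28359474480 3 12) (.br 37 (.leaf 1504293107 3 12) (.br 45 (.leaf 32659321795 3 12)
  .nil))))) (.br 20 (.br 11 (.br 2 (.br 12 (.br 13 (.br 14 (.br 22 (.br 21 (.br 29 (.br 38 (.br
  37 (.leaf 453770678240 13 22) (.br 47 (.br 46 (.leaf 6312164863219 13 22) (.br 56 (.leaf
  8077127986419 13 22) (.br 37 (.leaf 6183315844339 13 22) (.br 45 (.leaf 8077127986419 13 22)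
  .nil)))) (.br 45 (.leaf 8357643037939 13 22) .nil))) (.br 37 (.leaf 24064306419 13 22) (.br 45
  (.leaf 522280512755 13 22) .nil))) (.br 37 (.leaf 24064306419 13 22) (.br 45 (.leaf
  522550341827 13 22) .nil))) (.br 29 (.leaf 453770677552 13 22) (.br 37 (.leaf 24064306419 13
  22) (.br 45 (.leaf 522550341827 13 22) .nil)))) (.br 21 (.leaf 28360667340 13 22) (.br 29
  (.leaf 453770677552 13 22) (.br 37 (.leaf 24064306419 13 22) (.br 45 (.leaf 522550341827 13 22)
  .nil))))) (.br 22 (.leaf 7260329533644 14 23) (.br 21 (.leaf 7260329479436 14 23) (.br 29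
  (.leaf 453770677552 13 22) (.br 37 (.leaf 24064306419 13 22) (.br 45 (.leaf 522550341827 13 22)
  .nil)))))) (.br 21 (.leaf 28360667340 13 22) (.br 29 (.leaf 7260330577200 4 13) (.br 37 (.leaf
  1504062707 12 21) (.br 45 (.leaf 32659397827 12 21) .nil))))) (.br 21 (.leaf 1772543180 12 21)
  (.br 29 (.leaf 1772543216 12 21) (.br 37 (.leaf 1504062707 12 21) (.br 45 (.leaf 32659397827 12
  21) .nil))))) (.br 12 (.leaf 28360166604 4 13) (.br 21 (.leaf 453770677516 13 22) (.br 29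
  (.leaf 1772543216 12 21) (.br 37 (.leaf 1504062707 12 21) (.br 45 (.leaf 32659397827 12 21)
  .nil)))))) (.br 21 (.leaf 110786316 21 30) (.br 29 (.leaf 110786352 21 30) (.br 37 (.leaf
  94003443 12 21) (.br 45 (.leaf 2041208003 12 21) .nil))))) (.br 29 (.leaf 110786352 21 30) (.br
  37 (.br 46 (.leaf 1462413251 47 56) (.br 29 (.leaf 95057667 21 30) (.br 45 (.br 46 (.leaf
  1972021187 47 56) (.br 54 (.br 55 (.leaf 32103901123 47 56) (.br 46 (.leaf 1972021187 47 56)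
  (.br 29 (.leaf 1990883075 21 30) (.br 20 (.leaf 1990876355 12 21) (.br 11 (.leaf 31854064579 3
  12) .nil))))) (.br 29 (.leaf 2041214723 21 30) (.br 20 (.leaf 2041208003 12 21) (.br 11 (.leaf
  32659370947 3 12) .nil))))) (.br 20 (.leaf 95050947 12 21) (.br 11 (.leaf 1520858051 3 12)
  .nil))))) (.br 45 (.br 46 (.leaf 1462413251 47 56) (.br 37 (.br 38 (.leaf 1508255987 30 39)
  (.br 46 (.br 47 (.leaf 24655735027 39 48) (.br 55 (.br 56 (.leaf 394975684851 48 57) (.br 64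
  (.br 65 (.leaf 394961529075 57 66) (.br 56 (.leaf 394975684851 48 57) (.br 47 (.leaf
  394979223795 39 48) (.br 38 (.leaf 394980108531 30 39) (.br 29 (.leaf 394980329715 21 30) (.br
  20 (.leaf 394980385011 12 21) (.br 11 (.leaf 6319686447347 3 12) .nil))))))) (.br 47 (.leaf
  395029555443 39 48) (.br 38 (.leaf 395030440179 30 39) (.br 29 (.leaf 395030661363 21 30) (.br
  20 (.leaf 395030716659 12 21) (.br 11 (.leaf 6320491753715 3 12) .nil))))))) (.br 38 (.leaf
  24669202675 30 39) (.br 29 (.leaf 24669423859 21 30) (.br 20 (.leaf 24669479155 12 21) (.br 11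
  (.leaf 394711953651 3 12) .nil)))))) (.br 29 (.leaf 93948147 21 30) (.br 20 (.leaf 94003443 12
  21) (.br 11 (.leaf 1504342259 3 12) .nil))))) (.br 29 (.leaf 93948147 21 30) (.br 20 (.leaf
  95050947 12 21) (.br 11 (.leaf 1520858051 3 12) .nil))))) .nil))))) (.br 20 (.br 21 (.leaf
  110810928 21 30) (.br 29 (.leaf 110810928 21 30) (.br 10 (.br 1 (.br 2 (.br 21 (.br 22 (.br 30
  (.br 29 (.br 38 (.br 37 (.leaf 453810942944 21 30) (.br 47 (.br 46 (.leaf 6312150864883 21 30)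
  (.br 56 (.leaf 8077113988083 21 30) (.br 37 (.leaf 6183301846003 21 30) (.br 45 (.leaf
  8077113988083 21 30) .nil)))) (.br 45 (.leaf 8357629039603 21 30) .nil))) (.br 37 (.leaf
  24050308083 21 30) (.br 45 (.leaf 522266514419 21 30) .nil))) (.br 37 (.leaf 24050308083 21 30)
  (.br 45 (.leaf 522552858371 21 30) .nil))) (.br 29 (.leaf 28363183920 21 30) (.br 37 (.leaf
  24050308083 21 30) (.br 45 (.leaf 522552858371 21 30) .nil)))) (.br 30 (.leaf 7260974992908 22
  31) (.br 29 (.leaf 28363183920 21 30) (.br 37 (.leaf 24050308083 21 30) (.br 45 (.leaf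
  522552858371 21 30) .nil))))) (.br 29 (.leaf 28363183920 21 30) (.br 37 (.leaf 385049859059 12
  21) (.br 45 (.leaf 32659553731 20 29) .nil)))) (.br 21 (.leaf 7260975035148 13 22) (.br 29
  (.leaf 28363183920 21 30) (.br 37 (.leaf 385049859059 12 21) (.br 45 (.leaf 32659553731 20 29)
  .nil))))) (.br 21 (.leaf 453854524172 13 22) (.br 29 (.leaf 1772869424 21 30) (.br 37 (.leaf
  24065616883 12 21) (.br 45 (.leaf 2041232835 20 29) .nil))))) (.br 37 (.leaf 1504101107 12 21)
  (.br 45 (.leaf 127577539 20 29) .nil))))) (.br 29 (.leaf 110810928 21 30) (.br 37 (.leaf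
  5942723 20 29) (.br 45 (.leaf 127577539 20 29) .nil))))) (.br 29 (.leaf 433008 29 38) (.br 37
  (.leaf 366771 29 38) (.br 45 (.leaf 7973315 20 29) .nil)))) (.br 37 (.leaf 22915 29 38) (.br 45
  (.leaf 31388 28 37) .nil))) (.br 37 (.leaf 22915 29 38) (.br 45 (.leaf 31115 37 46) .nil))

/-- This evaluation is the whole case analysis for one block. It starts with only cell 36 visited,
the agent standing there after 0 steps, and no exit used (`x = 0`). The branches have to cover all
free neighbours of 36. -/
theorem rootTree_check :
    rootTree.check (1 <<< 36) (rootTree.block.known (1 <<< 36) 0) 36 0 0 0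
      (rootTree.block.known (1 <<< 36) 0 ^^^ 1 <<< 36) = true := by
  decide +kernel

/-! ### Counting moves in walks that may pause. -/

/-- The number of proper moves in a list of positions. -/
def moves {α : Type} [DecidableEq α] : List α → ℕ
  | x :: y :: l => (if x = y then 0 else 1) + moves (y :: l)
  | _ => 0

section moves
variable {α : Type} [DecidableEq α]

theorem moves_append (r : List α) (c : α) (l : List α) :
    moves (r ++ c :: l) = moves (r ++ [c]) + moves (c :: l) := by
  induction r with
  | nil => simp [moves]
  | cons x r ih => cases r with
    | nil => simp [moves]
    | cons y r => simp only [List.cons_append, moves] at ih ⊢; rw [ih]; ring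

theorem moves_cons_ne {x y : α} (h : x ≠ y) (l : List α) :
    moves (x :: y :: l) = moves (y :: l) + 1 := by
  simp [moves, h, add_comm]

theorem card_toFinset_le_moves (l : List α) : l.toFinset.card ≤ moves l + 1 := by
  induction l with
  | nil => simp
  | cons x l ih => cases l with
    | nil => simp
    | cons y l =>
      by_cases h : x = y
      · subst h; simpa [moves] using ih
      · rw [moves_cons_ne h, List.toFinset_cons]
        exact (Finset.card_insert_le _ _).trans (by omega)

end moves

/-! ### Soundness of the bit operations and of the search. -/

/-- Adjacency of codes. -/
def AdjN (i j : ℕ) : Prop := j = i + 1 ∨ i = j + 1 ∨ j = i + 9 ∨ i = j + 9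

theorem force_eq {α : Type} (x : ℕ) (f : ℕ → α) : force x f = f x := by
  cases x <;> rfl

theorem testBit_insertBit (m i j : ℕ) :
    (insertBit m i).testBit j = true ↔ m.testBit j = true ∨ j = i := by
  rw [insertBit, Nat.testBit_or, Nat.one_shiftLeft, Nat.testBit_two_pow, Bool.or_eq_true,
    decide_eq_true_eq, eq_comm (a := i)]

theorem testBit_nbrs {m i j : ℕ} (hi : m.testBit i = true) (h : AdjN i j) :
    (nbrs m).testBit j = true := by
  simp only [nbrs, Nat.testBit_or, Nat.testBit_shiftLeft, Nat.testBit_shiftRight, Bool.or_eq_true,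
    Bool.and_eq_true, decide_eq_true_eq]
  rcases h with rfl | rfl | rfl | rfl
  · left; left; simpa using hi
  · left; right; rwa [add_comm]
  · right; left; simpa using hi
  · right; right; rwa [add_comm]

theorem testBit_spread {V R j : ℕ} : (spread V R).testBit j = true ↔
    R.testBit j = true ∨ ((nbrs R).testBit j = true ∧ V.testBit j = true) := by
  simp [spread, Nat.testBit_or, Nat.testBit_and]

theorem testBit_one_shiftLeft {i j : ℕ} : (1 <<< i).testBit j = true ↔ j = i := by
  simp [Nat.one_shiftLeft, Nat.testBit_two_pow, eq_comm]

theorem testBit_log2 {m : ℕ} (h : m ≠ 0) : m.testBit m.log2 = true := by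
  exact Nat.testBit_log2 h

theorem testBit_erase {m i j : ℕ} (h : m.testBit i = true) :
    (m ^^^ 1 <<< i).testBit j = true ↔ m.testBit j = true ∧ j ≠ i := by
  rw [Nat.testBit_xor, Nat.one_shiftLeft, Nat.testBit_two_pow]
  by_cases hj : i = j
  · subst hj; simp [h]
  · simp [hj, Ne.symm hj]

theorem allBits_sound {P : ℕ → Bool} {n m i : ℕ} (h : allBits P n m = true)
    (hi : m.testBit i = true) : P i = true := by
  induction n generalizing m with
  | zero =>
    simp only [allBits, Nat.beq_eq] at h
    simp [h] at hi
  | succ n ih =>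
    have h0 : m ≠ 0 := by rintro rfl; simp at hi
    have h0' : m.beq 0 = false := by
      rw [Bool.eq_false_iff]; simpa using h0
    simp only [allBits, force_eq, h0', cond_false, Bool.and_eq_true] at h
    by_cases hj : i = m.log2
    · rw [hj]; exact h.1
    · exact ih h.2 ((testBit_erase (testBit_log2 h0)).2 ⟨hi, hj⟩)

theorem exists_finset_bitCount (n m : ℕ) (h : m < 2 ^ n) :
    ∃ s : Finset ℕ, s.card = bitCount n m ∧ ∀ i, i ∈ s ↔ m.testBit i = true := by
  induction n generalizing m with
  | zero =>
    have : m = 0 := by simpa using h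
    exact ⟨∅, by simp [bitCount], by simp [this]⟩
  | succ n ih =>
    by_cases h0 : m = 0
    · subst h0; exact ⟨∅, by simp [bitCount], by simp⟩
    · have h0' : m.beq 0 = false := by
        rw [Bool.eq_false_iff]; simpa using h0
      have key := fun j => testBit_erase (j := j) (testBit_log2 h0)
      have hlt : m ^^^ 1 <<< m.log2 < 2 ^ n := by
        apply Nat.lt_pow_two_of_testBit
        intro i hi
        rw [Bool.eq_false_iff, ne_eq, key]
        rintro ⟨h1, h2⟩
        have h3 : m.log2 < n + 1 := (Nat.log2_lt h0).2 h
        have h4 : 2 ^ i ≤ m := Nat.ge_two_pow_of_testBit h1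
        have h5 : i ≤ m.log2 := (Nat.le_log2 h0).2 h4
        omega
      obtain ⟨s, hs, hs'⟩ := ih _ hlt
      refine ⟨insert m.log2 s, ?_, ?_⟩
      · rw [Finset.card_insert_of_notMem, hs]
        · simp [bitCount, h0']
        · rw [hs', key]; simp
      · intro i
        rw [Finset.mem_insert, hs', key]
        constructor
        · rintro (rfl | h)
          · exact testBit_log2 h0
          · exact h.1
        · intro h
          by_cases hi : i = m.log2
          · exact Or.inl hi
          · exact Or.inr ⟨h, hi⟩

/-- Each cell is tested only in the first layer where it appears; afterwards `seen` hides it. So the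
test is obtained for some `i' ≤ i`. For lower bounds this is enough, since a later arrival only
costs more. -/
theorem layers_sound {P : ℕ → ℕ → Bool} {V C n R seen j i c : ℕ}
    (h : layers P V C n R seen j = true) (hi : i < n) (hC : C.testBit c = true)
    (hs : seen.testBit c = false) (hc : (nbrs ((spread V)^[i] R)).testBit c = true) :
    ∃ i' ≤ i, P (j + i') c = true := by
  induction n generalizing R seen j i with
  | zero => omega
  | succ n ih =>
    simp only [layers, force_eq, Bool.and_eq_true] at h
    by_cases hR : (nbrs R).testBit c = true
    · refine ⟨0, by omega, allBits_sound h.1 ?_⟩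
      simp [Nat.testBit_and, Nat.testBit_xor, hR, hC, hs]
    · cases i with
      | zero => exact absurd hc hR
      | succ i =>
        obtain ⟨i', h1, h2⟩ := ih h.2 (by omega) (by
          rw [Nat.testBit_or, hs, Nat.testBit_and]; simp [hR]) hc
        exact ⟨i' + 1, by omega, by rwa [show j + (i' + 1) = j + 1 + i' by ring]⟩

/-- Closing costs 1 from cell 45 and 2 from cell 36. Hence 45 is forbidden in all `n` layers,
whereas 36 may be reached in the last one. -/
theorem closing_sound {V n R i : ℕ} (h : closing V n R = true) (hi : i < n) :
    ¬ ((spread V)^[i] R).testBit 45 = true ∧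
      (i + 1 = n ∨ ¬ ((spread V)^[i] R).testBit 36 = true) := by
  induction n generalizing R i with
  | zero => omega
  | succ n ih =>
    simp only [closing, Bool.and_eq_true, Bool.or_eq_true, Nat.beq_eq,
      Bool.not_eq_true'] at h
    cases i with
    | zero => exact ⟨by simp [h.1.1], by rcases h.1.2 with h | h <;> simp [h]⟩
    | succ i =>
      obtain ⟨h1, h2⟩ := ih h.2 (i := i) (by omega)
      exact ⟨h1, by simpa using h2⟩

/-- The count stops at the first layer that touches `c`. Running out of fuel only makes it smaller,
so the bound needs no condition on `n`. -/
theorem layerOf_le {V c n R i : ℕ} (hc : (nbrs ((spread V)^[i] R)).testBit c = true) :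
    layerOf V c n R ≤ i := by
  induction n generalizing R i with
  | zero => simp [layerOf]
  | succ n ih =>
    by_cases hR : (nbrs R).testBit c = true
    · simp [layerOf, hR]
    · cases i with
      | zero => exact absurd hc hR
      | succ i =>
        have : layerOf V c n (spread V R) ≤ i := ih hc
        simp only [layerOf, Bool.not_eq_true] at hR ⊢
        simp only [hR, cond_false]
        omega

/-- A list of codes in which consecutive ones are equal or adjacent. -/
def LazyN (l : List ℕ) : Prop := l.IsChain fun x y => x = y ∨ AdjN x y

theorem AdjN.symm {i j : ℕ} (h : AdjN i j) : AdjN j i := by unfold AdjN at *; omega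

/-- Lists are latest first, so the walk starts in `p` and ends in `h`. A pause is no move and needs
no further layer; a proper move costs exactly one application of `spread`. -/
theorem testBit_iterate_spread {V p : ℕ} {r : List ℕ} {h : ℕ} (hl : LazyN (r ++ [p]))
    (hV : ∀ i ∈ r, V.testBit i = true) (hh : (r ++ [p]).head? = some h) :
    ((spread V)^[moves (r ++ [p])] (1 <<< p)).testBit h = true := by
  induction r generalizing h with
  | nil =>
    have : h = p := by simpa [eq_comm] using hh
    subst this
    simp [moves]
  | cons x r ih =>
    have : h = x := by simpa [eq_comm] using hh
    subst this
    obtain ⟨y, l, hy⟩ : ∃ y l, r ++ [p] = y :: l := by cases r <;> simp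
    rw [List.cons_append, hy] at hl ⊢
    rw [hy] at ih
    simp only [LazyN, List.isChain_cons_cons] at hl
    have ih' := ih hl.2 (fun i hi => hV i (by simp [hi])) rfl
    by_cases hxy : h = y
    · subst hxy; simpa [moves] using ih'
    · rw [moves_cons_ne hxy, Function.iterate_succ_apply', testBit_spread]
      rcases hl.1 with h1 | h1
      · exact absurd h1 hxy
      · exact Or.inr ⟨testBit_nbrs ih' h1.symm, hV _ (by simp)⟩

/-- The cost of closing the local tour from the entry cells. -/
def closeCost (i : ℕ) : ℕ := if i = 36 then 2 else 1

/-- The future walk `r` is cut at the first moment when it enters a cell `c` outside `V`. Up to then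
it stays in `V`, so the layers of the search account for it; the rest is the same problem with `c`
visited. Pauses have to be allowed because the walk arises from a longer one by deleting its
excursions behind the neck. -/
theorem search_sound {C m n V p k : ℕ} (h : search C m n V p k = true) (s : Finset ℕ)
    (hn : s.card = n) (hs : ∀ i, i ∈ s ↔ C.testBit i = true ∧ ¬ V.testBit i = true)
    (r : List ℕ) (hl : LazyN (r ++ [p])) (hp : V.testBit p = true)
    (hr : ∀ i ∈ r, C.testBit i = true) (hc : ∀ i ∈ s, i ∈ r) {e : ℕ}
    (he : (r ++ [p]).head? = some e) (he' : e = 36 ∨ e = 45) :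
    m ≤ k + moves (r ++ [p]) + closeCost e := by
  induction n generalizing V p k s r with
  | zero =>
    have hV : ∀ i ∈ r, V.testBit i = true := by
      intro i hi
      by_contra hV
      have := (hs i).2 ⟨hr i hi, hV⟩
      rw [Finset.card_eq_zero.1 hn] at this
      simp at this
    have h1 := testBit_iterate_spread hl hV he
    simp only [search] at h
    by_contra hlt
    have h2 := closing_sound h (i := moves (r ++ [p]))
    unfold closeCost at hlt
    rcases he' with rfl | rfl
    · simp only [if_true] at hlt
      rcases (h2 (by omega)).2 with h3 | h3
      · omega
      · exact h3 h1
    · simp only [show ¬ (45 = 36) by norm_num, if_false] at hlt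
      exact (h2 (by omega)).1 h1
  | succ n ih =>
    have hex : ∃ r2 c r1, r = r2 ++ c :: r1 ∧ ¬ V.testBit c = true ∧
        ∀ i ∈ r1, V.testBit i = true := by
      have : ∃ i ∈ r, ¬ V.testBit i = true := by
        obtain ⟨i, hi⟩ : s.Nonempty := Finset.card_pos.1 (by omega)
        exact ⟨i, hc i hi, ((hs i).1 hi).2⟩
      clear hl hr hc he ih hs hn h
      induction r with
      | nil => simp at this
      | cons x r ihr =>
        by_cases hx : ∃ i ∈ r, ¬ V.testBit i = true
        · obtain ⟨r2, c, r1, h1, h2, h3⟩ := ihr hx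
          exact ⟨x :: r2, c, r1, by simp [h1], h2, h3⟩
        · push Not at hx
          refine ⟨[], x, r, rfl, ?_, hx⟩
          obtain ⟨i, hi, hi'⟩ := this
          rcases List.mem_cons.1 hi with rfl | hi
          · exact hi'
          · exact absurd (hx i hi) hi'
    obtain ⟨r2, c, r1, rfl, hcV, hr1⟩ := hex
    have hcC : C.testBit c = true := hr c (by simp)
    rw [List.append_assoc, List.cons_append] at hl he ⊢
    have hl1 : LazyN (r1 ++ [p]) := hl.right_of_append.tail
    have hl2 : LazyN (r2 ++ [c]) := by
      have : r2 ++ c :: (r1 ++ [p]) = (r2 ++ [c]) ++ (r1 ++ [p]) := by simp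
      rw [this] at hl
      exact hl.left_of_append
    obtain ⟨y, l, hy⟩ : ∃ y l, r1 ++ [p] = y :: l := by cases r1 <;> simp
    have hyV : V.testBit y = true := by
      have : y ∈ r1 ++ [p] := by simp [hy]
      rcases List.mem_append.1 this with h | h
      · exact hr1 _ h
      · rw [List.mem_singleton.1 h]; exact hp
    have hne : c ≠ y := by rintro rfl; exact hcV hyV
    have hadj : AdjN y c := by
      have := hl.right_of_append
      rw [hy, List.isChain_cons_cons] at this
      rcases this.1 with h | h
      · exact absurd h hne
      · exact h.symm
    have hreach := testBit_nbrs (testBit_iterate_spread hl1 hr1 (h := y) (by simp [hy])) hadj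
    have hK : moves (r2 ++ c :: (r1 ++ [p])) = moves (r2 ++ [c]) + (moves (r1 ++ [p]) + 1) := by
      rw [moves_append, hy, moves_cons_ne hne]
    rw [hK]
    have hcs : c ∈ s := (hs c).2 ⟨hcC, hcV⟩
    have he2 : (r2 ++ [c]).head? = some e := by
      cases r2 <;> simpa using he
    have hc2 : ∀ i ∈ s.erase c, i ∈ r2 := by
      intro i hi
      rw [Finset.mem_erase] at hi
      have h1 := hc i hi.2
      simp only [List.mem_append, List.mem_cons] at h1
      rcases h1 with h1 | h1 | h1
      · exact h1
      · exact absurd h1 hi.1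
      · exact absurd (hr1 i h1) ((hs i).1 hi.2).2
    -- From this bound on no search is necessary: one step enters `c`, the other `n` unvisited cells
    -- need a step each, and closing costs at least one more, `n + 2` in all.
    by_cases hlt : moves (r1 ++ [p]) < m - k - (n + 2)
    · simp only [search, force_eq] at h
      obtain ⟨i', hi', h2⟩ := layers_sound h hlt hcC (by simpa using hcV) hreach
      have := ih h2 (s.erase c) (by rw [Finset.card_erase_of_mem hcs, hn]; rfl) (by
          intro i
          rw [Finset.mem_erase, hs, testBit_insertBit]
          tauto) r2 hl2 ((testBit_insertBit _ _ _).2 (Or.inr rfl))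
        (fun i hi => hr i (by simp [hi])) hc2 he2
      omega
    · have h3 : n + 1 ≤ moves (r2 ++ [c]) + 1 := by
        refine le_trans ?_ (card_toFinset_le_moves _)
        rw [← hn]
        apply Finset.card_le_card
        intro i hi
        by_cases hic : i = c
        · simp [hic]
        · simp [hc2 i (Finset.mem_erase.2 ⟨hic, hi⟩)]
      have : 1 ≤ closeCost e := by unfold closeCost; split <;> omega
      omega

/-! ### What the check of a tree says about its branches. -/

/-- The tree `t` is correct from the given position, if the known cells are those that it
prescribes. -/
def Tree.Entry (t : Tree) (V p k x y : ℕ) : Prop :=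
  t.isNil = false ∧
    t.check V (t.block.known V x) p k x y (t.block.known V x ^^^ V) = true

def Tree.size : Tree → ℕ
  | .leaf _ _ _ => 1
  | .br _ t r => t.size + r.size + 1
  | .nil => 1

theorem testBit_of_land_eq {a b i : ℕ} (h : a &&& b = a) (hi : a.testBit i = true) :
    b.testBit i = true := by
  rw [← h, Nat.testBit_and, Bool.and_eq_true] at hi
  exact hi.2

/-- The provisional block of a node is the finished block of the leaf found along first branches. On
the way there `V` only grows and an exit once fixed is kept, so the facts checked at that leaf hold
at the node. -/
theorem Tree.check_block {t : Tree} {V F p k x y rem : ℕ}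
    (h : t.check V F p k x y rem = true) (ht : t.isNil = false) :
    t.block.valid = true ∧ (∀ i, V.testBit i = true → t.block.mask.testBit i = true) ∧
      (x = 0 ∨ (x = t.block.a ∧ y = t.block.b)) := by
  induction t generalizing V F p k x y rem with
  | nil => simp [Tree.isNil] at ht
  | leaf q a b =>
    simp only [Tree.check, Bool.and_eq_true, Bool.or_eq_true, Nat.beq_eq] at h
    obtain ⟨⟨⟨h1, h2⟩, h3⟩, -⟩ := h
    exact ⟨h1, fun i => testBit_of_land_eq h2, h3⟩
  | br c t r iht ihr =>
    simp only [Tree.check, Bool.and_eq_true, Bool.not_eq_true'] at h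
    obtain ⟨⟨⟨⟨⟨h0, -⟩, -⟩, -⟩, -⟩, h⟩ := h
    by_cases hc : t.block.mask.testBit c = true
    · simp only [hc, cond_true] at h
      obtain ⟨h1, h2, h3⟩ := iht h h0
      exact ⟨h1, fun i hi => h2 i ((testBit_insertBit _ _ _).2 (Or.inl hi)), h3⟩
    · simp only [Bool.not_eq_true] at hc
      simp only [hc, cond_false, Bool.and_eq_true, Nat.beq_eq] at h
      obtain ⟨h1, h2, -⟩ := iht h.2 h0
      exact ⟨h1, h2, Or.inl h.1.1⟩

/-- All branches of a list are checked with the same `V`, `F`, `p` and `k`; only `rem` loses the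
cells already treated. The equation for `F` says that the reply `u` shows the agent what it knew
before. The second alternative is the declaration that `c` lies behind the neck. -/
theorem Tree.check_branch {t : Tree} {V F p k x y rem c : ℕ}
    (h : t.check V F p k x y rem = true) (ht : t.isLeaf = false)
    (hc : rem.testBit c = true) :
    ∃ u : Tree, u.size < t.size ∧ F = u.block.known V x ∧
      ((u.block.mask.testBit c = true ∧
          u.Entry (insertBit V c) c (k + layerOf V c 22 (1 <<< p) + 1) x y) ∨
        (x = 0 ∧ u.block.a + 1 = c ∧
          u.Entry V u.block.a (k + layerOf V c 22 (1 <<< p)) u.block.a u.block.b)) := by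
  induction t generalizing rem with
  | nil =>
    simp only [Tree.check, Nat.beq_eq] at h
    simp [h] at hc
  | leaf q a b => simp [Tree.isLeaf] at ht
  | br d t r iht ihr =>
    simp only [Tree.check, Bool.and_eq_true, Bool.not_eq_true', Nat.beq_eq] at h
    obtain ⟨⟨⟨⟨⟨h0, hr⟩, h1⟩, h2⟩, h3⟩, h⟩ := h
    by_cases hcd : c = d
    · subst hcd
      refine ⟨t, by simp only [Tree.size]; omega, h3, ?_⟩
      by_cases hm : t.block.mask.testBit c = true
      · simp only [hm, cond_true] at h
        exact Or.inl ⟨hm, h0, h⟩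
      · simp only [Bool.not_eq_true] at hm
        simp only [hm, cond_false, Bool.and_eq_true, Nat.beq_eq] at h
        exact Or.inr ⟨h.1.1, h.1.2, h0, h.2⟩
    · obtain ⟨u, hu, hu'⟩ := ihr h2 hr ((testBit_erase h1).2 ⟨hc, hcd⟩)
      exact ⟨u, by simp only [Tree.size]; omega, hu'⟩


/-! ### Geometry of a finished block, read off from its bits. -/

theorem testBit_known {B : Block} {V x i : ℕ} : (B.known V x).testBit i = true ↔
    V.testBit i = true ∨ ((nbrs V).testBit i = true ∧ (B.full x).testBit i = true) := by
  simp [Block.known, Nat.testBit_or, Nat.testBit_and]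

theorem testBit_full_zero {B : Block} {i : ℕ} : (B.full 0).testBit i = true ↔
    B.mask.testBit i = true ∨ i = B.a + 1 ∨ i = B.b + 1 := by
  simp [Block.full, testBit_insertBit, or_assoc]

theorem Block.full_of_ne {B : Block} {x : ℕ} (h : x ≠ 0) : B.full x = B.mask := by
  have : x.beq 0 = false := by rw [Bool.eq_false_iff]; simpa using h
  simp [Block.full, this]

theorem testBit_maskOf {l : List ℕ} {i : ℕ} : (maskOf l).testBit i = true ↔ i ∈ l := by
  induction l with
  | nil => simp [maskOf]
  | cons c l ih => rw [maskOf, testBit_insertBit, ih, List.mem_cons, or_comm]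

theorem testBit_blockBox {i : ℕ} (h : blockBox.testBit i = true) :
    i < 72 ∧ i % 9 ≤ 6 ∧ i / 9 ≤ 7 ∧ (i % 9 = 0 → 3 ≤ i / 9 ∧ i / 9 ≤ 6) := by
  have h64 : i < 72 := by
    by_contra hi
    have h1 : 2 ^ i ≤ blockBox := Nat.ge_two_pow_of_testBit h
    have h2 : 2 ^ 72 ≤ 2 ^ i := Nat.pow_le_pow_right (by norm_num) (by omega)
    have h3 : blockBox < 2 ^ 72 := by decide
    omega
  revert h
  have : ∀ i < 72, blockBox.testBit i = true →
    i < 72 ∧ i % 9 ≤ 6 ∧ i / 9 ≤ 7 ∧ (i % 9 = 0 → 3 ≤ i / 9 ∧ i / 9 ≤ 6) := by decide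
  exact this i h64

theorem testBit_boxTo {A i : ℕ} (hA : A ≤ 6) :
    (boxTo A).testBit i = true ↔ i < 72 ∧ i % 9 ≤ A := by
  constructor
  · intro h
    have h64 : i < 72 := by
      by_contra hi
      have h1 : 2 ^ i ≤ boxTo A := Nat.ge_two_pow_of_testBit h
      have h2 : 2 ^ 72 ≤ 2 ^ i := Nat.pow_le_pow_right (by norm_num) (by omega)
      have h3 : ∀ A ≤ 6, boxTo A < 2 ^ 72 := by decide
      have := h3 A hA
      omega
    revert h
    have : ∀ A ≤ 6, ∀ i < 72, (boxTo A).testBit i = true → i < 72 ∧ i % 9 ≤ A := by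
      decide +kernel
    exact this A hA i h64
  · rintro ⟨h1, h2⟩
    have : ∀ A ≤ 6, ∀ i < 72, i % 9 ≤ A → (boxTo A).testBit i = true := by decide +kernel
    exact this A hA i h1 h2

/-- The properties of a finished block that do not depend on the agent. -/
structure Block.Good (B : Block) : Prop where
  col_le : B.a % 9 ≤ 6
  neck : B.b = B.a + 9 ∨ B.a = B.b + 9
  box : ∀ i, B.mask.testBit i = true →
    i % 9 ≤ B.a % 9 ∧ i / 9 ≤ 7 ∧ (i % 9 = 0 → 3 ≤ i / 9 ∧ i / 9 ≤ 6)
  mem_a : B.mask.testBit B.a = true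
  mem_b : B.mask.testBit B.b = true
  clear : ∀ i, B.mask.testBit i = true → i ≠ B.a → i ≠ B.b →
    i + 9 ≠ B.a ∧ i + 9 ≠ B.b ∧ i ≠ B.a + 9 ∧ i ≠ B.b + 9
  hasStep : hasStep B.a B.b B.path = true
  getLast : B.path.getLastD 0 = 45
  length_le : B.path.length ≤ 22
  even : B.path.length % 2 = 0
  flood : flood (boxTo (B.a % 9) ^^^ B.mask) 20
    ((boxTo (B.a % 9) ^^^ B.mask) &&& (outerRows ||| columnMask <<< (B.a % 9))) = true

theorem Block.good_of_valid {B : Block} (h : B.valid = true) : B.Good := by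
  simp only [Block.valid, Block.col, Bool.and_eq_true, Bool.or_eq_true, Nat.beq_eq,
    Nat.ble_eq] at h
  obtain ⟨⟨⟨⟨⟨⟨⟨⟨⟨h1, -⟩, h3⟩, h4⟩, h5⟩, h6⟩, h7⟩, h8⟩, h9⟩, h10⟩ := h
  -- The constant has the bits 0, 9, 18, 27: four consecutive cells of a column. Shifted to start
  -- one row below the neck, they are the cell below the neck, the neck itself and the cell above
  -- it, and exactly the neck has to be free.
  have hstrip : ∀ i d, i + 9 = B.low + d → d < 28 → (0x8040201).testBit d = true →
      (B.mask.testBit i = true ↔ ((0x201 : ℕ) <<< B.low).testBit i = true) := by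
    intro i d hd _ hb
    rw [← h5, Nat.testBit_and, Nat.testBit_shiftRight, Nat.testBit_shiftLeft]
    have e : 9 + i - B.low = d := by omega
    simp only [e, hb, Bool.and_true, Bool.and_eq_true, decide_eq_true_eq]
    constructor
    · intro h; exact ⟨h, by omega⟩
    · exact fun h => h.1
  have s0 : ∀ i, i + 9 = B.low → ¬ B.mask.testBit i = true := by
    intro i hi
    rw [hstrip i 0 (by omega) (by norm_num) (by decide), Nat.testBit_shiftLeft]
    simp; omega
  have s1 : B.mask.testBit B.low = true := by
    rw [hstrip _ 9 rfl (by norm_num) (by decide), Nat.testBit_shiftLeft]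
    simp
  have s2 : B.mask.testBit (B.low + 9) = true := by
    rw [hstrip _ 18 (by omega) (by norm_num) (by decide), Nat.testBit_shiftLeft]
    simp [show (513 : ℕ).testBit 9 = true by decide]
  have s3 : ¬ B.mask.testBit (B.low + 18) = true := by
    rw [hstrip _ 27 (by omega) (by norm_num) (by decide), Nat.testBit_shiftLeft]
    simp [show (513 : ℕ).testBit 18 = false by decide]
  have hab : (B.low = B.a ∧ B.b = B.low + 9) ∨ (B.low = B.b ∧ B.a = B.low + 9) := by
    rcases h3 with h3 | h3
    · exact Or.inl ⟨h3.1, h3.2.symm⟩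
    · exact Or.inr ⟨h3.1, h3.2.symm⟩
  refine ⟨h1, by omega, ?_, ?_, ?_, ?_, h6, h7, h8, h9, h10⟩
  · intro i hi
    have := testBit_of_land_eq h4 hi
    rw [Nat.testBit_and, Bool.and_eq_true, testBit_boxTo h1] at this
    exact ⟨this.2.2, (testBit_blockBox this.1).2.2⟩
  · rcases hab with h | h
    · rw [← h.1]; exact s1
    · rw [h.2]; exact s2
  · rcases hab with h | h
    · rw [h.2]; exact s2
    · rw [← h.1]; exact s1
  · intro i hi ha hb
    have h0 : i + 9 ≠ B.low := fun h => s0 i h hi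
    have h4 : i ≠ B.low + 18 := by rintro rfl; exact s3 hi
    omega

/-! ### Frames, and gluing a set of cells behind a neck. -/

theorem adj_iff {a b : Cell} : edgeGraph.Adj a b ↔
    (a.1 = b.1 ∧ (a.2 = b.2 + 1 ∨ b.2 = a.2 + 1)) ∨
      (a.2 = b.2 ∧ (a.1 = b.1 + 1 ∨ b.1 = a.1 + 1)) := by
  change |a.1 - b.1| + |a.2 - b.2| = 1 ↔ _
  rcases abs_cases (a.1 - b.1) with h | h <;> rcases abs_cases (a.2 - b.2) with h' | h' <;> omega

theorem touch_iff {a b : Cell} : touchGraph.Adj a b ↔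
    a ≠ b ∧ a.1 ≤ b.1 + 1 ∧ b.1 ≤ a.1 + 1 ∧ a.2 ≤ b.2 + 1 ∧ b.2 ≤ a.2 + 1 := by
  change a ≠ b ∧ |a.1 - b.1| ≤ 1 ∧ |a.2 - b.2| ≤ 1 ↔ _
  rw [abs_le, abs_le]
  constructor
  · rintro ⟨h, h1, h2⟩; exact ⟨h, by omega⟩
  · rintro ⟨h, h1⟩; exact ⟨h, by omega⟩

/-- The two cells through which a block is entered. -/
def entryA : Cell := (0, 4)

/-- The partner of `entryA`. -/
def entryB : Cell := (0, 5)

/-- The position of a block relative to the previous one: the column `w` of the neck, the row `y`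
in which the neck is used first, and whether the other row is above. -/
structure Frame : Type where
  w : ℤ
  y : ℤ
  up : Bool

namespace Frame

def toLocal (F : Frame) (c : Cell) : Cell :=
  (c.1 - F.w - 1, if F.up then c.2 - F.y + 4 else F.y - c.2 + 4)

def toGlobal (F : Frame) (c : Cell) : Cell :=
  (c.1 + F.w + 1, if F.up then c.2 + F.y - 4 else F.y + 4 - c.2)

/-- The neck cell that is used first. -/
def fst (F : Frame) : Cell := (F.w, F.y)

/-- The other neck cell. -/
def snd (F : Frame) : Cell := (F.w, if F.up then F.y + 1 else F.y - 1)

variable (F : Frame)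

@[simp] theorem toLocal_toGlobal (c : Cell) : F.toLocal (F.toGlobal c) = c := by
  obtain ⟨w, y, _ | _⟩ := F <;> ext <;> simp [toLocal, toGlobal] <;> omega

@[simp] theorem toGlobal_toLocal (c : Cell) : F.toGlobal (F.toLocal c) = c := by
  obtain ⟨w, y, _ | _⟩ := F <;> ext <;> simp [toLocal, toGlobal] <;> omega

theorem toLocal_injective : Function.Injective F.toLocal :=
  Function.LeftInverse.injective F.toGlobal_toLocal

@[simp] theorem toLocal_fst (c : Cell) : (F.toLocal c).1 = c.1 - F.w - 1 := rfl

@[simp] theorem toGlobal_fst (c : Cell) : (F.toGlobal c).1 = c.1 + F.w + 1 := rfl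

theorem adj_toLocal {a b : Cell} :
    edgeGraph.Adj (F.toLocal a) (F.toLocal b) ↔ edgeGraph.Adj a b := by
  obtain ⟨w, y, _ | _⟩ := F <;> simp [toLocal, adj_iff] <;> omega

theorem adj_toGlobal {a b : Cell} :
    edgeGraph.Adj (F.toGlobal a) (F.toGlobal b) ↔ edgeGraph.Adj a b := by
  rw [← F.adj_toLocal]; simp

theorem touch_toGlobal {a b : Cell} :
    touchGraph.Adj (F.toGlobal a) (F.toGlobal b) ↔ touchGraph.Adj a b := by
  rw [touch_iff, touch_iff, (Function.LeftInverse.injective F.toLocal_toGlobal).ne_iff]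
  obtain ⟨w, y, _ | _⟩ := F <;> simp [toGlobal] <;> omega

theorem adj_fst_snd : edgeGraph.Adj F.fst F.snd := by
  obtain ⟨w, y, _ | _⟩ := F <;> simp [fst, snd, adj_iff]

end Frame

/-- The cells of a block fit into a frame. -/
structure Glue (F : Frame) (S : Cell → Prop) : Prop where
  w_nonneg : 0 ≤ F.w
  le : ∀ c, S c → 0 ≤ c.1 ∧ c.1 ≤ F.w ∧ (c.1 = 0 → 3 ≤ c.2 ∧ c.2 ≤ 6)
  fst : S F.fst
  snd : S F.snd
  clear : ∀ c, S c → c.1 = F.w → 3 ≤ (F.toLocal c).2 → (F.toLocal c).2 ≤ 6 → c = F.fst ∨ c = F.snd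

/-- A set of cells that can be placed behind a neck. -/
structure Proper (T : Cell → Prop) : Prop where
  memA : T entryA
  memB : T entryB
  nonneg : ∀ c, T c → 0 ≤ c.1
  rows : ∀ c, T c → c.1 = 0 → 3 ≤ c.2 ∧ c.2 ≤ 6

/-- The set `S`, with `T` placed behind its neck. -/
def glue (F : Frame) (S T : Cell → Prop) (c : Cell) : Prop :=
  if c.1 ≤ F.w then S c else T (F.toLocal c)

theorem glue_of_le {F : Frame} {S T : Cell → Prop} {c : Cell} (h : c.1 ≤ F.w) :
    glue F S T c ↔ S c := by simp [glue, h]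

theorem glue_of_lt {F : Frame} {S T : Cell → Prop} {c : Cell} (h : F.w < c.1) :
    glue F S T c ↔ T (F.toLocal c) := by simp [glue, not_le.2 h]

section
variable {F : Frame} {S T T' : Cell → Prop}

theorem Glue.proper_glue (hS : Glue F S) (hA : S entryA) (hB : S entryB) :
    Proper (glue F S T) where
  memA := (glue_of_le hS.w_nonneg).2 hA
  memB := (glue_of_le hS.w_nonneg).2 hB
  nonneg c hc := by
    rcases le_or_gt c.1 F.w with h | h
    · exact (hS.le c ((glue_of_le h).1 hc)).1
    · have := hS.w_nonneg; omega
  rows c hc h0 := by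
    rw [glue_of_le (by rw [h0]; exact hS.w_nonneg)] at hc
    exact (hS.le c hc).2.2 h0

theorem entryA_eq (F : Frame) {c : Cell} :
    F.toLocal c = entryA ↔ c = (F.w + 1, F.y) := by
  obtain ⟨w, y, _ | _⟩ := F <;> simp [Frame.toLocal, entryA, Prod.ext_iff] <;> omega

theorem entryB_eq (F : Frame) {c : Cell} :
    F.toLocal c = entryB ↔ c = (F.w + 1, F.snd.2) := by
  obtain ⟨w, y, _ | _⟩ := F <;> simp [Frame.toLocal, Frame.snd, entryB, Prod.ext_iff] <;> omega

/-- In its column 0 the set `T` has cells in the local rows 3 to 6 only, and in these rows the last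
column of `S` contains nothing but the neck. So the two sides share no edge other than the two at
the neck. -/
theorem Glue.crossing (hS : Glue F S) (hT : Proper T) {u v : Cell} (hu : S u) (hv : F.w < v.1)
    (hvT : T (F.toLocal v)) (h : edgeGraph.Adj u v) :
    (u = F.fst ∧ F.toLocal v = entryA) ∨ (u = F.snd ∧ F.toLocal v = entryB) := by
  have h1 := (hS.le u hu).2.1
  rw [adj_iff] at h
  have h2 : u.1 = F.w ∧ v.1 = F.w + 1 ∧ v.2 = u.2 := by omega
  have h3 := hT.rows _ hvT (by simp [h2.2.1])
  have h4 : (F.toLocal v).2 = (F.toLocal u).2 := by simp [Frame.toLocal, h2.2.2]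
  rw [h4] at h3
  rw [entryA_eq, entryB_eq]
  rcases hS.clear u hu h2.1 h3.1 h3.2 with h | h
  · left; refine ⟨h, Prod.ext h2.2.1 ?_⟩; rw [h2.2.2, h]; rfl
  · right; refine ⟨h, Prod.ext h2.2.1 ?_⟩; rw [h2.2.2, h]

/-- The cells whose status the agent knows after a visit of `v`. -/
def Near (v u : Cell) : Prop := u = v ∨ edgeGraph.Adj v u

theorem Near.toLocal {v u : Cell} (F : Frame) (h : Near v u) : Near (F.toLocal v) (F.toLocal u) := by
  rcases h with rfl | h
  · exact Or.inl rfl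
  · exact Or.inr (F.adj_toLocal.2 h)

/-- From the first block one sees behind the neck only the cells `entryA` and `entryB`, and these
belong to every proper set. So exchanging the tail cannot be noticed there. -/
theorem Glue.near_congr_tail (hS : Glue F S) (hT : Proper T) (hT' : Proper T') {v u : Cell}
    (hv : glue F S T v) (huv : Near v u)
    (h : F.w < v.1 → (T (F.toLocal u) ↔ T' (F.toLocal u))) :
    glue F S T u ↔ glue F S T' u := by
  rcases le_or_gt u.1 F.w with hu | hu
  · rw [glue_of_le hu, glue_of_le hu]
  rw [glue_of_lt hu, glue_of_lt hu]
  rcases le_or_gt v.1 F.w with hv' | hv'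
  · rw [glue_of_le hv'] at hv
    have huv' : edgeGraph.Adj v u := by
      rcases huv with rfl | h
      · omega
      · exact h
    constructor
    · intro h
      rcases hS.crossing hT hv hu h huv' with ⟨-, h⟩ | ⟨-, h⟩ <;> rw [h]
      exacts [hT'.memA, hT'.memB]
    · intro h
      rcases hS.crossing hT' hv hu h huv' with ⟨-, h⟩ | ⟨-, h⟩ <;> rw [h]
      exacts [hT.memA, hT.memB]
  · exact h hv'

/-- The mirror statement: from behind the neck only the two neck cells are visible, so a block may
be exchanged for another one with the same frame. -/
theorem Glue.near_congr_head {S' : Cell → Prop} (hS : Glue F S) (hS' : Glue F S') (hT : Proper T)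
    {v u : Cell} (hv : F.w < v.1) (hvT : T (F.toLocal v)) (huv : Near v u) :
    glue F S T u ↔ glue F S' T u := by
  rcases le_or_gt u.1 F.w with hu | hu
  · rw [glue_of_le hu, glue_of_le hu]
    have huv' : edgeGraph.Adj u v := by
      rcases huv with rfl | h
      · omega
      · exact h.symm
    constructor
    · intro h
      rcases hS.crossing hT h hv hvT huv' with ⟨h, -⟩ | ⟨h, -⟩ <;> rw [h]
      exacts [hS'.fst, hS'.snd]
    · intro h
      rcases hS'.crossing hT h hv hvT huv' with ⟨h, -⟩ | ⟨h, -⟩ <;> rw [h]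
      exacts [hS.fst, hS.snd]
  · rw [glue_of_lt hu, glue_of_lt hu]

end

/-! ### Cutting a walk at a neck and distributing its cost. -/

/-- A list of cells in which consecutive ones are equal or adjacent. -/
def Lazy (l : List Cell) : Prop := l.IsChain fun x y => x = y ∨ edgeGraph.Adj x y

theorem lazy_cons {x : Cell} {l : List Cell} :
    Lazy (x :: l) ↔ (∀ y, l.head? = some y → x = y ∨ edgeGraph.Adj x y) ∧ Lazy l := by
  unfold Lazy
  rw [List.isChain_cons]
  simp

/-- The part of a list of cells in the first block. -/
def Frame.lo (F : Frame) (l : List Cell) : List Cell := l.filter fun c => c.1 ≤ F.w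

/-- The part of a list of cells behind the first block. -/
def Frame.hi (F : Frame) (l : List Cell) : List Cell :=
  (l.filter fun c => F.w < c.1).map F.toLocal

section
variable {F : Frame}

theorem Frame.lo_cons_of_le {c : Cell} {l : List Cell} (h : c.1 ≤ F.w) :
    F.lo (c :: l) = c :: F.lo l := by simp [lo, h]

theorem Frame.lo_cons_of_lt {c : Cell} {l : List Cell} (h : F.w < c.1) :
    F.lo (c :: l) = F.lo l := by simp [lo, h]

theorem Frame.hi_cons_of_le {c : Cell} {l : List Cell} (h : c.1 ≤ F.w) :
    F.hi (c :: l) = F.hi l := by simp [hi, h]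

theorem Frame.hi_cons_of_lt {c : Cell} {l : List Cell} (h : F.w < c.1) :
    F.hi (c :: l) = F.toLocal c :: F.hi l := by simp [hi, h]

theorem Frame.mem_lo {c : Cell} {l : List Cell} : c ∈ F.lo l ↔ c ∈ l ∧ c.1 ≤ F.w := by
  simp [lo]

theorem Frame.toLocal_mem_hi {c : Cell} {l : List Cell} :
    F.toLocal c ∈ F.hi l ↔ c ∈ l ∧ F.w < c.1 := by
  simp [hi, F.toLocal_injective.eq_iff]

theorem Frame.mem_hi {d : Cell} {l : List Cell} :
    d ∈ F.hi l ↔ F.toGlobal d ∈ l ∧ F.w < (F.toGlobal d).1 := by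
  rw [← Frame.toLocal_mem_hi, toLocal_toGlobal]

end

/-- The cost of closing the local tour in an entry cell. -/
def closeCell (c : Cell) : ℕ := if c = entryA then 2 else 1

/-- If the agent is in the first block: it is charged for its moves in both parts, and for closing
its tour in the part behind the neck. -/
structure SplitLo (F : Frame) (l : List Cell) : Prop where
  moves_le : F.hi l = [] → moves (F.lo l) ≤ moves l
  head : ∀ h, (F.hi l).head? = some h → (h = entryA ∨ h = entryB) ∧
    moves (F.lo l) + moves (F.hi l) + closeCell h ≤ moves l

/-- If the agent is behind the first block: it is charged for its moves in both parts. -/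
def SplitHi (F : Frame) (l : List Cell) : Prop :=
  ∃ n, (F.lo l).head? = some n ∧
    ((n = F.fst ∧ moves (F.lo l) + moves (F.hi l) + 1 ≤ moves l) ∨
      (n = F.snd ∧ moves (F.lo l) + moves (F.hi l) + 2 ≤ moves l))

theorem entryA_ne_entryB : entryA ≠ entryB := by simp [entryA, entryB]

theorem adj_entry : edgeGraph.Adj entryA entryB := by simp [adj_iff, entryA, entryB]

theorem moves_cons_le {x y : Cell} {l : List Cell} (h : l.head? = some y) :
    moves (x :: l) ≤ moves l + 1 ∧ (x = y → moves (x :: l) = moves l) ∧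
      (x ≠ y → moves (x :: l) = moves l + 1) := by
  cases l with
  | nil => simp at h
  | cons z l =>
    simp only [List.head?_cons, Option.some.injEq] at h
    subst h
    by_cases hxz : x = z
    · subst hxz; simp [moves]
    · rw [moves_cons_ne hxz]; simp [hxz]

/-- The excess of `moves l` over the moves of the two parts serves as a potential. While the agent
is behind the neck it is at least 1 if it left by `F.fst` and at least 2 if it left by `F.snd`; back
in the first block it is at least 2 or 1, according to whether it last stood in `entryA` or
`entryB`. Each crossing adds one to the excess, and a change of side between two crossings takes one
away for the step along the neck or between the entry cells. All combinations balance. The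
assumption `hhi` says that the first entry is through `entryA`. -/
theorem Glue.split {F : Frame} {S T : Cell → Prop} (hS : Glue F S) (hT : Proper T) (l : List Cell)
    (hl : Lazy l) (hne : l ≠ []) (hmem : ∀ c ∈ l, glue F S T c)
    (hlast : ∀ c, l.getLast? = some c → c.1 ≤ F.w)
    (hhi : ∀ c, (F.hi l).getLast? = some c → c = entryA) :
    Lazy (F.lo l) ∧ Lazy (F.hi l) ∧
      (∀ h, l.head? = some h → (h.1 ≤ F.w → SplitLo F l) ∧ (F.w < h.1 → SplitHi F l)) := by
  induction l with
  | nil => exact absurd rfl hne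
  | cons z l ih =>
    rw [lazy_cons] at hl
    cases l with
    | nil =>
      have hz : z.1 ≤ F.w := hlast z (by simp)
      have hlo : F.lo [z] = [z] := by rw [Frame.lo_cons_of_le hz]; rfl
      have hhi' : F.hi [z] = [] := by rw [Frame.hi_cons_of_le hz]; rfl
      refine ⟨by rw [hlo]; exact List.isChain_singleton _, by rw [hhi']; exact List.isChain_nil, ?_⟩
      intro h hh
      obtain rfl : z = h := by simpa using hh
      exact ⟨fun _ => ⟨by simp [hlo], by simp [hhi']⟩, fun h => by omega⟩
    | cons y l =>
      have hlast' : ∀ c, (y :: l).getLast? = some c → c.1 ≤ F.w := by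
        intro c hc; exact hlast c (by rw [List.getLast?_cons_cons]; exact hc)
      have hmem' : ∀ c ∈ y :: l, glue F S T c := fun c hc => hmem c (List.mem_cons_of_mem _ hc)
      have hhi' : ∀ c, (F.hi (y :: l)).getLast? = some c → c = entryA := by
        intro c hc
        apply hhi c
        rcases le_or_gt z.1 F.w with hz | hz
        · rw [Frame.hi_cons_of_le hz]; exact hc
        · rw [Frame.hi_cons_of_lt hz]
          cases hh : F.hi (y :: l) with
          | nil => simp [hh] at hc
          | cons a b => rw [List.getLast?_cons_cons, ← hh]; exact hc
      obtain ⟨h1, h2, h3⟩ := ih hl.2 (by simp) hmem' hlast' hhi'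
      specialize h3 y rfl
      have hzy := hl.1 y rfl
      have hgz := hmem z (by simp)
      have hgy := hmem y (by simp)
      have hm := moves_cons_le (x := z) (y := y) (l := y :: l) rfl
      rcases le_or_gt z.1 F.w with hz | hz <;> rcases le_or_gt y.1 F.w with hy | hy
      · -- both in the first block
        have hlo := Frame.lo_cons_of_le (l := y :: l) hz
        have hhi2 := Frame.hi_cons_of_le (l := y :: l) hz
        have hloy := Frame.lo_cons_of_le (l := l) hy
        have hm' := moves_cons_le (x := z) (y := y) (l := F.lo (y :: l)) (by rw [hloy]; rfl)
        have hadd : moves (z :: F.lo (y :: l)) + moves (y :: l) =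
            moves (F.lo (y :: l)) + moves (z :: y :: l) := by
          by_cases h : z = y
          · rw [hm.2.1 h, hm'.2.1 h]
          · rw [hm.2.2 h, hm'.2.2 h]; ring
        refine ⟨?_, by rw [hhi2]; exact h2, ?_⟩
        · rw [hlo, lazy_cons]
          refine ⟨fun q hq => ?_, h1⟩
          rw [hloy] at hq
          obtain rfl : y = q := by simpa using hq
          exact hzy
        · intro h hh
          obtain rfl : z = h := by simpa using hh
          refine ⟨fun _ => ?_, fun h => by omega⟩
          have h4 := h3.1 hy
          constructor
          · intro h5; rw [hhi2] at h5; have := h4.moves_le h5; rw [hlo]; omega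
          · intro q hq; rw [hhi2] at hq ⊢; have := h4.head q hq; rw [hlo]; exact ⟨this.1, by omega⟩
      · -- return to the first block
        have hlo := Frame.lo_cons_of_le (l := y :: l) hz
        have hhi2 := Frame.hi_cons_of_le (l := y :: l) hz
        have hhiy := Frame.hi_cons_of_lt (l := l) hy
        have hne' : z ≠ y := by rintro rfl; omega
        have hcr := hS.crossing hT ((glue_of_le hz).1 hgz) hy ((glue_of_lt hy).1 hgy)
          (hzy.resolve_left hne')
        obtain ⟨n, hn, hn'⟩ := h3.2 hy
        have hm' := moves_cons_le (x := z) (y := n) (l := F.lo (y :: l)) hn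
        have hnS : n = F.fst ∨ n = F.snd := by tauto
        refine ⟨?_, by rw [hhi2]; exact h2, ?_⟩
        · rw [hlo, lazy_cons]
          refine ⟨fun q hq => ?_, h1⟩
          obtain rfl : n = q := by rw [hn] at hq; simpa using hq
          rcases hcr with ⟨rfl, -⟩ | ⟨rfl, -⟩ <;> rcases hnS with rfl | rfl
          · exact Or.inl rfl
          · exact Or.inr F.adj_fst_snd
          · exact Or.inr F.adj_fst_snd.symm
          · exact Or.inl rfl
        · intro h hh
          obtain rfl : z = h := by simpa using hh
          refine ⟨fun _ => ⟨?_, ?_⟩, fun h => by omega⟩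
          · intro h5; rw [hhi2, hhiy] at h5; simp at h5
          · intro q hq
            rw [hhi2] at hq ⊢
            rw [hlo, hm.2.2 hne']
            have hq' : F.toLocal y = q := by rw [hhiy] at hq; simpa using hq
            rcases hcr with ⟨rfl, hA⟩ | ⟨rfl, hB⟩
            · refine ⟨Or.inl (by rw [← hq', hA]), ?_⟩
              rw [← hq', hA]
              simp only [closeCell, if_true]
              rcases hn' with ⟨rfl, h⟩ | ⟨rfl, h⟩
              · rw [hm'.2.1 rfl]; omega
              · have := hm'.1; omega
            · refine ⟨Or.inr (by rw [← hq', hB]), ?_⟩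
              rw [← hq', hB]
              simp only [closeCell, entryA_ne_entryB.symm, if_false]
              rcases hn' with ⟨rfl, h⟩ | ⟨rfl, h⟩
              · have := hm'.1; omega
              · rw [hm'.2.1 rfl]; omega
      · -- entering the part behind the neck
        have hlo := Frame.lo_cons_of_lt (l := y :: l) hz
        have hhi2 := Frame.hi_cons_of_lt (l := y :: l) hz
        have hloy := Frame.lo_cons_of_le (l := l) hy
        have hne' : z ≠ y := by rintro rfl; omega
        have hcr := hS.crossing hT ((glue_of_le hy).1 hgy) hz ((glue_of_lt hz).1 hgz)
          (hzy.resolve_left hne').symm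
        have h4 := h3.1 hy
        cases hg : F.hi (y :: l) with
        | nil =>
          -- Nothing behind the neck was visited before, so `z` is the oldest cell of that part and
          -- `hhi` applies to it. An excess of 1 has to suffice here, which excludes a first entry
          -- from `F.snd`.
          have hzA : F.toLocal z = entryA := hhi _ (by rw [hhi2, hg]; rfl)
          refine ⟨by rw [hlo]; exact h1, by rw [hhi2, hg]; exact List.isChain_singleton _, ?_⟩
          intro h hh
          obtain rfl : z = h := by simpa using hh
          refine ⟨fun h => by omega, fun _ => ⟨y, by rw [hlo, hloy]; rfl, Or.inl ?_⟩⟩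
          rw [hlo, hhi2, hg, hm.2.2 hne']
          have := h4.moves_le hg
          refine ⟨?_, by simpa [moves] using this⟩
          rcases hcr with h | h
          · exact h.1
          · rw [hzA] at h; exact absurd h.2 entryA_ne_entryB
        | cons q g =>
          have h5 := h4.head q (by rw [hg]; rfl)
          rw [hg] at h5
          have hm' := moves_cons_le (x := F.toLocal z) (y := q) (l := q :: g) rfl
          refine ⟨by rw [hlo]; exact h1, ?_, ?_⟩
          · rw [hhi2, hg, lazy_cons]
            refine ⟨fun q' hq' => ?_, by rw [← hg]; exact h2⟩
            obtain rfl : q = q' := by simpa using hq'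
            rcases hcr with ⟨-, h⟩ | ⟨-, h⟩ <;> rw [h] <;> rcases h5.1 with rfl | rfl
            · exact Or.inl rfl
            · exact Or.inr adj_entry
            · exact Or.inr adj_entry.symm
            · exact Or.inl rfl
          · intro h hh
            obtain rfl : z = h := by simpa using hh
            refine ⟨fun h => by omega, fun _ => ⟨y, by rw [hlo, hloy]; rfl, ?_⟩⟩
            rw [hlo, hhi2, hg, hm.2.2 hne']
            rcases hcr with ⟨hy1, hA⟩ | ⟨hy1, hB⟩
            · refine Or.inl ⟨hy1, ?_⟩
              rcases h5.1 with rfl | rfl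
              · rw [hm'.2.1 hA]; have := h5.2; simp only [closeCell, if_true] at this; omega
              · have := h5.2
                simp only [closeCell, entryA_ne_entryB.symm, if_false] at this
                have := hm'.1; omega
            · refine Or.inr ⟨hy1, ?_⟩
              rcases h5.1 with rfl | rfl
              · have := h5.2; simp only [closeCell, if_true] at this
                have := hm'.1; omega
              · rw [hm'.2.1 hB]; have := h5.2
                simp only [closeCell, entryA_ne_entryB.symm, if_false] at this
                omega
      · -- both behind the neck
        have hlo := Frame.lo_cons_of_lt (l := y :: l) hz
        have hhi2 := Frame.hi_cons_of_lt (l := y :: l) hz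
        have hhiy := Frame.hi_cons_of_lt (l := l) hy
        have hm' := moves_cons_le (x := F.toLocal z) (y := F.toLocal y) (l := F.hi (y :: l))
          (by rw [hhiy]; rfl)
        have hadd : moves (F.toLocal z :: F.hi (y :: l)) + moves (y :: l) =
            moves (F.hi (y :: l)) + moves (z :: y :: l) := by
          by_cases h : z = y
          · rw [hm.2.1 h, hm'.2.1 (by rw [h])]
          · rw [hm.2.2 h, hm'.2.2 (F.toLocal_injective.ne h)]; ring
        refine ⟨by rw [hlo]; exact h1, ?_, ?_⟩
        · rw [hhi2, lazy_cons]
          refine ⟨fun q hq => ?_, h2⟩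
          rw [hhiy] at hq
          obtain rfl : F.toLocal y = q := by simpa using hq
          rcases hzy with h | h
          · exact Or.inl (by rw [h])
          · exact Or.inr (F.adj_toLocal.2 h)
        · intro h hh
          obtain rfl : z = h := by simpa using hh
          refine ⟨fun h => by omega, fun _ => ?_⟩
          obtain ⟨n, hn, hn'⟩ := h3.2 hy
          refine ⟨n, by rw [hlo]; exact hn, ?_⟩
          rw [hlo, hhi2]
          rcases hn' with ⟨h, h'⟩ | ⟨h, h'⟩
          · exact Or.inl ⟨h, by omega⟩
          · exact Or.inr ⟨h, by omega⟩

/-! ### Translation between cells and codes. -/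

/-- The code of a cell in local coordinates. -/
def code (c : Cell) : ℕ := (9 * c.2 + c.1).toNat

/-- The cell with a given code. -/
def toCell (i : ℕ) : Cell := ((i % 9 : ℕ), (i / 9 : ℕ))

/-- The cells that have a code. -/
def InBox (c : Cell) : Prop := 0 ≤ c.1 ∧ c.1 ≤ 7 ∧ 0 ≤ c.2 ∧ c.2 ≤ 7

/-- Membership of a cell in a coded set. -/
def Mem (m : ℕ) (c : Cell) : Prop := InBox c ∧ m.testBit (code c) = true

theorem InBox.code_eq {c : Cell} (h : InBox c) : (code c : ℤ) = 9 * c.2 + c.1 := by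
  unfold InBox at h
  exact Int.toNat_of_nonneg (by omega)

/-- The box has columns 0 to 7 while a row has nine codes. The spare column keeps the rows apart: no
step by one connects box cells of different rows. -/
theorem InBox.code_mod {c : Cell} (h : InBox c) :
    ((code c % 9 : ℕ) : ℤ) = c.1 ∧ ((code c / 9 : ℕ) : ℤ) = c.2 := by
  have := h.code_eq
  unfold InBox at h
  omega

theorem InBox.toCell_code {c : Cell} (h : InBox c) : toCell (code c) = c :=
  Prod.ext h.code_mod.1 h.code_mod.2

theorem code_toCell (i : ℕ) : code (toCell i) = i := by
  simp only [code, toCell]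
  omega

theorem InBox.code_inj {c d : Cell} (hc : InBox c) (hd : InBox d) : code c = code d ↔ c = d :=
  ⟨fun h => by rw [← hc.toCell_code, h, hd.toCell_code], fun h => by rw [h]⟩

theorem InBox.adjN {c d : Cell} (hc : InBox c) (hd : InBox d) (h : edgeGraph.Adj c d) :
    AdjN (code c) (code d) := by
  have h1 := hc.code_eq
  have h2 := hd.code_eq
  rw [adj_iff] at h
  unfold AdjN
  omega

theorem lazyN_map_code {f : List Cell} (hf : ∀ c ∈ f, InBox c) (h : Lazy f) :
    LazyN (f.map code) := by
  induction f with
  | nil => exact List.isChain_nil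
  | cons x f ih =>
    rw [lazy_cons] at h
    cases f with
    | nil => exact List.isChain_singleton _
    | cons y f =>
      rw [List.map_cons, List.map_cons, LazyN, List.isChain_cons_cons]
      refine ⟨?_, ih (fun c hc => hf c (List.mem_cons_of_mem _ hc)) h.2⟩
      rcases h.1 y rfl with h | h
      · exact Or.inl (by rw [h])
      · exact Or.inr ((hf x (by simp)).adjN (hf y (by simp)) h)

theorem moves_map_code {f : List Cell} (hf : ∀ c ∈ f, InBox c) :
    moves (f.map code) = moves f := by
  induction f with
  | nil => rfl
  | cons x f ih =>
    cases f with
    | nil => rfl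
    | cons y f =>
      have := ih (fun c hc => hf c (List.mem_cons_of_mem _ hc))
      simp only [List.map_cons, moves] at this ⊢
      simp only [this, (hf x (by simp)).code_inj (hf y (by simp))]

/-- The frame behind a block; `sw` tells whether the cell `b` of the neck is used first. -/
def Block.frame (B : Block) (sw : Bool) : Frame where
  w := (B.a % 9 : ℕ)
  y := ((if sw then B.b else B.a) / 9 : ℕ)
  up := if sw then decide (B.b < B.a) else decide (B.a < B.b)

theorem Block.Good.fst_frame {B : Block} (hB : B.Good) (sw : Bool) :
    (B.frame sw).fst = toCell (if sw then B.b else B.a) := by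
  have := hB.neck
  cases sw <;> simp only [Block.frame, Frame.fst, toCell, Prod.mk.injEq, if_true] <;> simp <;> omega

theorem Block.Good.snd_frame {B : Block} (hB : B.Good) (sw : Bool) :
    (B.frame sw).snd = toCell (if sw then B.a else B.b) := by
  have := hB.neck
  cases sw <;> rcases this with h | h <;>
    simp [Block.frame, Frame.snd, toCell, h]

theorem Block.Good.mem_toCell {B : Block} (hB : B.Good) {i : ℕ} (h : B.mask.testBit i = true) :
    Mem B.mask (toCell i) := by
  have h1 := hB.box i h
  have h2 := hB.col_le
  refine ⟨?_, by rwa [code_toCell]⟩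
  simp only [InBox, toCell]
  omega

theorem Block.Good.le {B : Block} (hB : B.Good) {c : Cell} (h : Mem B.mask c) :
    0 ≤ c.1 ∧ c.1 ≤ (B.a % 9 : ℕ) ∧ (c.1 = 0 → 3 ≤ c.2 ∧ c.2 ≤ 6) := by
  have h1 := hB.box _ h.2
  have h2 := h.1.code_mod
  have h3 := h.1
  unfold InBox at h3
  omega

/-- In frame coordinates the neck has rows 4 and 5. Rows 3 and 6 are the cells just beside it in its
column, which the strip condition of a valid block keeps unfree. -/
theorem Block.Good.glue {B : Block} (hB : B.Good) (sw : Bool) :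
    Glue (B.frame sw) (Mem B.mask) where
  w_nonneg := by simp [Block.frame]; omega
  le c hc := hB.le hc
  fst := by
    rw [hB.fst_frame]
    cases sw
    · exact hB.mem_toCell hB.mem_a
    · exact hB.mem_toCell hB.mem_b
  snd := by
    rw [hB.snd_frame]
    cases sw
    · exact hB.mem_toCell hB.mem_b
    · exact hB.mem_toCell hB.mem_a
  clear c hc hw h3 h6 := by
    rw [hB.fst_frame, hB.snd_frame]
    have key : code c = B.a ∨ code c = B.b := by
      by_contra hne
      push Not at hne
      have h1 := hB.clear _ hc.2 hne.1 hne.2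
      have h2 := hc.1.code_eq
      have h4 := hB.neck
      have hw' : c.1 = (B.a % 9 : ℕ) := hw
      cases sw <;> rcases h4 with h | h <;>
        simp [Block.frame, Frame.toLocal, h] at h3 h6 <;> omega
    rw [← hc.1.toCell_code]
    rcases key with h | h <;> rw [h] <;> cases sw <;> simp

/-! ### Chains of blocks and the state of the play in one block. -/

/-- The polygons of the adversary: a chain of blocks, of which `m` have not been opened. -/
inductive Chain : Type
  | nil (m : ℕ)
  | cons (t : Tree) (sw : Bool) (tail : Chain)

namespace Chain

/-- The set of cells of a chain, in the local coordinates of its first block. -/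
def In : Chain → Cell → Prop
  | nil _ => fun c => c = entryA ∨ c = entryB
  | cons t sw tail => glue (t.block.frame sw) (Mem t.block.mask) tail.In

/-- The measure that makes the play finite: it drops at every change of the polygon. An unopened
block counts one more than the root tree, so opening a block is a drop as well. -/
def weight : Chain → ℕ
  | nil m => m * (rootTree.size + 1)
  | cons t _ tail => t.size + tail.weight

/-- The total number of blocks, opened or not. It is constant during the play and yields the lower
bound for the number of cells. -/
def depth : Chain → ℕ
  | nil m => m
  | cons _ _ tail => tail.depth + 1

end Chain

/-- The agent has visited the cells of `f` (latest first), and the adversary is in the node `t` of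
its strategy tree. -/
def Tree.State (t : Tree) (x y : ℕ) (f : List ℕ) : Prop :=
  ∃ V p k f1 f0, f = f1 ++ p :: f0 ∧ t.Entry V p k x y ∧
    (∀ i, V.testBit i = true ↔ i ∈ p :: f0) ∧ k ≤ moves (p :: f0) ∧
    (∀ i ∈ f1, t.block.mask.testBit i = true) ∧
    (t.isLeaf = true ∨ ∀ i ∈ f1, V.testBit i = true)

namespace Tree
variable {t : Tree} {x y : ℕ} {f : List ℕ}

theorem State.valid (h : t.State x y f) : t.block.valid = true ∧
    (∀ i ∈ f, t.block.mask.testBit i = true) ∧ (x = 0 ∨ (x = t.block.a ∧ y = t.block.b)) := by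
  obtain ⟨V, p, k, f1, f0, rfl, hE, hV, -, hm, -⟩ := h
  obtain ⟨h1, h2, h3⟩ := check_block hE.2 hE.1
  refine ⟨h1, fun i hi => ?_, h3⟩
  rcases List.mem_append.1 hi with h | h
  · exact hm i h
  · exact h2 i ((hV i).2 h)

theorem State.good (h : t.State x y f) : t.block.Good := Block.good_of_valid h.valid.1

/-- At a leaf the block is final and no reply is due. The data of the node stay as they were when it
was reached; the search starting there covers any continuation, including visits of new cells. -/
theorem State.cons_leaf (h : t.State x y f) (ht : t.isLeaf = true) {z : ℕ}
    (hz : t.block.mask.testBit z = true) : t.State x y (z :: f) := by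
  obtain ⟨V, p, k, f1, f0, rfl, hE, hV, hk, hm, -⟩ := h
  exact ⟨V, p, k, z :: f1, f0, rfl, hE, hV, hk, by simpa [hz] using hm, Or.inl ht⟩

/-- A revisit reveals nothing, so the node is kept; its moves are charged only with the next new
cell, through `layerOf`. -/
theorem State.cons_mem (h : t.State x y f) {z : ℕ} (hz : z ∈ f) : t.State x y (z :: f) := by
  have hzm := h.valid.2.1 z hz
  obtain ⟨V, p, k, f1, f0, rfl, hE, hV, hk, hm, hl⟩ := h
  refine ⟨V, p, k, z :: f1, f0, rfl, hE, hV, hk, by simpa [hzm] using hm, ?_⟩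
  rcases hl with hl | hl
  · exact Or.inl hl
  · right
    intro i hi
    rcases List.mem_cons.1 hi with rfl | hi
    · rcases List.mem_append.1 hz with h | h
      · exact hl _ h
      · exact (hV _).2 h
    · exact hl i hi

/-- The reaction of the adversary to the visit of a new cell. -/
theorem State.cons_new (h : t.State x y f) (ht : t.isLeaf = false) (hl : LazyN f) {q z : ℕ}
    (hq : f.head? = some q) (hqz : AdjN q z) (hz : (t.block.full x).testBit z = true)
    (hzf : z ∉ f) :
    ∃ u : Tree, u.size < t.size ∧
      (∀ i, (i ∈ f ∨ ∃ v ∈ f, AdjN v i) →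
        ((t.block.full x).testBit i = true ↔ (u.block.full x).testBit i = true)) ∧
      ((u.block.mask.testBit z = true ∧ u.State x y (z :: f)) ∨
        (x = 0 ∧ u.block.a + 1 = z ∧ u.State u.block.a u.block.b f)) := by
  have hmem := h.valid.2.1
  obtain ⟨V, p, k, f1, f0, rfl, hE, hV, hk, -, hf1⟩ := h
  have hf1 : ∀ i ∈ f1, V.testBit i = true := by
    rcases hf1 with h | h
    · rw [ht] at h; cases h
    · exact h
  have hVf : ∀ i, V.testBit i = true ↔ i ∈ f1 ++ p :: f0 := by
    intro i
    rw [hV, List.mem_append]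
    exact ⟨Or.inr, fun h => h.elim (fun h => (hV i).1 (hf1 i h)) id⟩
  have hqV : V.testBit q = true := (hVf q).2 (List.mem_of_mem_head? hq)
  have hN := testBit_nbrs hqV hqz
  have hzV : V.testBit z = false := by
    rw [Bool.eq_false_iff, ne_eq, hVf]; exact hzf
  have hrem : (t.block.known V x ^^^ V).testBit z = true := by
    rw [Nat.testBit_xor, hzV, testBit_known.2 (Or.inr ⟨hN, hz⟩)]; rfl
  obtain ⟨u, hu, hF, hu'⟩ := check_branch hE.2 ht hrem
  have hlp : LazyN (f1 ++ [p]) := by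
    have : f1 ++ p :: f0 = (f1 ++ [p]) ++ f0 := by simp
    rw [this] at hl
    exact hl.left_of_append
  have hqp : (f1 ++ [p]).head? = some q := by cases f1 <;> simpa using hq
  -- Since the last reply the agent has moved within `V`. Hence its true number of moves is at least
  -- the distance that the tree adds to `k`, and `k` stays a lower bound.
  have hreach := layerOf_le (n := 22) (testBit_nbrs (testBit_iterate_spread hlp hf1 hqp) hqz)
  have hmv : moves (f1 ++ p :: f0) = moves (f1 ++ [p]) + moves (p :: f0) := moves_append _ _ _
  have hsub : ∀ i ∈ f1 ++ p :: f0, u.block.mask.testBit i = true := by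
    intro i hi
    have hi' := (hVf i).2 hi
    rcases hu' with ⟨-, h⟩ | ⟨-, -, h⟩
    · exact (check_block h.2 h.1).2.1 i ((testBit_insertBit _ _ _).2 (Or.inl hi'))
    · exact (check_block h.2 h.1).2.1 i hi'
  have hfull : ∀ (B : Block) i, B.mask.testBit i = true → (B.full x).testBit i = true := by
    intro B i hi
    by_cases hx : x = 0
    · subst hx; exact testBit_full_zero.2 (Or.inl hi)
    · rwa [Block.full_of_ne hx]
  refine ⟨u, hu, ?_, ?_⟩
  · intro i hi
    by_cases hif : i ∈ f1 ++ p :: f0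
    · exact ⟨fun _ => hfull _ _ (hsub i hif), fun _ => hfull _ _ (hmem i hif)⟩
    · obtain ⟨v, hv, hvi⟩ := hi.resolve_left hif
      have hiN := testBit_nbrs ((hVf v).2 hv) hvi
      have hiV : ¬ V.testBit i = true := by rwa [hVf]
      have h1 := testBit_known (B := t.block) (V := V) (x := x) (i := i)
      have h2 := testBit_known (B := u.block) (V := V) (x := x) (i := i)
      rw [hF] at h1
      rw [h1] at h2
      simpa [hiN, hiV] using h2
  · rcases hu' with ⟨hzu, hEu⟩ | ⟨hx, hzu, hEu⟩
    · left
      refine ⟨hzu, insertBit V z, z, _, [], f1 ++ p :: f0, rfl, hEu, ?_, ?_, by simp,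
        Or.inr (by simp)⟩
      · intro i
        rw [testBit_insertBit, hVf, List.mem_cons, or_comm]
      · obtain ⟨f', hf'⟩ : ∃ f', f1 ++ p :: f0 = q :: f' := by
          cases hh : f1 ++ p :: f0 with
          | nil => simp at hh
          | cons a b => rw [hh] at hq; exact ⟨b, by simpa using hq⟩
        rw [hf', moves_cons_ne (by rintro rfl; rw [hzV] at hqV; cases hqV), ← hf']
        omega
    · right
      have hBu := Block.good_of_valid (check_block hEu.2 hEu.1).1
      -- The cell `z` lies one column to the right of the block, and `col_le` leaves room for it
      -- without wrapping into the next row. So its only neighbour in the block is the neck cell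
      -- `a`, where the agent must be standing.
      have hqa : q = u.block.a := by
        have h1 := hBu.box q (hsub q (List.mem_of_mem_head? hq))
        have h2 := hBu.col_le
        unfold AdjN at hqz
        omega
      subst hqa
      refine ⟨hx, hzu, V, u.block.a, _, [], (f1 ++ p :: f0).tail, ?_, hEu, ?_, ?_, by simp,
        Or.inr (by simp)⟩
      · rw [List.nil_append, List.cons_head?_tail hq]
      · intro i; rw [List.cons_head?_tail hq]; exact hVf i
      · rw [List.cons_head?_tail hq]; omega

theorem block_eq_mkBlock (h : t.block.valid = true) : ∃ q a b, t.block = mkBlock q a b := by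
  induction t with
  | leaf q a b => exact ⟨q, a, b, rfl⟩
  | br c t r iht _ => exact iht h
  | nil => exact absurd h (by decide)

end Tree

theorem decodePath_head (n p c : ℕ) : ∃ l, decodePath n p c = c :: l := by
  cases n with
  | zero => exact ⟨_, rfl⟩
  | succ n =>
    unfold decodePath
    cases p.ble 1
    · exact ⟨_, rfl⟩
    · exact ⟨_, rfl⟩

theorem Tree.mem_path {t : Tree} (h : t.block.valid = true) {i : ℕ} :
    t.block.mask.testBit i = true ↔ i ∈ t.block.path := by
  obtain ⟨q, a, b, h⟩ := Tree.block_eq_mkBlock h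
  rw [h]
  exact testBit_maskOf

theorem Tree.mem_entry {t : Tree} (h : t.block.valid = true) :
    Mem t.block.mask entryA ∧ Mem t.block.mask entryB := by
  have hA : (36 : ℕ) ∈ t.block.path := by
    obtain ⟨q, a, b, h⟩ := Tree.block_eq_mkBlock h
    obtain ⟨l, hl⟩ := decodePath_head 22 q 36
    rw [h, mkBlock, hl]
    simp
  have hB : (45 : ℕ) ∈ t.block.path := by
    have h1 := (Block.good_of_valid h).getLast
    rw [List.getLastD_eq_getLast?] at h1
    cases h2 : t.block.path.getLast? with
    | none => simp [h2] at h1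
    | some a =>
      obtain rfl : a = 45 := by simpa [h2] using h1
      exact List.mem_of_getLast? h2
  exact ⟨⟨by simp [InBox, entryA], (Tree.mem_path h).2 hA⟩,
    ⟨by simp [InBox, entryB], (Tree.mem_path h).2 hB⟩⟩

/-! ### The invariant of the play and the reply to one step. -/

namespace Chain

/-- The list of visited cells (latest first) is compatible with the chain. -/
def Inv : Chain → List Cell → Prop
  | nil m => fun l =>
    l = [] ∨ (m = 0 ∧ l.getLast? = some entryA ∧ ∀ c ∈ l, c = entryA ∨ c = entryB)
  | cons t sw tail => fun l => l.getLast? = some entryA ∧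
    tail.Inv ((t.block.frame sw).hi l) ∧
    ∃ x y, t.State x y (((t.block.frame sw).lo l).map code) ∧
      (t.isLeaf = true ∨
        (x = 0 ∧ sw = false ∧ (∃ m, tail = nil m) ∧ (t.block.frame sw).hi l = []) ∨
        (x ≠ 0 ∧ sw = false ∧ (t.block.frame sw).hi l ≠ []))

theorem Inv.getLast {c : Chain} {l : List Cell} (h : c.Inv l) {e : Cell}
    (he : l.getLast? = some e) : e = entryA := by
  cases c with
  | nil m =>
    rcases h with h | h
    · simp [h] at he
    · rw [h.2.1] at he; simpa [eq_comm] using he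
  | cons t sw tail => rw [h.1] at he; simpa [eq_comm] using he

theorem Inv.eq_nil {c : Chain} (h : c.Inv []) : ∃ m, c = nil m := by
  cases c with
  | nil m => exact ⟨m, rfl⟩
  | cons t sw tail => have := h.1; simp at this

theorem proper_nil (m : ℕ) : Proper (nil m).In where
  memA := Or.inl rfl
  memB := Or.inr rfl
  nonneg c hc := by rcases hc with rfl | rfl <;> simp [entryA, entryB]
  rows c hc _ := by rcases hc with rfl | rfl <;> simp [entryA, entryB]

theorem proper_cons {t : Tree} (ht : t.block.valid = true) (sw : Bool) (tail : Chain) :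
    Proper (cons t sw tail).In :=
  ((Block.good_of_valid ht).glue sw).proper_glue (Tree.mem_entry ht).1 (Tree.mem_entry ht).2

theorem Inv.proper {c : Chain} {l : List Cell} (h : c.Inv l) : Proper c.In := by
  cases c with
  | nil m => exact proper_nil m
  | cons t sw tail =>
    obtain ⟨-, -, x, y, hS, -⟩ := h
    exact proper_cons hS.valid.1 sw tail

/-- Behind a neck that has not been passed lie only the two cells to its right, whichever is called
`entryA`. So the orientation `sw` can be left open until the agent enters. -/
theorem glue_nil {B : Block} (hB : B.Good) (sw : Bool) (m : ℕ) (c : Cell) :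
    glue (B.frame sw) (Mem B.mask) (nil m).In c ↔ Mem (B.full 0) c := by
  have hcol := hB.col_le
  have ha := hB.box _ hB.mem_a
  have hb := hB.box _ hB.mem_b
  have hn := hB.neck
  have hab : B.b % 9 = B.a % 9 := by omega
  have key : ∀ i, (i = B.a ∨ i = B.b) → (c = (((B.a % 9 : ℕ) : ℤ) + 1, ((i / 9 : ℕ) : ℤ)) ↔
      InBox c ∧ code c = i + 1) := by
    intro i hi
    constructor
    · rintro rfl
      simp only [InBox, code]
      omega
    · rintro ⟨h1, h2⟩
      have := h1.code_mod
      ext <;> simp <;> omega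
  have hout : (B.frame sw).toLocal c = entryA ∨ (B.frame sw).toLocal c = entryB ↔
      c = (((B.a % 9 : ℕ) : ℤ) + 1, ((B.a / 9 : ℕ) : ℤ)) ∨ c = (((B.a % 9 : ℕ) : ℤ) + 1, ((B.b / 9 : ℕ) : ℤ)) := by
    rw [entryA_eq, entryB_eq, hB.snd_frame]
    cases sw
    · rfl
    · rw [or_comm]; rfl
  rcases le_or_gt c.1 (B.frame sw).w with h | h
  · rw [glue_of_le h]
    refine ⟨fun h => ⟨h.1, testBit_full_zero.2 (Or.inl h.2)⟩, fun ⟨h1, h2⟩ => ⟨h1, ?_⟩⟩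
    have h3 := h1.code_mod
    have h' : c.1 ≤ (B.a % 9 : ℕ) := h
    rcases testBit_full_zero.1 h2 with h2 | h2 | h2
    · exact h2
    · omega
    · omega
  · rw [glue_of_lt h]
    change _ ∨ _ ↔ _
    rw [hout, key _ (Or.inl rfl), key _ (Or.inr rfl), ← and_or_left]
    refine and_congr_right fun h1 => ?_
    rw [testBit_full_zero]
    have h' : ((B.a % 9 : ℕ) : ℤ) < c.1 := h
    refine ⟨Or.inr, fun h2 => h2.resolve_left fun h3 => ?_⟩
    have := hB.le ⟨h1, h3⟩
    omega

theorem Near.full_iff {f : List Cell} {B B' : Block} {x : ℕ}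
    (h : ∀ i, (i ∈ f.map code ∨ ∃ v ∈ f.map code, AdjN v i) →
      ((B.full x).testBit i = true ↔ (B'.full x).testBit i = true))
    {v u : Cell} (hv : v ∈ f) (hvb : InBox v) (hu : Near v u) :
    Mem (B.full x) u ↔ Mem (B'.full x) u := by
  refine and_congr_right fun hub => h _ ?_
  rcases hu with rfl | hu
  · exact Or.inl (List.mem_map_of_mem hv)
  · exact Or.inr ⟨code v, List.mem_map_of_mem hv, hvb.adjN hub hu⟩

theorem root_entry : rootTree.Entry (1 <<< 36) 36 0 0 0 := ⟨rfl, rootTree_check⟩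

/-- Opening the next block. -/
theorem step_nil (m : ℕ) : ∃ c : Chain, c.Inv [entryA] ∧ c.In entryA ∧
    c.depth = m ∧ (c = nil m ∨ c.weight < (nil m).weight) := by
  cases m with
  | zero => exact ⟨nil 0, by simp [Inv], by simp [In], rfl, Or.inl rfl⟩
  | succ m =>
    have hS : rootTree.State 0 0 [36] := by
      refine ⟨1 <<< 36, 36, 0, [], [], rfl, root_entry, ?_, by simp, by simp, Or.inr (by simp)⟩
      intro i
      rw [testBit_one_shiftLeft, List.mem_singleton]
    have hle : entryA.1 ≤ (rootTree.block.frame false).w := by simp [entryA, Block.frame]; omega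
    refine ⟨cons rootTree false (nil m), ⟨rfl, ?_, 0, 0, ?_, Or.inr (Or.inl ?_)⟩, ?_, rfl, Or.inr ?_⟩
    · rw [Frame.hi_cons_of_le hle]; exact Or.inl rfl
    · rw [Frame.lo_cons_of_le hle]; exact hS
    · refine ⟨rfl, rfl, ⟨m, rfl⟩, ?_⟩
      rw [Frame.hi_cons_of_le hle]; rfl
    · exact (proper_cons hS.valid.1 _ _).memA
    · simp only [weight]; ring_nf; omega

theorem Frame.lo_eq_self {F : Frame} {l : List Cell} (h : ∀ c ∈ l, c.1 ≤ F.w) : F.lo l = l :=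
  List.filter_eq_self.2 (by simpa using h)

theorem Frame.hi_eq_nil {F : Frame} {l : List Cell} : F.hi l = [] ↔ ∀ c ∈ l, c.1 ≤ F.w := by
  simp [Frame.hi]

/-- The flag decides which neck cell counts as the first one, so toggling it exchanges the roles of
`entryA` and `entryB`. -/
theorem exists_swap {B : Block} (hB : B.Good) {sw : Bool} {z : Cell}
    (h : (B.frame sw).toLocal z = entryA ∨ (B.frame sw).toLocal z = entryB) :
    ∃ sw', (B.frame sw').toLocal z = entryA := by
  rcases h with h | h
  · exact ⟨sw, h⟩
  · refine ⟨!sw, ?_⟩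
    rw [entryB_eq, hB.snd_frame] at h
    rw [entryA_eq, h]
    cases sw <;> rfl

/-- The reaction of the adversary to a step of the agent. -/
theorem step (c : Chain) (l : List Cell) (z : Cell) (hI : c.Inv l) (hL : Lazy (z :: l))
    (hm : ∀ v ∈ z :: l, c.In v) (h0 : l = [] → z = entryA) :
    ∃ c' : Chain, c'.Inv (z :: l) ∧ (∀ v ∈ l, ∀ u, Near v u → (c.In u ↔ c'.In u)) ∧ c'.In z ∧
      c'.depth = c.depth ∧
      (c'.weight < c.weight ∨ (c'.weight = c.weight ∧ ∀ u, c.In u ↔ c'.In u)) := by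
  induction c generalizing l z with
  | nil m =>
    rcases hI with rfl | ⟨rfl, h1, h2⟩
    · obtain rfl := h0 rfl
      obtain ⟨c', h1, h2, h3, h4⟩ := step_nil m
      refine ⟨c', h1, by simp, h2, h3, ?_⟩
      rcases h4 with rfl | h4
      · exact Or.inr ⟨rfl, fun _ => Iff.rfl⟩
      · exact Or.inl h4
    · refine ⟨nil 0, Or.inr ⟨rfl, ?_, ?_⟩, fun _ _ _ _ => Iff.rfl, hm z (by simp), rfl,
        Or.inr ⟨rfl, fun _ => Iff.rfl⟩⟩
      · cases l with
        | nil => simp at h1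
        | cons a l => rwa [List.getLast?_cons_cons]
      · intro c hc
        exact hm c hc
  | cons t sw tail ih =>
    have hI' := hI
    obtain ⟨hlast, hT, x, y, hS, hcase⟩ := hI
    have hB := hS.good
    have hG := hB.glue sw
    have hP := hT.proper
    have hne : l ≠ [] := by rintro rfl; simp at hlast
    have hlast' : (z :: l).getLast? = some entryA := by
      cases l with
      | nil => exact absurd rfl hne
      | cons a l => rwa [List.getLast?_cons_cons]
    have hle0 : ∀ (B : Block) sw, entryA.1 ≤ (B.frame sw).w := by
      intro B sw; simp [entryA, Block.frame]; omega
    have hgl : ∀ v ∈ z :: l, glue (t.block.frame sw) (Mem t.block.mask) tail.In v := hm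
    have hloMem : ∀ v ∈ (t.block.frame sw).lo l, Mem t.block.mask v := by
      intro v hv
      rw [Frame.mem_lo] at hv
      exact (glue_of_le hv.2).1 (hgl v (List.mem_cons_of_mem _ hv.1))
    have hsplit := fun hh => hG.split hP (z :: l) hL (by simp) hgl
      (fun c hc => by rw [hlast'] at hc; obtain rfl : entryA = c := by simpa using hc
                      exact hle0 _ _) hh
    have hlo_ne : (t.block.frame sw).lo l ≠ [] := by
      have : entryA ∈ (t.block.frame sw).lo l :=
        Frame.mem_lo.2 ⟨List.mem_of_getLast? hlast, hle0 _ _⟩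
      exact List.ne_nil_of_mem this
    -- behind the neck, when the exit has been used
    have hbehind : (t.isLeaf = true ∨ (x ≠ 0 ∧ sw = false)) →
        (t.block.frame sw).w < z.1 → (t.block.frame sw).hi l ≠ [] →
        ∃ c' : Chain, c'.Inv (z :: l) ∧
          (∀ v ∈ l, ∀ u, Near v u → ((cons t sw tail).In u ↔ c'.In u)) ∧ c'.In z ∧
          c'.depth = (cons t sw tail).depth ∧ (c'.weight < (cons t sw tail).weight ∨
            (c'.weight = (cons t sw tail).weight ∧ ∀ u, (cons t sw tail).In u ↔ c'.In u)) := by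
      intro hc hz hhi
      have hhiz := Frame.hi_cons_of_lt (l := l) hz
      obtain ⟨-, h2, -⟩ := hsplit (by
        intro c hc
        rw [hhiz] at hc
        cases hh : (t.block.frame sw).hi l with
        | nil => exact absurd hh hhi
        | cons a b =>
          rw [hh, List.getLast?_cons_cons, ← hh] at hc
          exact hT.getLast hc)
      rw [hhiz] at h2
      obtain ⟨tail', h3, h4, h5, h6, h7⟩ := ih _ _ hT h2 (by
        intro v hv
        rcases List.mem_cons.1 hv with rfl | hv
        · exact (glue_of_lt hz).1 (hgl z (by simp))
        · rw [Frame.mem_hi] at hv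
          have := (glue_of_lt hv.2).1 (hgl _ (List.mem_cons_of_mem _ hv.1))
          rwa [Frame.toLocal_toGlobal] at this) (fun h => absurd h hhi)
      refine ⟨cons t sw tail', ⟨hlast', by rwa [hhiz], x, y, ?_, ?_⟩, ?_, ?_, ?_, ?_⟩
      · rwa [Frame.lo_cons_of_lt hz]
      · rcases hc with hc | hc
        · exact Or.inl hc
        · exact Or.inr (Or.inr ⟨hc.1, hc.2, by rw [hhiz]; simp⟩)
      · intro v hv u hu
        refine hG.near_congr_tail hP h3.proper (hgl v (List.mem_cons_of_mem _ hv)) hu ?_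
        intro hvw
        exact h4 _ (Frame.toLocal_mem_hi.2 ⟨hv, hvw⟩) _ (hu.toLocal _)
      · exact (glue_of_lt hz).2 h5
      · simp [depth, h6]
      · rcases h7 with h7 | ⟨h7, h8⟩
        · left; simp only [weight]; omega
        · right
          refine ⟨by simp [weight, h7], fun u => ?_⟩
          rcases le_or_gt u.1 (t.block.frame sw).w with hu | hu
          · exact (glue_of_le hu).trans (glue_of_le hu).symm
          · exact (glue_of_lt hu).trans ((h8 _).trans (glue_of_lt hu).symm)
    have hstay : (t.block.frame sw).w ≥ z.1 → t.State x y (code z :: ((t.block.frame sw).lo l).map code)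
        → ∃ c' : Chain, c'.Inv (z :: l) ∧
          (∀ v ∈ l, ∀ u, Near v u → ((cons t sw tail).In u ↔ c'.In u)) ∧ c'.In z ∧
          c'.depth = (cons t sw tail).depth ∧ (c'.weight < (cons t sw tail).weight ∨
            (c'.weight = (cons t sw tail).weight ∧ ∀ u, (cons t sw tail).In u ↔ c'.In u)) := by
      intro hz hS'
      refine ⟨cons t sw tail, ⟨hlast', ?_, x, y, ?_, ?_⟩, fun _ _ _ _ => Iff.rfl, hm z (by simp),
        rfl, Or.inr ⟨rfl, fun _ => Iff.rfl⟩⟩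
      · rwa [Frame.hi_cons_of_le hz]
      · rwa [Frame.lo_cons_of_le hz]
      · rwa [Frame.hi_cons_of_le hz]
    by_cases hleaf : t.isLeaf = true
    · rcases le_or_gt z.1 (t.block.frame sw).w with hz | hz
      · exact hstay hz (hS.cons_leaf hleaf ((glue_of_le hz).1 (hgl z (by simp))).2)
      · by_cases hhi : (t.block.frame sw).hi l = []
        · rw [hhi] at hT
          obtain ⟨m, rfl⟩ := hT.eq_nil
          -- A leaf does not prescribe which neck cell is used first. The orientation is chosen now,
          -- when the agent enters; by `glue_nil` this leaves the polygon unchanged.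
          obtain ⟨sw', hsw⟩ := exists_swap hB ((glue_of_lt hz).1 (hgl z (by simp)))
          obtain ⟨tail', h1, h2, h3, h4⟩ := step_nil m
          have hz' : (t.block.frame sw').w < z.1 := hz
          have hlw : ∀ v ∈ l, v.1 ≤ (t.block.frame sw').w :=
            (Frame.hi_eq_nil (F := t.block.frame sw)).1 hhi
          have hlo : (t.block.frame sw').lo l = (t.block.frame sw).lo l := rfl
          have hhi' : (t.block.frame sw').hi l = [] := Frame.hi_eq_nil.2 hlw
          have hswap : ∀ u, (cons t sw (nil m)).In u ↔ (cons t sw' (nil m)).In u := fun u =>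
            (glue_nil hB sw m u).trans (glue_nil hB sw' m u).symm
          refine ⟨cons t sw' tail', ⟨hlast', ?_, x, y, ?_, Or.inl hleaf⟩, ?_, ?_, ?_, ?_⟩
          · rw [Frame.hi_cons_of_lt hz', hhi', hsw]; exact h1
          · rw [Frame.lo_cons_of_lt hz', hlo]; exact hS
          · intro v hv u hu
            rw [hswap u]
            exact (hB.glue sw').near_congr_tail hP h1.proper
              ((hswap v).1 (hgl v (List.mem_cons_of_mem _ hv))) hu
              (fun h => absurd (hlw v hv) (not_le.2 h))
          · exact (glue_of_lt hz').2 (by rw [hsw]; exact h2)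
          · simp [depth, h3]
          · rcases h4 with rfl | h4
            · exact Or.inr ⟨rfl, hswap⟩
            · left; simp only [weight] at h4 ⊢; omega
        · exact hbehind (Or.inl hleaf) hz hhi
    have hleaf' : t.isLeaf = false := by simpa using hleaf
    have hloBox : ∀ v ∈ (t.block.frame sw).lo l, InBox v := fun v hv => (hloMem v hv).1
    -- At an inner node either everything visited lies in the last opened block, with its exit
    -- unused, or the exit has been declared. The tree names the neck cells so that `a` is the first
    -- one used, whence `sw = false`.
    rcases hcase with h | ⟨rfl, rfl, ⟨m, rfl⟩, hhi⟩ | ⟨hx, rfl, hhi⟩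
    · exact absurd h hleaf
    · -- no exit has been declared
      have hlw := Frame.hi_eq_nil.1 hhi
      have hlol := Frame.lo_eq_self hlw
      rw [hlol] at hS hloBox hlo_ne hloMem
      have hzfull := (glue_nil hB false m z).1 (hgl z (by simp))
      by_cases hzl : z ∈ l
      · refine hstay (hlw z hzl) ?_
        rw [hlol]
        exact hS.cons_mem (List.mem_map_of_mem hzl)
      obtain ⟨q, l', rfl⟩ := List.exists_cons_of_ne_nil hne
      have hqz : edgeGraph.Adj q z := by
        rcases (lazy_cons.1 hL).1 q rfl with h | h
        · exact absurd (by simp [h]) hzl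
        · exact h.symm
      obtain ⟨u, hu, hcons, hu'⟩ := hS.cons_new hleaf'
        (lazyN_map_code hloBox (lazy_cons.1 hL).2) (q := code q) (z := code z) (by simp)
        ((hloBox q (by simp)).adjN hzfull.1 hqz) hzfull.2 (by
          intro h
          obtain ⟨v, hv, hvz⟩ := List.mem_map.1 h
          rw [(hloBox v hv).code_inj hzfull.1] at hvz
          exact hzl (hvz ▸ hv))
      have hBu : u.block.Good := by
        rcases hu' with h | h
        · exact h.2.good
        · exact h.2.2.good
      have hview : ∀ v ∈ q :: l', ∀ w, Near v w →
          ((cons t false (nil m)).In w ↔ (cons u false (nil m)).In w) := by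
        intro v hv w hw
        exact (glue_nil hB false m w).trans ((Near.full_iff hcons hv (hloBox v hv) hw).trans
          (glue_nil hBu false m w).symm)
      have hmu : ∀ v ∈ q :: l', Mem u.block.mask v := by
        intro v hv
        refine ⟨hloBox v hv, ?_⟩
        rcases hu' with h | h
        · exact h.2.valid.2.1 _ (List.mem_cons_of_mem _ (List.mem_map_of_mem hv))
        · exact h.2.2.valid.2.1 _ (List.mem_map_of_mem hv)
      have hlwu : ∀ v ∈ q :: l', v.1 ≤ (u.block.frame false).w := fun v hv => (hBu.le (hmu v hv)).2.1
      rcases hu' with ⟨hzu, hSu⟩ | ⟨-, hzu, hSu⟩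
      · have hzu' : Mem u.block.mask z := ⟨hzfull.1, hzu⟩
        have hlwz : ∀ v ∈ z :: q :: l', v.1 ≤ (u.block.frame false).w := by
          intro v hv
          rcases List.mem_cons.1 hv with rfl | hv
          · exact (hBu.le hzu').2.1
          · exact hlwu v hv
        have hhiu := Frame.hi_eq_nil.2 hlwz
        refine ⟨cons u false (nil m), ⟨hlast', by rw [hhiu]; exact Or.inl rfl, 0, y, ?_,
          Or.inr (Or.inl ⟨rfl, rfl, ⟨m, rfl⟩, hhiu⟩)⟩, hview, ?_, rfl, Or.inl ?_⟩
        · rw [Frame.lo_eq_self hlwz]; exact hSu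
        · exact (glue_of_le (hlwz z (by simp))).2 hzu'
        · simp only [weight]; omega
      -- The tree declares `z` to be behind the neck: `z` becomes the first cell of the next block,
      -- which is opened at once if one is left.
      · obtain ⟨tail', h1, h2, h3, h4⟩ := step_nil m
        have hmod := hzfull.1.code_mod
        have hcol := hBu.col_le
        have hzA : (u.block.frame false).toLocal z = entryA := by
          rw [entryA_eq]
          ext
          · simp [Block.frame]; omega
          · simp [Block.frame]; omega
        have hzw : (u.block.frame false).w < z.1 := by simp [Block.frame]; omega
        have hhiu := Frame.hi_eq_nil.2 hlwu
        have ha0 : u.block.a ≠ 0 := by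
          have := hBu.box _ hBu.mem_a
          intro h
          rw [h] at this
          simp at this
        refine ⟨cons u false tail', ⟨hlast', ?_, u.block.a, u.block.b, ?_,
          Or.inr (Or.inr ⟨ha0, rfl, ?_⟩)⟩, ?_, ?_, ?_, Or.inl ?_⟩
        · rw [Frame.hi_cons_of_lt hzw, hhiu, hzA]; exact h1
        · rw [Frame.lo_cons_of_lt hzw, Frame.lo_eq_self hlwu]; exact hSu
        · rw [Frame.hi_cons_of_lt hzw]; simp
        · intro v hv w hw
          rw [hview v hv w hw]
          exact (hBu.glue false).near_congr_tail hP h1.proper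
            ((glue_of_le (hlwu v hv)).2 (hmu v hv)) hw
            (fun h => absurd (hlwu v hv) (not_le.2 h))
        · exact (glue_of_lt hzw).2 (by rw [hzA]; exact h2)
        · simp [depth, h3]
        · rcases h4 with rfl | h4
          · simp only [weight]; omega
          · simp only [weight] at h4 ⊢; omega
    · -- the exit has been declared
      rcases le_or_gt z.1 (t.block.frame false).w with hz | hz
      swap
      · exact hbehind (Or.inr ⟨hx, rfl⟩) hz hhi
      have hzm := (glue_of_le hz).1 (hgl z (by simp))
      by_cases hzl : z ∈ (t.block.frame false).lo l
      · exact hstay hz (hS.cons_mem (List.mem_map_of_mem hzl))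
      obtain ⟨q, f, hqf⟩ := List.exists_cons_of_ne_nil hlo_ne
      obtain ⟨hLlo, -, -⟩ := hsplit (by
        intro c hc
        rw [Frame.hi_cons_of_le hz] at hc
        exact hT.getLast hc)
      rw [Frame.lo_cons_of_le hz] at hLlo
      have hqz : edgeGraph.Adj q z := by
        rcases (lazy_cons.1 hLlo).1 q (by rw [hqf]; rfl) with h | h
        · exact absurd (by rw [hqf, h]; simp) hzl
        · exact h.symm
      have hqm : q ∈ (t.block.frame false).lo l := by rw [hqf]; simp
      obtain ⟨u, hu, hcons, hu'⟩ := hS.cons_new hleaf'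
        (lazyN_map_code hloBox (lazy_cons.1 hLlo).2) (q := code q) (z := code z)
        (by rw [hqf]; rfl) ((hloBox q hqm).adjN hzm.1 hqz)
        (by rw [Block.full_of_ne hx]; exact hzm.2) (by
          intro h
          obtain ⟨v, hv, hvz⟩ := List.mem_map.1 h
          rw [(hloBox v hv).code_inj hzm.1] at hvz
          exact hzl (hvz ▸ hv))
      obtain ⟨hzu, hSu⟩ : u.block.mask.testBit (code z) = true ∧
          u.State x y (code z :: ((t.block.frame false).lo l).map code) := by
        rcases hu' with h | h
        · exact h
        · exact absurd h.1 hx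
      have hBu := hSu.good
      -- After the declaration all further provisional blocks have the same neck, so the tail keeps
      -- its place.
      have hfr : u.block.frame false = t.block.frame false := by
        have h1 := hSu.valid.2.2.resolve_left hx
        have h2 := hS.valid.2.2.resolve_left hx
        have h3 : u.block.a = t.block.a := h1.1.symm.trans h2.1
        have h4 : u.block.b = t.block.b := h1.2.symm.trans h2.2
        simp [Block.frame, h3, h4]
      have hGu : Glue (t.block.frame false) (Mem u.block.mask) := hfr ▸ hBu.glue false
      have hIn : ∀ w, (cons u false tail).In w ↔
          glue (t.block.frame false) (Mem u.block.mask) tail.In w := by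
        intro w
        change glue _ _ _ _ ↔ _
        rw [hfr]
      refine ⟨cons u false tail, ⟨hlast', ?_, x, y, ?_, Or.inr (Or.inr ⟨hx, rfl, ?_⟩)⟩, ?_, ?_, rfl,
        Or.inl ?_⟩
      · rwa [hfr, Frame.hi_cons_of_le hz]
      · rwa [hfr, Frame.lo_cons_of_le hz]
      · rwa [hfr, Frame.hi_cons_of_le hz]
      · intro v hv w hw
        rw [hIn w]
        have hgv := hgl v (List.mem_cons_of_mem _ hv)
        rcases le_or_gt v.1 (t.block.frame false).w with hvw | hvw
        · have hvlo := Frame.mem_lo.2 ⟨hv, hvw⟩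
          have := Near.full_iff hcons hvlo (hloBox v hvlo) hw
          rw [Block.full_of_ne hx, Block.full_of_ne hx] at this
          rcases le_or_gt w.1 (t.block.frame false).w with hww | hww
          · exact (glue_of_le hww).trans (this.trans (glue_of_le hww).symm)
          · exact (glue_of_lt hww).trans (glue_of_lt hww).symm
        · exact hG.near_congr_head hGu hP hvw ((glue_of_lt hvw).1 hgv) hw
      · rw [hIn z]
        exact (glue_of_le hz).2 ⟨hzm.1, hzu⟩
      · simp only [weight]; omega

end Chain
-- Chains have no holes.
/-- Connection through edges and corners inside a set of cells. -/
def Conn (Q : Cell → Prop) : Cell → Cell → Prop :=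
  Relation.ReflTransGen fun x y => touchGraph.Adj x y ∧ Q x ∧ Q y

namespace Conn
variable {Q : Cell → Prop}

theorem symm {u v : Cell} (h : Conn Q u v) : Conn Q v u :=
  by
  induction h with
  | refl => exact Relation.ReflTransGen.refl
  | tail _ hbc ih => exact Relation.ReflTransGen.head ⟨hbc.1.symm, hbc.2.2, hbc.2.1⟩ ih

theorem trans {u v w : Cell} (h : Conn Q u v) (h' : Conn Q v w) : Conn Q u w :=
  Relation.ReflTransGen.trans h h'

theorem single {u v : Cell} (h : touchGraph.Adj u v) (hu : Q u) (hv : Q v) : Conn Q u v :=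
  Relation.ReflTransGen.single ⟨h, hu, hv⟩

theorem vertical_add (x y : ℤ) (n : ℕ) (h : ∀ t, y ≤ t → t ≤ y + n → Q (x, t)) :
    Conn Q (x, y) (x, y + n) := by
  induction n with
  | zero =>
    rw [Nat.cast_zero, add_zero]
    exact Relation.ReflTransGen.refl
  | succ n ih =>
    refine trans (ih fun t h1 h2 => h t h1 (by push_cast; omega)) (single ?_ (h _ ?_ ?_) (h _ ?_ ?_))
    · simp only [touch_iff, ne_eq, Prod.mk.injEq]
      push_cast
      omega
    all_goals push_cast; omega

theorem vertical {x y z : ℤ} (h : ∀ t, min y z ≤ t → t ≤ max y z → Q (x, t)) :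
    Conn Q (x, y) (x, z) := by
  rcases le_total y z with hyz | hyz
  · obtain ⟨n, rfl⟩ := Int.le.dest hyz
    exact vertical_add x y n fun t h1 h2 => h t (by omega) (by omega)
  · obtain ⟨n, rfl⟩ := Int.le.dest hyz
    exact (vertical_add x z n fun t h1 h2 => h t (by omega) (by omega)).symm

theorem horizontal_add (x y : ℤ) (n : ℕ) (h : ∀ t, x ≤ t → t ≤ x + n → Q (t, y)) :
    Conn Q (x, y) (x + n, y) := by
  induction n with
  | zero =>
    rw [Nat.cast_zero, add_zero]
    exact Relation.ReflTransGen.refl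
  | succ n ih =>
    refine trans (ih fun t h1 h2 => h t h1 (by push_cast; omega)) (single ?_ (h _ ?_ ?_) (h _ ?_ ?_))
    · simp only [touch_iff, ne_eq, Prod.mk.injEq]
      push_cast
      omega
    all_goals push_cast; omega

theorem horizontal {x y z : ℤ} (h : ∀ t, min x z ≤ t → t ≤ max x z → Q (t, y)) :
    Conn Q (x, y) (z, y) := by
  rcases le_total x z with hyz | hyz
  · obtain ⟨n, rfl⟩ := Int.le.dest hyz
    exact horizontal_add x y n fun t h1 h2 => h t (by omega) (by omega)
  · obtain ⟨n, rfl⟩ := Int.le.dest hyz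
    exact (horizontal_add z y n fun t h1 h2 => h t (by omega) (by omega)).symm

end Conn

/-- Two codes whose cells are equal or touch. -/
def TouchN (i j : ℕ) : Prop :=
  (j = i ∨ j = i + 1 ∨ i = j + 1) ∨ (j = i + 9 ∨ j = i + 10 ∨ i + 9 = j + 1) ∨
    (i = j + 9 ∨ j + 9 = i + 1 ∨ i = j + 10)

/-- A round adds only cells of `m` that touch cells already found, so `G` spreads along with `f`. If
the fuel runs out the test still demands `f = m`. -/
theorem flood_sound {G : ℕ → Prop} {m n f : ℕ} (h : flood m n f = true)
    (hf : ∀ i, f.testBit i = true → G i)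
    (hG : ∀ i j, G i → TouchN i j → m.testBit j = true → m.testBit i = true → G j)
    (hfm : ∀ i, f.testBit i = true → m.testBit i = true) {i : ℕ}
    (hi : m.testBit i = true) : G i := by
  induction n generalizing f with
  | zero =>
    simp only [flood, Nat.beq_eq] at h
    subst h; exact hf i hi
  | succ n ih =>
    by_cases hfe : f = m
    · subst hfe; exact hf i hi
    have hfe' : f.beq m = false := by rw [Bool.eq_false_iff]; simpa using hfe
    simp only [flood, hfe', cond_false] at h
    have key : ∀ j, ((f ||| f <<< 1 ||| f >>> 1 ||| (f ||| f <<< 1 ||| f >>> 1) <<< 9 |||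
        (f ||| f <<< 1 ||| f >>> 1) >>> 9) &&& m).testBit j = true →
        m.testBit j = true ∧ ∃ i, f.testBit i = true ∧ TouchN i j := by
      intro j hj
      simp only [Nat.testBit_and, Nat.testBit_or, Nat.testBit_shiftLeft, Nat.testBit_shiftRight,
        Bool.and_eq_true, Bool.or_eq_true, decide_eq_true_eq] at hj
      refine ⟨hj.2, ?_⟩
      unfold TouchN
      rcases hj.1 with (((hj | hj) | hj) | hj) | hj
      · exact ⟨j, hj, by omega⟩
      · exact ⟨j - 1, hj.2, by omega⟩
      · exact ⟨1 + j, hj, by omega⟩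
      · rcases hj.2 with (h | h) | h
        · exact ⟨_, h, by omega⟩
        · exact ⟨_, h.2, by omega⟩
        · exact ⟨_, h, by omega⟩
      · rcases hj with (h | h) | h
        · exact ⟨_, h, by omega⟩
        · exact ⟨_, h.2, by omega⟩
        · exact ⟨_, h, by omega⟩
    refine ih h ?_ fun i hi => (key i hi).1
    intro j hj
    obtain ⟨h1, i, h2, h3⟩ := key j hj
    exact hG i j (hf i h2) h3 h1 (hfm i h2)

theorem testBit_outerRows {i : ℕ} (hi : i < 72) (h : outerRows.testBit i = true) :
    i / 9 = 0 ∨ i / 9 = 7 := by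
  revert h
  have : ∀ i < 72, outerRows.testBit i = true → i / 9 = 0 ∨ i / 9 = 7 := by decide
  exact this i hi

theorem testBit_columnMask {A i : ℕ} (hi : i < 72) (h : (columnMask <<< A).testBit i = true) :
    (i - A) % 9 = 0 ∧ A ≤ i := by
  rw [Nat.testBit_shiftLeft, Bool.and_eq_true, decide_eq_true_eq] at h
  have : ∀ i < 72, columnMask.testBit i = true → i % 9 = 0 := by decide
  exact ⟨this _ (by omega) h.2, h.1⟩

namespace Chain

def Valid : Chain → Prop
  | nil _ => True
  | cons t _ tail => t.block.valid = true ∧ tail.Valid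

theorem Inv.toValid {c : Chain} {l : List Cell} (h : c.Inv l) : c.Valid := by
  induction c generalizing l with
  | nil m => trivial
  | cons t sw tail ih =>
    obtain ⟨-, h1, x, y, hS, -⟩ := h
    exact ⟨hS.valid.1, ih h1⟩

theorem Valid.proper {c : Chain} (h : c.Valid) : Proper c.In := by
  cases c with
  | nil m => exact proper_nil m
  | cons t sw tail => exact proper_cons h.1 sw tail

/-- The boundary cells in the right half plane. -/
def Out (c : Chain) (u : Cell) : Prop := ¬ c.In u ∧ 0 ≤ u.1

/-- By the flood check a boundary cell beside the first block is connected to the bottom or top row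
of the box, or to the column of the neck. From there it escapes below, above, or diagonally past the
neck into the next column. Cells behind the neck are settled by induction in the coordinates of the
tail. The restriction to the right half plane is what lets the induction pass through `F.toGlobal`:
it keeps all connecting paths behind the neck. -/
theorem Valid.conn_out {c : Chain} (hc : c.Valid) {u : Cell} (hu : c.Out u) :
    Conn c.Out u (0, 30) := by
  induction c generalizing u with
  | nil m =>
    have hout : ∀ x y : ℤ, 0 ≤ x → (x ≠ 0 ∨ y ≤ 3 ∨ 6 ≤ y) → (nil m).Out (x, y) := by
      intro x y hx hxy
      refine ⟨?_, hx⟩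
      rintro (h | h) <;> simp only [entryA, entryB, Prod.mk.injEq] at h <;> omega
    have h30 : ∀ x y : ℤ, 1 ≤ x → Conn (nil m).Out (x, y) (0, 30) := fun x y hx =>
      (Conn.vertical (z := 30) fun t _ _ => hout _ _ (by omega) (by omega)).trans
        (Conn.horizontal fun t _ _ => hout _ _ (by omega) (by omega))
    obtain ⟨x, y⟩ := u
    have hx : 0 ≤ x := hu.2
    have hA : ¬ (x = 0 ∧ y = 4) := fun h => hu.1 (Or.inl (Prod.ext h.1 h.2))
    have hB : ¬ (x = 0 ∧ y = 5) := fun h => hu.1 (Or.inr (Prod.ext h.1 h.2))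
    by_cases h1 : 1 ≤ x
    · exact h30 x y h1
    · refine (Conn.single (v := (x + 1, y)) ?_ hu (hout _ _ (by omega) (by omega))).trans
        (h30 _ _ (by omega))
      simp only [touch_iff, ne_eq, Prod.mk.injEq]
      omega
  | cons t sw tail ih =>
    have hB := Block.good_of_valid hc.1
    have hG := hB.glue sw
    have hP := hc.2.proper
    set F := t.block.frame sw with hF
    have hw : F.w = (t.block.a % 9 : ℕ) := rfl
    have hcol := hB.col_le
    -- cells behind the neck
    have hout_gt : ∀ v, F.w < v.1 → (¬ tail.In (F.toLocal v) ↔ (cons t sw tail).Out v) := by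
      intro v hv
      constructor
      · intro h
        exact ⟨fun h' => h ((glue_of_lt hv).1 h'), by omega⟩
      · intro h h'
        exact h.1 ((glue_of_lt hv).2 h')
    have hout_le : ∀ v, v.1 ≤ F.w → 0 ≤ v.1 → ¬ Mem t.block.mask v → (cons t sw tail).Out v :=
      fun v hv h0 h => ⟨fun h' => h ((glue_of_le hv).1 h'), h0⟩
    have hlift : ∀ a b, Conn tail.Out a b → Conn (cons t sw tail).Out (F.toGlobal a) (F.toGlobal b) := by
      intro a b hab
      refine Relation.ReflTransGen.lift F.toGlobal ?_ _ _ hab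
      rintro p q ⟨h1, h2, h3⟩
      have aux : ∀ p, tail.Out p → (cons t sw tail).Out (F.toGlobal p) := by
        intro p hp
        refine (hout_gt _ ?_).1 ?_
        · have := hp.2; simp; omega
        · rw [Frame.toLocal_toGlobal]; exact hp.1
      exact ⟨F.touch_toGlobal.2 h1, aux p h2, aux q h3⟩
    have hcol_out : ∀ y : ℤ, ((F.toLocal (F.w + 1, y)).2 < 3 ∨ 6 < (F.toLocal (F.w + 1, y)).2) →
        ¬ tail.In (F.toLocal (F.w + 1, y)) := by
      intro y hy h
      have := hP.rows _ h (by simp)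
      omega
    have hy8 : 0 ≤ F.y ∧ F.y ≤ 7 := by
      have h1 := hG.fst.1
      simp only [InBox, Frame.fst] at h1
      omega
    have hrow_far : ∀ y : ℤ, (y ≤ -5 ∨ 12 ≤ y) → ¬ tail.In (F.toLocal (F.w + 1, y)) := by
      intro y hy
      apply hcol_out
      simp only [Frame.toLocal]
      split <;> omega
    -- The frame may be a reflection, and then the cell `(0, 30)` of the tail lies far below.
    -- Comparing with `(F.w + 1, 30)`, which is also connected to it, avoids distinguishing the two
    -- cases.
    have hbehind : ∀ v, F.w < v.1 → (cons t sw tail).Out v →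
        Conn (cons t sw tail).Out v (F.w + 1, 30) := by
      intro v hv hvo
      have h1 := hlift _ _ (ih hc.2 (u := F.toLocal v)
        ⟨(hout_gt v hv).2 hvo, by simp; omega⟩)
      have h2 := hlift _ _ (ih hc.2 (u := F.toLocal (F.w + 1, 30))
        ⟨hrow_far 30 (by omega), by simp⟩)
      rw [Frame.toGlobal_toLocal] at h1 h2
      exact h1.trans h2.symm
    have hnotmem : ∀ x y : ℤ, (y < 0 ∨ 8 ≤ y) → ¬ Mem t.block.mask (x, y) := by
      intro x y hy h
      have := h.1
      simp only [InBox] at this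
      omega
    have hhigh : ∀ x y : ℤ, 0 ≤ x → x ≤ F.w → 8 ≤ y → Conn (cons t sw tail).Out (x, y) (0, 30) :=
      fun x y h0 h1 h2 =>
        (Conn.vertical (z := 30) fun s h3 h4 => hout_le _ h1 h0 (hnotmem _ _ (by omega))).trans
          (Conn.horizontal fun s h3 h4 => hout_le _ (by simp; omega) (by simp; omega)
            (hnotmem _ _ (by omega)))
    have hout30 : ∀ y : ℤ, (y ≤ -5 ∨ 12 ≤ y) → (cons t sw tail).Out (F.w + 1, y) := fun y hy =>
      (hout_gt _ (by simp)).1 (hrow_far y hy)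
    have hw0 := hG.w_nonneg
    have hlink : Conn (cons t sw tail).Out (F.w + 1, 30) (0, 30) := by
      refine (Conn.single (v := (F.w, 30)) ?_ (hout30 30 (by omega))
        (hout_le _ le_rfl hw0 (hnotmem _ _ (by omega)))).trans
        (hhigh _ _ hw0 le_rfl (by omega))
      simp only [touch_iff, ne_eq, Prod.mk.injEq]
      omega
    have hright : ∀ v, F.w < v.1 → (cons t sw tail).Out v →
        Conn (cons t sw tail).Out v (0, 30) := fun v hv hvo => (hbehind v hv hvo).trans hlink
    -- A way around the left side would leave the half plane. The detour instead runs along row -30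
    -- to the column behind the neck, where the boundary of the tail leads up.
    have hdeep : ∀ x y : ℤ, 0 ≤ x → x ≤ F.w → y < 0 → Conn (cons t sw tail).Out (x, y) (0, 30) := by
      intro x y h0 h1 h2
      refine (Conn.vertical (z := -30) fun s h3 h4 =>
        hout_le _ h1 h0 (hnotmem _ _ (by omega))).trans ?_
      refine (Conn.horizontal (z := F.w) fun s h3 h4 => hout_le _ (by simp; omega) (by simp; omega)
        (hnotmem _ _ (by omega))).trans ?_
      refine (Conn.single (v := (F.w + 1, -30)) ?_ (hout_le _ le_rfl hw0 (hnotmem _ _ (by omega)))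
        (hout30 (-30) (by omega))).trans (hright _ (by simp) (hout30 _ (by omega)))
      simp only [touch_iff, ne_eq, Prod.mk.injEq, and_true]
      change ¬ F.w = F.w + 1 ∧ F.w ≤ F.w + 1 + 1 ∧ F.w + 1 ≤ F.w + 1 ∧ _
      omega
    rcases lt_or_ge F.w u.1 with hu' | hu'
    · exact hright u hu' hu
    obtain ⟨x, y⟩ := u
    have hx0 : 0 ≤ x := hu.2
    have hxw : x ≤ F.w := hu'
    rcases lt_or_ge y 0 with hy | hy
    · exact hdeep x y hx0 hxw hy
    rcases le_or_gt 8 y with hy8' | hy8'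
    · exact hhigh x y hx0 hxw hy8'
    have hbox : InBox (x, y) := by simp only [InBox]; omega
    have hcomp : ∀ i, (boxTo (t.block.a % 9) ^^^ t.block.mask).testBit i = true →
        i < 72 ∧ i % 9 ≤ t.block.a % 9 ∧ ¬ t.block.mask.testBit i = true := by
      intro i hi
      rw [Nat.testBit_xor] at hi
      have h1 := testBit_boxTo (i := i) hcol
      have h2 := hB.box i
      by_cases hm : t.block.mask.testBit i = true
      · have h3 := h1.2 ⟨by have := h2 hm; omega, (h2 hm).1⟩
        rw [hm, h3] at hi
        cases hi
      · simp only [Bool.not_eq_true] at hm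
        rw [hm, Bool.xor_false] at hi
        exact ⟨(h1.1 hi).1, (h1.1 hi).2, by simp [hm]⟩
    have hcell : ∀ i, (boxTo (t.block.a % 9) ^^^ t.block.mask).testBit i = true →
        (cons t sw tail).Out (toCell i) := by
      intro i hi
      obtain ⟨-, h2, h3⟩ := hcomp i hi
      refine hout_le _ (by simp [toCell, hw]; omega) (by simp [toCell]; omega) fun h => h3 ?_
      have := h.2
      rwa [code_toCell] at this
    have hcode := hbox.code_mod
    have key : Conn (cons t sw tail).Out (toCell (code (x, y))) (0, 30) := by
      refine flood_sound (G := fun i => Conn (cons t sw tail).Out (toCell i) (0, 30)) hB.flood ?_ ?_ ?_ ?_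
      · intro i hi
        rw [Nat.testBit_and, Bool.and_eq_true, Nat.testBit_or, Bool.or_eq_true] at hi
        have hio := hcell i hi.1
        obtain ⟨h1, h2, h3⟩ := hcomp i hi.1
        have hq : toCell i = (((i % 9 : ℕ) : ℤ), ((i / 9 : ℕ) : ℤ)) := rfl
        rcases hi.2 with hi' | hi'
        · rcases testBit_outerRows h1 hi' with h4 | h4
          · refine (Conn.single (v := (((i % 9 : ℕ) : ℤ), -1)) ?_ hio ?_).trans
              (hdeep _ _ (by omega) (by omega) (by omega))
            · rw [touch_iff, hq, h4]
              simp only [ne_eq, Prod.mk.injEq]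
              omega
            · exact hout_le _ (by simp only; omega) (by simp only; omega)
                (hnotmem _ _ (by omega))
          · refine (Conn.single (v := (((i % 9 : ℕ) : ℤ), 8)) ?_ hio ?_).trans
              (hhigh _ _ (by omega) (by omega) (by omega))
            · rw [touch_iff, hq, h4]
              simp only [ne_eq, Prod.mk.injEq]
              omega
            · exact hout_le _ (by simp only; omega) (by simp only; omega)
                (hnotmem _ _ (by omega))
        · have h4 := testBit_columnMask h1 hi'
          have h5 : i % 9 = t.block.a % 9 := by omega
          have hq' : toCell i = (F.w, ((i / 9 : ℕ) : ℤ)) := by rw [hq, h5, hw]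
          have hnf : toCell i ≠ F.fst := by
            intro h; rw [h] at hio; exact hio.1 ((glue_of_le le_rfl).2 hG.fst)
          have hns : toCell i ≠ F.snd := by
            intro h; rw [h] at hio; exact hio.1 ((glue_of_le le_rfl).2 hG.snd)
          -- The row `r` is one further away from the neck than the cell itself. This already lies
          -- outside the local rows 3 to 6, so the diagonal neighbour in the next column is a
          -- boundary cell.
          have hex : ∃ r : ℤ, r ≤ (i / 9 : ℕ) + 1 ∧ ((i / 9 : ℕ) : ℤ) ≤ r + 1 ∧
              ((F.toLocal (F.w + 1, r)).2 < 3 ∨ 6 < (F.toLocal (F.w + 1, r)).2) := by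
            rw [hq'] at hnf hns
            simp only [Frame.fst, Frame.snd, ne_eq, Prod.mk.injEq, true_and] at hnf hns
            simp only [Frame.toLocal]
            by_cases hle : ((i / 9 : ℕ) : ℤ) ≤ F.y
            · refine ⟨(i / 9 : ℕ) - 1, by omega, by omega, ?_⟩
              cases hup : F.up <;> simp only [hup, if_true, Bool.false_eq_true, if_false] at * <;>
                omega
            · refine ⟨(i / 9 : ℕ) + 1, by omega, by omega, ?_⟩
              cases hup : F.up <;> simp only [hup, if_true, Bool.false_eq_true, if_false] at * <;>
                omega
          obtain ⟨r, hr1, hr2, hr3⟩ := hex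
          have hro := (hout_gt (F.w + 1, r) (by simp)).1 (hcol_out r hr3)
          refine (Conn.single (v := (F.w + 1, r)) ?_ hio hro).trans (hright _ (by simp) hro)
          rw [touch_iff, hq']
          simp only [ne_eq, Prod.mk.injEq]
          omega
      · intro i j hi hij hj hi'
        have h1 := hcomp i hi'
        have h2 := hcomp j hj
        by_cases hne : j = i
        · rw [hne]; exact hi
        · refine (Conn.single ?_ (hcell j hj) (hcell i hi')).trans hi
          unfold TouchN at hij
          rw [touch_iff]
          simp only [toCell, ne_eq, Prod.mk.injEq]
          omega
      · intro i hi
        rw [Nat.testBit_and, Bool.and_eq_true] at hi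
        exact hi.1
      · have h1 : ¬ t.block.mask.testBit (code (x, y)) = true := fun h =>
          hu.1 ((glue_of_le hxw).2 ⟨hbox, h⟩)
        have h2 : (boxTo (t.block.a % 9)).testBit (code (x, y)) = true := by
          rw [testBit_boxTo hcol]
          simp only at hcode
          omega
        simp only [Bool.not_eq_true] at h1
        rw [Nat.testBit_xor, h1, h2]; rfl
    rwa [hbox.toCell_code] at key

theorem Valid.conn_compl {c : Chain} (hc : c.Valid) {u : Cell} (hu : ¬ c.In u) :
    Conn (fun v => ¬ c.In v) u (0, 30) := by
  have hP := hc.proper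
  rcases le_or_gt 0 u.1 with h | h
  · exact Relation.ReflTransGen.mono (r := fun x y => touchGraph.Adj x y ∧ c.Out x ∧ c.Out y)
      (fun a b hab => ⟨hab.1, hab.2.1.1, hab.2.2.1⟩) _ _ (hc.conn_out ⟨hu, h⟩)
  · have hout : ∀ x y : ℤ, (x < 0 ∨ (x = 0 ∧ 7 ≤ y)) → ¬ c.In (x, y) := by
      intro x y hxy h
      have h1 := hP.nonneg _ h
      have h2 := hP.rows _ h
      simp only at h1 h2
      omega
    obtain ⟨x, y⟩ := u
    simp only at h
    exact (Conn.vertical (z := 30) fun t _ _ => hout _ _ (by omega)).trans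
      (Conn.horizontal fun t _ _ => hout _ _ (by omega))

theorem Valid.no_hole {c : Chain} (hc : c.Valid) {P : Finset Cell} (hP : ∀ u, u ∈ P ↔ c.In u) :
    (touchGraph.induce (P : Set Cell)ᶜ).Preconnected := by
  have key : ∀ u v : Cell, Conn (fun v => ¬ c.In v) u v → ∀ (hu : u ∈ (P : Set Cell)ᶜ)
      (hv : v ∈ (P : Set Cell)ᶜ),
      (touchGraph.induce (P : Set Cell)ᶜ).Reachable ⟨u, hu⟩ ⟨v, hv⟩ := by
    intro u v h
    induction h with
    | refl => intro _ _; exact SimpleGraph.Reachable.refl _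
    | tail hab hbc ih =>
      intro hu hv
      have hb : _ ∈ (P : Set Cell)ᶜ := fun h => hbc.2.1 ((hP _).1 h)
      refine (ih hu hb).trans (SimpleGraph.Adj.reachable ?_)
      exact hbc.1
  rintro ⟨u, hu⟩ ⟨v, hv⟩
  refine key u v ?_ hu hv
  exact (hc.conn_compl fun h => hu ((hP u).2 h)).trans
    (hc.conn_compl fun h => hv ((hP v).2 h)).symm

end Chain
-- The closed tour through a chain.
-- The bounds on rows and columns rule out steps that wrap around the end of a row and subtractions
-- truncated at 0, so steps of codes are steps of cells.
theorem decodePath_isChain {n p c : ℕ} (h : ∀ i ∈ decodePath n p c,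
    i % 9 ≤ 6 ∧ i / 9 ≤ 7 ∧ (i % 9 = 0 → 3 ≤ i / 9 ∧ i / 9 ≤ 6)) :
    (decodePath n p c).IsChain fun i j => edgeGraph.Adj (toCell i) (toCell j) := by
  induction n generalizing p c with
  | zero => exact List.isChain_singleton _
  | succ n ih =>
    unfold decodePath at h ⊢
    cases hp : p.ble 1
    · simp only [hp, cond_false] at h ⊢
      set d := bif (p % 4).beq 0 then c + 1 else bif (p % 4).beq 1 then c - 1 else
          bif (p % 4).beq 2 then c + 9 else c - 9 with hd
      have hd' : d = c + 1 ∨ d = c - 1 ∨ d = c + 9 ∨ d = c - 9 := by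
        rw [hd]
        cases (p % 4).beq 0 <;> cases (p % 4).beq 1 <;> cases (p % 4).beq 2 <;> simp
      have h1 := ih fun i hi => h i (List.mem_cons_of_mem _ hi)
      obtain ⟨l, hl⟩ := decodePath_head n (p / 4) d
      rw [hl] at h1 h ⊢
      refine List.isChain_cons_cons.2 ⟨?_, h1⟩
      have h2 := h c (by simp)
      have h3 := h d (by simp)
      rw [adj_iff]
      simp only [toCell]
      omega
    · exact List.isChain_singleton _

theorem exists_of_hasStep {a b : ℕ} {l : List ℕ} (h : hasStep a b l = true) :
    ∃ l1 x y l2, l = l1 ++ x :: y :: l2 ∧ ((x = a ∧ y = b) ∨ (x = b ∧ y = a)) := by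
  induction l with
  | nil => simp [hasStep] at h
  | cons x l ih =>
    cases l with
    | nil => simp [hasStep] at h
    | cons y l =>
      simp only [hasStep, Bool.or_eq_true, Bool.and_eq_true, Nat.beq_eq] at h
      rcases h with h | h
      · exact ⟨[], x, y, l, rfl, h⟩
      · obtain ⟨l1, u, v, l2, h1, h2⟩ := ih h
        exact ⟨x :: l1, u, v, l2, by rw [h1]; rfl, h2⟩

/-- A list with a detour inserted between two consecutive entries. -/
theorem isChain_insert {α : Type} {R : α → α → Prop} {l1 l2 q : List α} {x y a b : α}
    (h : (l1 ++ x :: y :: l2).IsChain R) (hq : q.IsChain R) (ha : q.head? = some a)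
    (hb : q.getLast? = some b) (hxa : R x a) (hby : R b y) :
    (l1 ++ x :: (q ++ y :: l2)).IsChain R := by
  have h1 := List.isChain_split.1 h
  refine List.isChain_split.2 ⟨h1.1, ?_⟩
  rw [List.isChain_cons]
  refine ⟨?_, ?_⟩
  · intro z hz
    rw [List.head?_append, ha] at hz
    simp only [Option.some_or, Option.mem_def, Option.some.injEq] at hz
    rwa [← hz]
  · rw [List.isChain_append]
    refine ⟨hq, h1.2.tail, ?_⟩
    intro u hu v hv
    rw [hb] at hu
    simp only [Option.mem_def, Option.some.injEq, List.head?_cons] at hu hv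
    rwa [← hu, ← hv]

/-- The path through a block uses its neck. -/
theorem Tree.exists_blockPath {t : Tree} (ht : t.block.valid = true) (sw : Bool) :
    ∃ l1 x y l2, (l1 ++ x :: y :: l2).IsChain edgeGraph.Adj ∧
      (l1 ++ x :: y :: l2).head? = some entryA ∧ (l1 ++ x :: y :: l2).getLast? = some entryB ∧
      (∀ u, u ∈ l1 ++ x :: y :: l2 ↔ Mem t.block.mask u) ∧
      (l1 ++ x :: y :: l2).length = t.block.path.length ∧
      ((x = (t.block.frame sw).fst ∧ y = (t.block.frame sw).snd) ∨
        (x = (t.block.frame sw).snd ∧ y = (t.block.frame sw).fst)) := by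
  have hB := Block.good_of_valid ht
  have hbox : ∀ i ∈ t.block.path, i % 9 ≤ 6 ∧ i / 9 ≤ 7 ∧ (i % 9 = 0 → 3 ≤ i / 9 ∧ i / 9 ≤ 6) := by
    intro i hi
    have := hB.box i ((Tree.mem_path ht).2 hi)
    have := hB.col_le
    omega
  have hch : (t.block.path.map toCell).IsChain edgeGraph.Adj := by
    rw [List.isChain_map]
    obtain ⟨q, a, b, h⟩ := Tree.block_eq_mkBlock ht
    rw [h] at hbox ⊢
    exact decodePath_isChain hbox
  have hmem : ∀ u, u ∈ t.block.path.map toCell ↔ Mem t.block.mask u := by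
    intro u
    rw [List.mem_map]
    constructor
    · rintro ⟨i, hi, rfl⟩
      exact hB.mem_toCell ((Tree.mem_path ht).2 hi)
    · intro h
      exact ⟨code u, (Tree.mem_path ht).1 h.2, h.1.toCell_code⟩
  have hhead : (t.block.path.map toCell).head? = some entryA := by
    obtain ⟨q, a, b, h⟩ := Tree.block_eq_mkBlock ht
    obtain ⟨l, hl⟩ := decodePath_head 22 q 36
    rw [h, mkBlock, hl]
    rfl
  have hlast : (t.block.path.map toCell).getLast? = some entryB := by
    have h1 := hB.getLast
    rw [List.getLastD_eq_getLast?] at h1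
    rw [List.getLast?_map]
    cases h2 : t.block.path.getLast? with
    | none => simp [h2] at h1
    | some a =>
      obtain rfl : a = 45 := by simpa [h2] using h1
      rfl
  obtain ⟨l1, x, y, l2, hl, hxy⟩ := exists_of_hasStep hB.hasStep
  have hmap : t.block.path.map toCell =
      l1.map toCell ++ toCell x :: toCell y :: l2.map toCell := by
    rw [hl, List.map_append, List.map_cons, List.map_cons]
  have hlen : (t.block.path.map toCell).length = t.block.path.length := List.length_map _
  rw [hmap] at hch hmem hhead hlast hlen
  refine ⟨_, _, _, _, hch, hhead, hlast, hmem, hlen, ?_⟩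
  rw [hB.fst_frame, hB.snd_frame]
  rcases hxy with ⟨rfl, rfl⟩ | ⟨rfl, rfl⟩ <;> cases sw <;> simp

theorem Frame.adj_entryA (F : Frame) : edgeGraph.Adj F.fst (F.toGlobal entryA) := by
  obtain ⟨w, y, _ | _⟩ := F <;> simp [fst, toGlobal, entryA, adj_iff]

theorem Frame.adj_entryB (F : Frame) : edgeGraph.Adj F.snd (F.toGlobal entryB) := by
  obtain ⟨w, y, _ | _⟩ := F <;> simp [snd, toGlobal, entryB, adj_iff] <;> omega

namespace Chain

/-- The length of the closed path through all cells. -/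
def len : Chain → ℕ
  | nil _ => 2
  | cons t _ tail => t.block.path.length + tail.len

/-- The step along the neck in the path of the first block is replaced by the path through the tail,
reversed if the neck is traversed from `F.snd` to `F.fst`. The lengths simply add up, since the step
replaced had its two ends in the block anyway. -/
theorem Valid.exists_path {c : Chain} (hc : c.Valid) : ∃ p : List Cell,
    p.IsChain edgeGraph.Adj ∧ p.head? = some entryA ∧ p.getLast? = some entryB ∧
      (∀ u, u ∈ p ↔ c.In u) ∧ p.length = c.len := by
  induction c with
  | nil m =>
    exact ⟨[entryA, entryB], by simpa using adj_entry, rfl, rfl, by simp [In], rfl⟩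
  | cons t sw tail ih =>
    obtain ⟨q, hq, hqA, hqB, hqm, hql⟩ := ih hc.2
    have hP := hc.2.proper
    have hB := Block.good_of_valid hc.1
    have hG := hB.glue sw
    set F := t.block.frame sw with hF
    obtain ⟨l1, x, y, l2, hch, hhead, hlast, hmem, hlen, hxy⟩ := Tree.exists_blockPath hc.1 sw
    rw [← hF] at hxy
    have hQ : (q.map F.toGlobal).IsChain edgeGraph.Adj := by
      rw [List.isChain_map]
      exact hq.imp fun _ _ h => F.adj_toGlobal.2 h
    obtain ⟨Q, hQc, a, b, ha, hb, hxa, hby, hQm, hQl⟩ : ∃ Q : List Cell, Q.IsChain edgeGraph.Adj ∧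
        ∃ a b, Q.head? = some a ∧ Q.getLast? = some b ∧ edgeGraph.Adj x a ∧
          edgeGraph.Adj b y ∧ (∀ u, u ∈ Q ↔ u ∈ q.map F.toGlobal) ∧
          Q.length = tail.len := by
      rcases hxy with h | h
      · refine ⟨q.map F.toGlobal, hQ, F.toGlobal entryA, F.toGlobal entryB, ?_, ?_, ?_, ?_, ?_, ?_⟩
        · rw [List.head?_map, hqA]; rfl
        · rw [List.getLast?_map, hqB]; rfl
        · rw [h.1]; exact F.adj_entryA
        · rw [h.2]; exact F.adj_entryB.symm
        · exact fun _ => Iff.rfl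
        · rw [List.length_map, hql]
      · refine ⟨(q.map F.toGlobal).reverse, ?_, F.toGlobal entryB, F.toGlobal entryA,
          ?_, ?_, ?_, ?_, ?_, ?_⟩
        · rw [List.isChain_reverse]
          exact hQ.imp fun _ _ h => h.symm
        · rw [List.head?_reverse, List.getLast?_map, hqB]; rfl
        · rw [List.getLast?_reverse, List.head?_map, hqA]; rfl
        · rw [h.1]; exact F.adj_entryB
        · rw [h.2]; exact F.adj_entryA.symm
        · exact fun _ => List.mem_reverse
        · rw [List.length_reverse, List.length_map, hql]
    refine ⟨l1 ++ x :: (Q ++ y :: l2),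
      isChain_insert hch hQc ha hb hxa hby, ?_, ?_, ?_, ?_⟩
    · rw [List.head?_append] at hhead ⊢
      exact hhead
    · simp only [List.getLast?_append, List.getLast?_cons] at hlast ⊢
      simpa using hlast
    · intro u
      have h1 := hmem u
      have h2 : u ∈ l1 ++ x :: (Q ++ y :: l2) ↔
          u ∈ Q ∨ Mem t.block.mask u := by
        rw [← h1]
        simp only [List.mem_append, List.mem_cons]
        tauto
      rw [h2, hQm, List.mem_map]
      constructor
      · rintro (⟨v, hv, rfl⟩ | h)
        · have hv' := (hqm v).1 hv
          have := hP.nonneg v hv'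
          refine (glue_of_lt (by change F.w < v.1 + F.w + 1; omega)).2 ?_
          rwa [Frame.toLocal_toGlobal]
        · exact (glue_of_le (hG.le u h).2.1).2 h
      · intro h
        rcases le_or_gt u.1 F.w with hu | hu
        · exact Or.inr ((glue_of_le hu).1 h)
        · exact Or.inl ⟨F.toLocal u, (hqm _).2 ((glue_of_lt hu).1 h), F.toGlobal_toLocal u⟩
    · simp only [List.length_append, List.length_cons] at hlen ⊢
      rw [len, ← hlen, hQl]
      omega

end Chain

theorem reachable_of_isChain {P : Set Cell} {p : List Cell} (h : p.IsChain edgeGraph.Adj)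
    {a : Cell} (ha : p.head? = some a) (hP : ∀ u ∈ p, u ∈ P) {u : Cell} (hu : u ∈ p)
    (haP : a ∈ P) : (edgeGraph.induce P).Reachable ⟨a, haP⟩ ⟨u, hP u hu⟩ := by
  induction p generalizing a with
  | nil => simp at ha
  | cons x p ih =>
    obtain rfl : x = a := by simpa using ha
    rcases List.mem_cons.1 hu with rfl | hu'
    · exact SimpleGraph.Reachable.refl _
    cases p with
    | nil => simp at hu'
    | cons y p =>
      rw [List.isChain_cons_cons] at h
      have hy : y ∈ P := hP y (by simp)
      refine (SimpleGraph.Adj.reachable (v := ⟨y, hy⟩) ?_).trans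
        (ih h.2 rfl (fun v hv => hP v (List.mem_cons_of_mem _ hv)) hu' hy)
      exact h.1

theorem IsTour.card_le {P : Finset Cell} {s : Cell} {l : List Cell} (h : IsTour P s l) :
    P.card ≤ l.length :=
  (Finset.card_le_card fun u hu => List.mem_toFinset.2 ((h.mem_iff u).2 hu)).trans
    l.toFinset_card_le

/-- The cells of a valid chain form an instance, and its closed path bounds the optimal tour. -/
theorem Chain.Valid.exists_polygon {c : Chain} (hc : c.Valid) : ∃ P : Finset Cell,
    (∀ u, u ∈ P ↔ c.In u) ∧ IsInstance P entryA ∧ optSteps P entryA ≤ c.len ∧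
      P.card ≤ optSteps P entryA + 1 := by
  obtain ⟨p, h1, h2, h3, h4, h5⟩ := hc.exists_path
  have hP : ∀ u, u ∈ p.toFinset ↔ c.In u := fun u => by rw [List.mem_toFinset, h4]
  have hA : entryA ∈ p.toFinset := (hP _).2 hc.proper.memA
  have htour : IsTour p.toFinset entryA (p ++ [entryA]) := by
    refine ⟨?_, by simp, ?_, ?_⟩
    · rw [List.head?_append, h2]; rfl
    · rw [List.isChain_append]
      refine ⟨h1, List.isChain_singleton _, ?_⟩
      intro u hu v hv
      rw [h3] at hu
      simp only [Option.mem_def, Option.some.injEq, List.head?_cons] at hu hv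
      rw [← hu, ← hv]
      exact adj_entry.symm
    · intro u
      have hA' := List.mem_toFinset.1 hA
      rw [List.mem_append, List.mem_singleton, List.mem_toFinset]
      exact ⟨fun h => h.elim id fun h => h ▸ hA', Or.inl⟩
  have hmem : c.len ∈ {k | ∃ l : List Cell, IsTour p.toFinset entryA l ∧ l.length = k + 1} :=
    ⟨_, htour, by simp [h5]⟩
  refine ⟨p.toFinset, hP, ⟨⟨?_, hc.no_hole hP⟩, hA, Dir.west, ?_⟩, Nat.sInf_le hmem, ?_⟩
  · have : Nonempty ↑(p.toFinset : Set Cell) := ⟨⟨entryA, hA⟩⟩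
    refine ⟨?_⟩
    have key := fun (u : Cell) hu => reachable_of_isChain (P := (p.toFinset : Set Cell)) h1 h2
      (fun u hu => List.mem_toFinset.2 hu) (u := u) hu hA
    rintro ⟨u, hu⟩ ⟨v, hv⟩
    exact (key u (List.mem_toFinset.1 hu)).symm.trans (key v (List.mem_toFinset.1 hv))
  · rw [hP]
    intro h
    have := hc.proper.nonneg _ h
    simp [entryA, Dir.vec] at this
  · obtain ⟨l, hl, hl'⟩ := Nat.sInf_mem ⟨_, hmem⟩
    rw [optSteps, ← hl']
    exact hl.card_le

/-! ### The cost of a completed exploration. -/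

theorem closeCost_code {h : Cell} (hh : h = entryA ∨ h = entryB) :
    closeCost (code h) = closeCell h := by
  rcases hh with rfl | rfl <;> rfl

/-- The surcharge 2 suffices up to `O = 11` and the surcharge 4 up to `O = 22`, where equality
holds. This is the origin of the constant 13/11. -/
theorem le_need {O : ℕ} (h : O ≤ 22) (h' : O % 2 = 0) : 13 * O ≤ 11 * need O := by
  have : ∀ O ≤ 22, O % 2 = 0 → 13 * O ≤ 11 * need O := by decide
  exact this O h h'

namespace Tree
variable {t : Tree} {x y : ℕ} {f : List ℕ}

/-- The agent cannot finish a block whose exit it has not used. -/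
theorem not_covers_of_br {c : ℕ} {t r : Tree} {V p k x y : ℕ} (hx : x ≠ 0)
    (h : (br c t r).Entry V p k x y)
    (hV : ∀ i, (br c t r).block.mask.testBit i = true → V.testBit i = true) : False := by
  obtain ⟨-, h⟩ := h
  have hfull : (br c t r).block.full x = (br c t r).block.mask := by
    have : x.beq 0 = false := by rw [Bool.eq_false_iff]; simpa using hx
    rw [Block.full, this]; rfl
  have hk : (br c t r).block.known V x ^^^ V = 0 := by
    apply Nat.eq_of_testBit_eq
    intro i
    rw [Block.known, hfull, Nat.testBit_xor, Nat.testBit_or, Nat.testBit_and]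
    have := hV i
    cases h1 : (br c t r).block.mask.testBit i <;> cases h2 : V.testBit i <;> simp_all
  rw [hk] at h
  simp [check] at h

/-- A branch at an inner node stands for a known free cell not yet visited. With the exit used and
the whole block visited there is none. -/
theorem State.isLeaf (h : t.State x y f) (hx : x ≠ 0)
    (hf : ∀ i, t.block.mask.testBit i = true → i ∈ f) : t.isLeaf = true := by
  by_contra hl
  obtain ⟨V, p, k, f1, f0, rfl, hE, hV, hk, hm, h1⟩ := h
  replace h1 := h1.resolve_left hl
  cases t with
  | leaf q a b => exact hl rfl
  | nil => exact absurd hE.1 (by decide)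
  | br c t r =>
    refine not_covers_of_br hx hE fun i hi => ?_
    rcases List.mem_append.1 (hf i hi) with h2 | h2
    · exact h1 i h2
    · exact (hV i).2 h2

/-- The walk is cut at the moment when the leaf was reached: `k` bounds the moves made before, and
the search bounds the rest together with the closing cost. -/
theorem State.need_le (h : t.State x y f) (ht : t.isLeaf = true)
    (hf : ∀ i, t.block.mask.testBit i = true → i ∈ f) (hl : LazyN f) {e : ℕ}
    (he : f.head? = some e) (he' : e = 36 ∨ e = 45) :
    need t.block.path.length ≤ moves f + closeCost e := by
  have hbox := h.good.box
  obtain ⟨V, p, k, f1, f0, rfl, hE, hV, hk, hm, -⟩ := h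
  cases t with
  | br c t r => cases ht
  | nil => cases ht
  | leaf q a b =>
    have hch := hE.2
    simp only [check, Bool.and_eq_true] at hch
    obtain ⟨⟨⟨-, hsub⟩, -⟩, hs⟩ := hch
    have hVC := fun i => testBit_of_land_eq (Nat.eq_of_beq_eq_true hsub) (i := i)
    have hlt : ((mkBlock q a b).mask ^^^ V) < 2 ^ 72 := by
      apply Nat.lt_pow_two_of_testBit
      intro i hi
      by_contra h
      have : (mkBlock q a b).mask.testBit i = true := by
        by_contra h1
        have h2 : V.testBit i ≠ true := fun h2 => h1 (hVC i h2)
        simp only [Bool.not_eq_true] at h1 h2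
        simp [Nat.testBit_xor, h1, h2] at h
      have := hbox i this
      omega
    obtain ⟨s, hs1, hs2⟩ := exists_finset_bitCount 72 _ hlt
    have hs3 : ∀ i, i ∈ s ↔ (mkBlock q a b).mask.testBit i = true ∧ ¬ V.testBit i = true := by
      intro i
      rw [hs2, Nat.testBit_xor]
      have := hVC i
      cases h1 : (mkBlock q a b).mask.testBit i <;> cases h2 : V.testBit i <;> simp_all
    have hp : V.testBit p = true := (hV p).2 (by simp)
    have hl' : LazyN (f1 ++ [p]) := by
      have : f1 ++ p :: f0 = (f1 ++ [p]) ++ f0 := by simp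
      rw [this] at hl
      exact hl.left_of_append
    have he2 : (f1 ++ [p]).head? = some e := by
      rw [List.head?_append] at he ⊢
      exact he
    have key := search_sound hs s hs1 hs3 f1 hl' hp hm ?_ he2 he'
    · rw [moves_append]
      exact key.trans (by omega)
    · intro i hi
      have h1 := (hs3 i).1 hi
      rcases List.mem_append.1 (hf i h1.1) with h2 | h2
      · exact h2
      · exact absurd ((hV i).2 h2) h1.2

end Tree

namespace Chain

/-- The cost of a finished exploration. -/
theorem Inv.cost {c : Chain} {l : List Cell} (hI : c.Inv l) (hL : Lazy l)
    (hmem : ∀ u, u ∈ l ↔ c.In u) {h : Cell} (hh : l.head? = some h)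
    (hAB : h = entryA ∨ h = entryB) :
    13 * c.len ≤ 11 * (moves l + closeCell h) + 26 ∧
      ∃ s : Finset Cell, s.card = c.depth + 1 ∧ ∀ u ∈ s, c.In u := by
  induction c generalizing l h with
  | nil m =>
    -- The constant 26 is `13 * 2`, for the two cells that end the chain; nothing is demanded of the
    -- agent there.
    refine ⟨by simp [len], ?_⟩
    rcases hI with rfl | ⟨rfl, -, -⟩
    · simp at hh
    · exact ⟨{entryA}, rfl, by simp [In]⟩
  | cons t sw tail ih =>
    obtain ⟨h1, h2, x, y, hS, h3⟩ := hI
    have hB := hS.good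
    have hG := hB.glue sw
    have hP := h2.proper
    have hmem' : ∀ u, u ∈ l ↔ glue (t.block.frame sw) (Mem t.block.mask) tail.In u := hmem
    revert h2 hS h3 hG hmem'
    generalize hF : t.block.frame sw = F
    intro h2 hS h3 hG hmem'
    have hhi : ∀ u, u ∈ F.hi l ↔ tail.In u := by
      intro u
      rw [Frame.mem_hi, hmem']
      constructor
      · rintro ⟨h4, h5⟩
        rw [glue_of_lt h5, Frame.toLocal_toGlobal] at h4
        exact h4
      · intro h4
        have := hP.nonneg u h4
        have h5 : F.w < (F.toGlobal u).1 := by rw [Frame.toGlobal_fst]; omega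
        refine ⟨?_, h5⟩
        rwa [glue_of_lt h5, Frame.toLocal_toGlobal]
    have hhiA := (hhi _).2 hP.memA
    have hne : F.hi l ≠ [] := List.ne_nil_of_mem hhiA
    have hle : h.1 ≤ F.w := by
      have := hG.w_nonneg
      rcases hAB with rfl | rfl <;> simpa [entryA, entryB] using this
    obtain ⟨hlo, hhiL, hsplit⟩ := hG.split hP l hL (by rintro rfl; simp at hh)
      (fun u hu => (hmem' u).1 hu)
      (fun u hu => by
        rw [h1] at hu
        obtain rfl : entryA = u := by simpa using hu
        simpa [entryA] using hG.w_nonneg)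
      (fun u hu => h2.getLast hu)
    have hsp := (hsplit h hh).1 hle
    obtain ⟨g, hg⟩ : ∃ g, (F.hi l).head? = some g := ⟨_, List.head?_eq_some_head hne⟩
    obtain ⟨hgAB, hcost⟩ := hsp.head g hg
    obtain ⟨ih1, s, hs1, hs2⟩ := ih h2 hhiL hhi hg hgAB
    have hloS : ∀ u ∈ F.lo l, Mem t.block.mask u := by
      intro u hu
      rw [Frame.mem_lo, hmem'] at hu
      exact (glue_of_le hu.2).1 hu.1
    have hcov : ∀ i, t.block.mask.testBit i = true → i ∈ (F.lo l).map code := by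
      intro i hi
      have hi' := hB.mem_toCell hi
      refine List.mem_map.2 ⟨toCell i, ?_, code_toCell i⟩
      have := (hG.le _ hi').2.1
      rw [Frame.mem_lo, hmem', glue_of_le this]
      exact ⟨hi', this⟩
    -- Since cells behind the neck have been visited, the exit is used, and a fully visited block is
    -- then at a leaf.
    have hleaf : t.isLeaf = true := by
      rcases h3 with h3 | h3 | h3
      · exact h3
      · exact absurd h3.2.2.2 hne
      · exact hS.isLeaf h3.1 hcov
    have hbox := fun u hu => (hloS u hu).1
    have hhead : (F.lo l).head? = some h := by
      cases l with
      | nil => simp at hh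
      | cons z l =>
        obtain rfl : z = h := by simpa using hh
        rw [Frame.lo_cons_of_le hle]; rfl
    have hneed := hS.need_le hleaf hcov (lazyN_map_code hbox hlo) (e := code h)
      (by rw [List.head?_map, hhead]; rfl)
      (by rcases hAB with rfl | rfl <;> simp [code, entryA, entryB])
    rw [moves_map_code hbox, closeCost_code hAB] at hneed
    have hO := le_need hB.length_le hB.even
    refine ⟨by simp only [len]; omega, insert entryA (s.image F.toGlobal), ?_, ?_⟩
    · rw [Finset.card_insert_of_notMem, Finset.card_image_of_injective _
        (Function.LeftInverse.injective F.toLocal_toGlobal), hs1]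
      · rfl
      · intro h4
        obtain ⟨u, hu, hu'⟩ := Finset.mem_image.1 h4
        have h5 := hP.nonneg u (hs2 u hu)
        have h6 := congrArg Prod.fst hu'
        have h7 := hG.w_nonneg
        rw [Frame.toGlobal_fst] at h6
        simp only [entryA] at h6
        omega
    · intro u hu
      rw [← hmem, hmem']
      rcases Finset.mem_insert.1 hu with rfl | hu
      · have := (hG.proper_glue (T := tail.In) (Tree.mem_entry hS.valid.1).1
          (Tree.mem_entry hS.valid.1).2).memA
        exact this
      · obtain ⟨v, hv, rfl⟩ := Finset.mem_image.1 hu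
        exact ((Frame.mem_hi (F := F)).1 ((hhi v).2 (hs2 v hv))).1 |> (hmem' _).1

end Chain
-- Playing a strategy against the adversary.
namespace Strategy
variable (A : Strategy) {P P' : Finset Cell} {s : Cell}

theorem visits_suffix {m n : ℕ} (h : m ≤ n) : A.visits P s m <:+ A.visits P s n := by
  induction n, h using Nat.le_induction with
  | base => exact List.suffix_rfl
  | succ n _ ih =>
    refine ih.trans ?_
    rw [visits]
    split
    · exact List.suffix_rfl
    · exact List.suffix_cons _ _

theorem getLast?_visits (n : ℕ) : (A.visits P s n).getLast? = some s := by
  obtain ⟨t, ht⟩ := A.visits_suffix (P := P) (s := s) (Nat.zero_le n)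
  rw [← ht]
  simp [visits]

/-- The strategy proceeds in the same way if it has the same information. -/
theorem visits_congr {n : ℕ}
    (h : ∀ v ∈ A.visits P s n, ∀ u, Near v u → (u ∈ P ↔ u ∈ P')) {k : ℕ} (hk : k ≤ n + 1) :
    A.visits P' s k = A.visits P s k := by
  -- The decision taken after `n` steps depends only on the records up to then; therefore agreement
  -- reaches one cell further, to `n + 1`.
  induction k with
  | zero => rfl
  | succ k ih =>
    have h1 := ih (by omega)
    have h2 : (A.visits P s k).map (observe P' s) = (A.visits P s k).map (observe P s) := by
      refine List.map_congr_left fun v hv => ?_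
      refine Prod.ext rfl (funext fun d => ?_)
      have h3 := h v ((A.visits_suffix (by omega)).subset hv) (v + d.vec) (Or.inr ?_)
      · exact decide_eq_decide.2 h3.symm
      · rw [adj_iff]
        cases d <;> simp [Dir.vec]
    rw [visits, visits, h1, h2]

theorem visits_of_stopsAt {n k : ℕ} (h : A.StopsAt P s n) (hk : n ≤ k) :
    A.visits P s k = A.visits P s n := by
  induction k, hk using Nat.le_induction with
  | base => rfl
  | succ k _ ih =>
    have h' : A ((A.visits P s k).map (observe P s)) = none := by rw [ih]; exact h
    rw [visits, h']
    exact ih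

theorem length_visits {n : ℕ} (h : ∀ k < n, ¬ A.StopsAt P s k) :
    (A.visits P s n).length = n + 1 := by
  induction n with
  | zero => rfl
  | succ n ih =>
    have h1 := ih fun k hk => h k (by omega)
    have h2 := h n (by omega)
    rw [visits]
    unfold StopsAt at h2
    split
    · contradiction
    · rw [List.length_cons, h1]

theorem length_visits_steps : (A.visits P s (A.steps P s)).length = A.steps P s + 1 :=
  A.length_visits fun _ hk => Nat.notMem_of_lt_sInf hk

theorem Solves.stopsAt_steps {A : Strategy} (h : A.Solves P s) : A.StopsAt P s (A.steps P s) :=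
  Nat.sInf_mem h.1

end Strategy

theorem moves_eq_of_isChain {l : List Cell} (h : l.IsChain edgeGraph.Adj) :
    moves l = l.length - 1 := by
  induction l with
  | nil => rfl
  | cons x l ih =>
    cases l with
    | nil => rfl
    | cons y l =>
      rw [List.isChain_cons_cons] at h
      rw [moves_cons_ne h.1.ne, ih h.2]
      simp

/-- Against every strategy the adversary can keep up its play until all cells are visited. -/
theorem Strategy.exists_explored (A : Strategy) (hA : A.IsExploration) (w k : ℕ) (c : Chain)
    (P : Finset Cell) (n : ℕ) (hw : c.weight = w) (hk : A.steps P entryA - n = k)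
    (hP : ∀ u, u ∈ P ↔ c.In u) (hI : c.Inv (A.visits P entryA n)) :
    ∃ (c' : Chain) (P' : Finset Cell), (∀ u, u ∈ P' ↔ c'.In u) ∧
      c'.Inv (A.visits P' entryA (A.steps P' entryA)) ∧ c'.depth = c.depth := by
  -- A changed polygon may change the total number of steps of the strategy, so only the weight
  -- decreases then. The number of steps left is the inner measure, used as long as the polygon
  -- stays the same.
  induction w using Nat.strong_induction_on generalizing k c P n with
  | _ w ihw =>
  induction k using Nat.strong_induction_on generalizing c P n with
  | _ k ihk =>
  have hinst : IsInstance P entryA := by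
    obtain ⟨Q, hQ, hQ', -⟩ := hI.toValid.exists_polygon
    obtain rfl : P = Q := by ext u; rw [hP, hQ]
    exact hQ'
  have hS := hA P entryA hinst
  have hfinal := hS.stopsAt_steps
  rcases le_or_gt (A.steps P entryA) n with hn | hn
  · rw [A.visits_of_stopsAt hfinal hn] at hI
    exact ⟨c, P, hP, hI, rfl⟩
  have hns : ¬ A.StopsAt P entryA n := Nat.notMem_of_lt_sInf hn
  obtain ⟨d, hd⟩ := Option.ne_none_iff_exists'.1 hns
  set l := A.visits P entryA n with hl
  obtain ⟨z, hz⟩ : ∃ z, A.visits P entryA (n + 1) = z :: l := by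
    rw [Strategy.visits, hd]; exact ⟨_, rfl⟩
  have hsuf : z :: l <:+ A.visits P entryA (A.steps P entryA) := by
    rw [← hz]; exact A.visits_suffix (by omega)
  have hmem : ∀ v ∈ z :: l, c.In v := fun v hv =>
    (hP v).1 ((hS.2.mem_iff v).1 (hsuf.subset hv))
  have hlazy : Lazy (z :: l) := (hS.2.chain.suffix hsuf).imp fun _ _ h => Or.inr h
  have hlne : l ≠ [] := fun h => by
    have := A.getLast?_visits (P := P) (s := entryA) n
    rw [← hl, h] at this
    cases this
  obtain ⟨c', hI', hnear, -, hdep, hwt⟩ := c.step l z hI hlazy hmem fun h => absurd h hlne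
  obtain ⟨P', hP', -⟩ := hI'.toValid.exists_polygon
  have hvis : A.visits P' entryA (n + 1) = z :: l := by
    rw [← hz]
    refine A.visits_congr (fun v hv u hu => ?_) le_rfl
    rw [hP, hP']
    exact hnear v hv u hu
  rw [← hvis] at hI'
  rw [← hdep]
  rcases hwt with hlt | ⟨heq, hIn⟩
  · exact ihw _ (hw ▸ hlt) _ c' P' (n + 1) rfl rfl hP' hI'
  · obtain rfl : P = P' := by ext u; rw [hP, hP', hIn]
    exact ihk _ (by omega) c' P (n + 1) (by omega) rfl hP' hI'

/-- The tour ends in `entryA`, where closing is charged with 2. With the 26 for the end of the chain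
this gives `11 * 2 + 26 = 48`. -/
theorem Strategy.exists_instance (A : Strategy) (hA : A.IsExploration) (m : ℕ) :
    ∃ P : Finset Cell, IsInstance P entryA ∧ m + 1 ≤ P.card ∧ P.card ≤ optSteps P entryA + 1 ∧
      13 * optSteps P entryA ≤ 11 * A.steps P entryA + 48 := by
  obtain ⟨c, hc, -, hdep, -⟩ := Chain.step_nil m
  obtain ⟨P, hP, -⟩ := hc.toValid.exists_polygon
  obtain ⟨c', P', hP', hI, hdep'⟩ := A.exists_explored hA _ _ c P 0 rfl rfl hP hc
  obtain ⟨Q, hQ, hinst, hopt, hcard⟩ := hI.toValid.exists_polygon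
  obtain rfl : P' = Q := by ext u; rw [hP', hQ]
  have hS := (hA P' entryA hinst).2
  have hcost := hI.cost (hS.chain.imp fun _ _ h => Or.inr h)
    (fun u => by rw [hS.mem_iff, hP']) hS.head_eq (Or.inl rfl)
  rw [moves_eq_of_isChain hS.chain, A.length_visits_steps] at hcost
  obtain ⟨h1, s, h2, h3⟩ := hcost
  refine ⟨P', hinst, ?_, hcard, ?_⟩
  · rw [← hdep, ← hdep', ← h2]
    exact Finset.card_le_card fun u hu => (hP' u).2 (h3 u hu)
  · simp only [closeCell, if_true] at h1
    omega

end GridExploration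

/-! ### From the additive estimate to the ratio. -/

theorem theorem1 (A : GridExploration.Strategy) (hA : A.IsExploration) :
    (∀ ε : ℝ, 0 < ε → ∀ N : ℕ, ∃ (P : Finset GridExploration.Cell) (s : GridExploration.Cell),
      GridExploration.IsInstance P s ∧ N ≤ P.card ∧ 0 < GridExploration.optSteps P s ∧
        13 / 11 - ε < (A.steps P s : ℝ) / (GridExploration.optSteps P s : ℝ)) ∧
    (∀ C : ℝ, C < 13 / 11 → ¬ A.IsCompetitive C) := by
  have key : ∀ ε : ℝ, 0 < ε → ∀ N : ℕ,
      ∃ (P : Finset GridExploration.Cell) (s : GridExploration.Cell),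
        GridExploration.IsInstance P s ∧ N ≤ P.card ∧ N ≤ GridExploration.optSteps P s ∧
        0 < GridExploration.optSteps P s ∧
        13 / 11 - ε < (A.steps P s : ℝ) / (GridExploration.optSteps P s : ℝ) := by
    intro ε hε N
    -- The estimate says that the ratio is at least `13 / 11 - 48 / (11 * OPT)`, and `OPT ≥ K` makes
    -- the loss smaller than `ε`.
    obtain ⟨K, hK⟩ := exists_nat_gt (48 / (11 * ε))
    obtain ⟨P, h1, h2, h3, h4⟩ := A.exists_instance hA (N + K + 1)
    refine ⟨P, _, h1, by omega, by omega, by omega, ?_⟩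
    have hpos : (0 : ℝ) < GridExploration.optSteps P GridExploration.entryA := by
      exact_mod_cast (by omega : 0 < GridExploration.optSteps P GridExploration.entryA)
    have h5 : (K : ℝ) ≤ GridExploration.optSteps P GridExploration.entryA := by
      exact_mod_cast (by omega : K ≤ GridExploration.optSteps P GridExploration.entryA)
    have h6 : (13 : ℝ) * GridExploration.optSteps P GridExploration.entryA ≤
        11 * A.steps P GridExploration.entryA + 48 := by exact_mod_cast h4
    rw [div_lt_iff₀ (by positivity)] at hK
    rw [lt_div_iff₀ hpos]
    nlinarith
  refine ⟨fun ε hε N => ?_, ?_⟩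
  · obtain ⟨P, s, h1, h2, -, h3, h4⟩ := key ε hε N
    exact ⟨P, s, h1, h2, h3, h4⟩
  · rintro C hC ⟨a, ha⟩
    -- Half of the gap: the ratio exceeds `13 / 11 - δ = C + δ`, so competitiveness would force `δ *
    -- OPT < a`, against `OPT ≥ N > a / δ`.
    set δ := (13 / 11 - C) / 2 with hδ
    have hδ0 : 0 < δ := by rw [hδ]; linarith
    obtain ⟨N, hN⟩ := exists_nat_gt (a / δ)
    obtain ⟨P, s, h1, -, h2, h3, h4⟩ := key δ hδ0 N
    have h5 := ha P s h1
    have hpos : (0 : ℝ) < GridExploration.optSteps P s := by exact_mod_cast h3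
    have h6 : (N : ℝ) ≤ GridExploration.optSteps P s := by exact_mod_cast h2
    rw [div_lt_iff₀ hδ0] at hN
    rw [lt_div_iff₀ hpos] at h4
    nlinarith
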